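/- **Setting (quartic $O(N)^3$ tensor model).** Vacuum graphs are connected $4$-regular graphs whose edges are properly colored by $0,1,2,3$ and such that the connected components (*bubbles*) of the subgraph of edges of colors $1,2,3$ are *tetrahedra* ($K_4$, properly edge-colored) or *pillows* of color $i\in\{1,2,3\}$ (four vertices, two pairs of vertices each joined by two parallel edges of the colors $j,k\neq i$, the two pairs being joined by two edges of color $i$). The graph has $n_t$ tetrahedra and $n_p$ pillows. A *face* of color $i$ is a cycle alternating the colors $0$ and $i$, $F$ is the number of faces, and the *degree* is $\omega=3+\tfrac32 n_t+2n_p-F$. A *2-point graph* is obtained by cutting an edge of color $0$ into two external (distinguishable) half-edges; the single edge of color $0$ is also a 2-point graph, and then regluing its two ends gives a closed loop, counted as one face of each color. The degree of a 2-point graph is that of the vacuum graph obtained by regluing the two half-edges. A *melonic 2-point subgraph* is a 2-point subgraph (other than an edge) of degree $0$; removing it means replacing it with an edge of color $0$. A *dipole* of color $i$ is a 4-point subgraph which is either a pillow of color $i$, or made of two distinct tetrahedra together with two edges of color $0$ forming with them a face of color $i$ of length two. Its four external half-edges are split into two sides: for a pillow, two half-edges are on the same side if they are joined by the two edges of colors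 $\ne i$; for two tetrahedra, two external half-edges, one on each tetrahedron, are on the same side if they are joined by a path of colors $j,0,j$ for some (equivalently both) $j\neq i$ through the dipole. A dipole is *isolated* if it shares no bubble with any dipole that has a different set of bubbles. A *chain* is an isolated dipole, or a sequence of at least two pairwise bubble-disjoint dipoles in which one side of each dipole is connected to one side of the next one by two edges of color $0$ (using both sides of every interior dipole); it is of color $i$ if all its dipoles are, and *broken* if it has no color. A chain is *maximal* if it is not contained in a longer one. The *scheme* of a 2-point graph is obtained by removing all melonic 2-point subgraphs, and then replacing every maximal chain with a chain-vertex of the same type (color $i$, or broken), which remembers the two sides of the chain and which half-edges of the two sides face each other. A *scheme of degree $\omega$* is the scheme of a 2-point graph of degree $\omega$. **Theorem.** 1. For every $\omega\in\frac{\mathbb N}{2}$ the set of schemes of degree $\omega$ (up to isomorphism) is finite. 2. If $\omega>0$, every scheme of degree $\omega$ has at most $7\omega-1$ chain-vertices. 3. For all $\omega$ and $k$ there is a constant $n_{\omega,k}$ such that every vacuum graph of degree $\omega$ with exactly $k$ isolated dipoles has at most $n_{\omega,k}$ bubbles. -/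

import Mathlib

namespace QuarticTensor

/-- Positions of the four half-edges of color `0` at a quartic node. Every node is used up to
translations of this Klein four-group. For nodes having two sides, a position is a pair
`(side, rail)`. -/
abbrev Pos : Type := ZMod 2 × ZMod 2

/-- The colors `1, 2, 3` of the indices of the tensor (written `0, 1, 2`). -/
abbrev Color : Type := Fin 3

/-- The quartic bubbles: the tetrahedron and the pillows of color `i`. -/
inductive Bubble : Type
  | tetra : Bubble
  | pillow (i : Color) : Bubble

/-- The three nonzero elements of the Klein four-group, one for each color. -/
def colorVec : Color → Pos := ![(1, 0), (0, 1), (1, 1)]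

/-- The edge of color `c` at position `x` of a bubble `b` leads to the position
`x + b.shift c`. In the tetrahedron the three colors give the three perfect matchings of
`K₄`; in the pillow of color `i` the edges of the two colors other than `i` are parallel (they
join the two positions of a same side), and the edges of color `i` join the two sides. -/
def Bubble.shift : Bubble → Color → Pos
  | .tetra, c => colorVec c
  | .pillow i, c => if c = i then (1, 0) else (0, 1)

/-- Connected graphs with quartic nodes labelled by `K` and with `n` external legs. The half-edges
of color `0` are the pairs (node, position); the map `E` is the perfect matching given by the edges
of color `0`, the endpoints of which are half-edges of nodes or (free ends of) external legs.
It is used with `n = 0` (vacuum graphs) and `n = 2` (2-point graphs). -/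
structure Graph (K : Type) (n : ℕ) : Type 1 where
  V : Type
  finite : Finite V
  kind : V → K
  E : (V × Pos) ⊕ Fin n → (V × Pos) ⊕ Fin n
  E_invol : ∀ h, E (E h) = h
  E_ne : ∀ h, E h ≠ h
  nonempty : Nonempty ((V × Pos) ⊕ Fin n)
  connected : ∀ h h' : (V × Pos) ⊕ Fin n,
    Relation.EqvGen
      (fun x y => E x = y ∨
        Sum.elim (fun p => some p.1) (fun _ => none) x =
          (Sum.elim (fun p => some p.1) (fun _ => none) y : Option V)) h h'

namespace Graph

variable {K : Type} {n : ℕ}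

/-- Half-edges of color `0` together with the free ends of the external legs. -/
abbrev H (G : Graph K n) : Type := (G.V × Pos) ⊕ Fin n

/-- The half-edge at position `x` of the node `v`. -/
def at' (G : Graph K n) (v : G.V) (x : Pos) : G.H := Sum.inl (v, x)

/-- Graphs are considered up to relabelling of the nodes and up to the symmetries (translations of
the positions) of each node; the external legs are distinguishable. -/
def Iso (G G' : Graph K n) : Prop :=
  ∃ (f : G.V ≃ G'.V) (t : G.V → Pos),
    (∀ v, G'.kind (f v) = G.kind v) ∧
    ∀ h : G.H,
      G'.E (Sum.map (fun p => (f p.1, p.2 + t p.1)) id h) =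
        Sum.map (fun p => (f p.1, p.2 + t p.1)) id (G.E h)

theorem Iso.refl (G : Graph K n) : Iso G G := by
  refine ⟨Equiv.refl _, fun _ => 0, fun _ => rfl, fun h => ?_⟩
  have key : ∀ x : G.H,
      (Sum.map (fun p : G.V × Pos => ((Equiv.refl G.V) p.1, p.2 + 0)) id x : G.H) = x := by
    rintro (⟨v, x⟩ | l) <;> simp
  rw [key, key]

theorem Iso.symm {G G' : Graph K n} (h : Iso G G') : Iso G' G := by
  obtain ⟨f, t, hk, hE⟩ := h
  refine ⟨f.symm, fun v => - t (f.symm v), fun v => ?_, fun h => ?_⟩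
  · rw [← hk]; simp
  · set φ : G.H → G'.H := Sum.map (fun p => (f p.1, p.2 + t p.1)) id with hφ
    set ψ : G'.H → G.H := Sum.map (fun p => (f.symm p.1, p.2 + - t (f.symm p.1))) id with hψ
    have h1 : ∀ x, ψ (φ x) = x := by
      rintro (⟨v, x⟩ | l) <;> simp [hφ, hψ]
    have h2 : ∀ x, φ (ψ x) = x := by
      rintro (⟨v, x⟩ | l) <;> simp [hφ, hψ]
    have := hE (ψ h)
    rw [h2] at this
    rw [this, h1]

theorem Iso.trans {G G' G'' : Graph K n} (h : Iso G G') (h' : Iso G' G'') : Iso G G'' := by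
  obtain ⟨f, t, hk, hE⟩ := h
  obtain ⟨f', t', hk', hE'⟩ := h'
  refine ⟨f.trans f', fun v => t v + t' (f v), fun v => ?_, fun h => ?_⟩
  · simp [hk, hk']
  · have key : ∀ x : G.H,
        (Sum.map (fun p : G.V × Pos => ((f.trans f') p.1, p.2 + (t p.1 + t' (f p.1)))) id x :
          G''.H) =
        Sum.map (fun p : G'.V × Pos => (f' p.1, p.2 + t' p.1)) id
          (Sum.map (fun p : G.V × Pos => (f p.1, p.2 + t p.1)) id x) := by
      rintro (⟨v, x⟩ | l) <;> simp [add_assoc]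
    rw [key, key, hE', hE]

/-- Isomorphism as an equivalence relation. -/
instance isoSetoid (K : Type) (n : ℕ) : Setoid (Graph K n) :=
  ⟨Iso, Iso.refl, Iso.symm, Iso.trans⟩

end Graph

/-- Connected vacuum graphs of the quartic `O(N)³` model. -/
abbrev VacuumGraph : Type 1 := Graph Bubble 0

/-- Connected 2-point graphs of the quartic `O(N)³` model, including the graph reduced to a
single edge of color `0`. -/
abbrev TwoPointGraph : Type 1 := Graph Bubble 2

namespace Graph

variable {n : ℕ}

/-- The edges of color `c`. The two legs of a 2-point graph are glued together, so that the
faces are those of the vacuum graph obtained by connecting its two external half-edges. -/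
def colorStep (G : Graph Bubble n) (c : Color) : G.H → G.H :=
  Sum.elim (fun p => Sum.inl (p.1, p.2 + (G.kind p.1).shift c)) (fun l => Sum.inr l.rev)

/-- Faces of color `c`: cycles alternating edges of color `0` and `c`. -/
def Face (G : Graph Bubble n) (c : Color) : Type :=
  Quot (fun x y : G.H => G.E x = y ∨ G.colorStep c x = y)

/-- The number of faces. -/
noncomputable def numFaces (G : Graph Bubble n) : ℕ := ∑ c : Color, Nat.card (G.Face c)

/-- The number of tetrahedral bubbles. -/
noncomputable def numTetra (G : Graph Bubble n) : ℕ := Nat.card {v : G.V // G.kind v = .tetra}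

/-- The number of pillows. -/
noncomputable def numPillow (G : Graph Bubble n) : ℕ :=
  Nat.card {v : G.V // ∃ i, G.kind v = .pillow i}

/-- The degree `ω = 3 + (3/2) n_t + 2 n_p - F`; for a 2-point graph, it is the degree of the vacuum
graph obtained by connecting the two external half-edges. -/
noncomputable def degree (G : Graph Bubble n) : ℚ :=
  3 + 3 / 2 * (G.numTetra : ℚ) + 2 * (G.numPillow : ℚ) - (G.numFaces : ℚ)

/-- `G` is obtained from `G'` by inserting the 2-point graph `M` on the edge of color `0` having
`x` as one of its ends. -/
def IsInsertion (G G' M : TwoPointGraph) (x : G'.H) : Prop :=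
  ∃ f : G'.V ⊕ M.V ≃ G.V,
    (∀ v, G.kind (f (Sum.inl v)) = G'.kind v) ∧
    (∀ v, G.kind (f (Sum.inr v)) = M.kind v) ∧
    let e : G'.H → G.H := Sum.map (fun p => (f (Sum.inl p.1), p.2)) id
    let m : M.V × Pos → G.H := fun p => Sum.inl (f (Sum.inr p.1), p.2)
    (∀ y, y ≠ x → y ≠ G'.E x → G.E (e y) = e (G'.E y)) ∧
    (∀ p q, M.E (Sum.inl p) = Sum.inl q → G.E (m p) = m q) ∧
    (∀ p, M.E (Sum.inl p) = Sum.inr 0 → G.E (m p) = e x) ∧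
    (∀ p, M.E (Sum.inl p) = Sum.inr 1 → G.E (m p) = e (G'.E x))

/-- `G'` is obtained from `G` by removing a melonic 2-point subgraph, that is a 2-point subgraph
of degree `0` which is not reduced to an edge. -/
def MelonRemoval (G G' : TwoPointGraph) : Prop :=
  ∃ (M : TwoPointGraph) (x : G'.H), Nonempty M.V ∧ M.degree = 0 ∧ IsInsertion G G' M x

/-- `G₀` is obtained from `G` by removing all melonic 2-point subgraphs. -/
def IsMelonFreeCore (G G₀ : TwoPointGraph) : Prop :=
  Relation.ReflTransGen MelonRemoval G G₀ ∧ ¬ ∃ G', MelonRemoval G₀ G'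

/-- Dipoles of color `i`, with their set of bubbles and their four external half-edges
`p (side, rail)`. A dipole of type I consists of two tetrahedra sharing two edges of color `0`
which form a face of color `i` of length two; a dipole of type II is a pillow. The two
half-edges of a same side come from cutting one edge of an elementary melon. -/
inductive IsDipole (G : Graph Bubble n) : Color → Set G.V → (Pos → G.H) → Prop
  | typeI {i j : Color} {u v : G.V} {a b : Pos}
      (hu : G.kind u = .tetra) (hv : G.kind v = .tetra) (huv : u ≠ v) (hij : j ≠ i)
      (h₁ : G.E (G.at' u a) = G.at' v b)
      (h₂ : G.E (G.at' u (a + colorVec i)) = G.at' v (b + colorVec i)) :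
      IsDipole G i {u, v} (fun x =>
        if x.2 = 0 then G.at' u (a + colorVec j + x.1 • colorVec i)
        else G.at' v (b + colorVec j + x.1 • colorVec i))
  | typeII {i : Color} {v : G.V} (t : Pos) (hv : G.kind v = .pillow i) :
      IsDipole G i {v} (fun x => G.at' v (x + t))

/-- The set of bubbles `A` of a dipole overlaps no other dipole: any dipole using other bubbles is
bubble-disjoint from it. -/
def IsIsolated (G : Graph Bubble n) (A : Set G.V) : Prop :=
  ∀ (i : Color) (B : Set G.V) (p : Pos → G.H), IsDipole G i B p → B = A ∨ Disjoint A B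

/-- The number of isolated dipoles; a dipole is determined by its four external half-edges. -/
noncomputable def numIsolatedDipoles (G : Graph Bubble n) : ℕ :=
  Set.ncard {X : Set G.H | ∃ i A p, IsDipole G i A p ∧ G.IsIsolated A ∧ X = Set.range p}

/-- Sequences of dipoles, of colors given by the list, in which one side (side `1`) of each dipole
is matched to one side (side `0`) of the next one. -/
inductive IsDipoleSeq (G : Graph Bubble n) : List Color → Set G.V → (Pos → G.H) → Prop
  | single {i : Color} {A : Set G.V} {p : Pos → G.H} (h : IsDipole G i A p) :
      IsDipoleSeq G [i] A p
  | cons {i : Color} {A B : Set G.V} {l : List Color} {p q : Pos → G.H}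
      (h : IsDipole G i A p) (hs : IsDipoleSeq G l B q) (hAB : Disjoint A B)
      (hE : ∀ r : ZMod 2, G.E (p (1, r)) = q (0, r)) :
      IsDipoleSeq G (i :: l) (A ∪ B) (fun x => if x.1 = 0 then p x else q x)

/-- A chain is an isolated dipole, or is made of at least two dipoles connected in sequence. -/
def IsChain (G : Graph Bubble n) (l : List Color) (A : Set G.V) (p : Pos → G.H) : Prop :=
  IsDipoleSeq G l A p ∧ (2 ≤ l.length ∨ G.IsIsolated A)

/-- A chain which cannot be included in a longer one. -/
def IsMaximalChain (G : Graph Bubble n) (l : List Color) (A : Set G.V) (p : Pos → G.H) : Prop :=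
  G.IsChain l A p ∧ ∀ l' A' p', G.IsChain l' A' p' → ¬ A ⊂ A'

end Graph

/-- The nodes of a scheme: bubbles, chain-vertices `C_i` and broken chain-vertices `B`. -/
inductive SchemeNode : Type
  | bubble (b : Bubble) : SchemeNode
  | chain (i : Color) : SchemeNode
  | broken : SchemeNode

/-- Graphs made of bubbles and chain-vertices, with two external legs. -/
abbrev SchemeGraph : Type 1 := Graph SchemeNode 2

/-- `S` is obtained from `G` by replacing every maximal chain with a chain-vertex of the same type.
Here `A s` is the set of bubbles of `G` represented by the node `s`, and `P s` gives the half-edges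
of `G` attached to the half-edges of `s`. -/
def IsChainReplacement (G : TwoPointGraph) (S : SchemeGraph) : Prop :=
  ∃ (A : S.V → Set G.V) (P : S.V → Pos → G.H),
    (∀ v, ∃! s, v ∈ A s) ∧
    (∀ s b, S.kind s = .bubble b →
      ∃ (v : G.V) (t : Pos), G.kind v = b ∧ A s = {v} ∧ (∀ x, P s x = G.at' v (x + t)) ∧
        ∀ l A' p', G.IsChain l A' p' → v ∉ A') ∧
    (∀ s i, S.kind s = .chain i →
      ∃ l, G.IsMaximalChain l (A s) (P s) ∧ ∀ c ∈ l, c = i) ∧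
    (∀ s, S.kind s = .broken →
      ∃ l, G.IsMaximalChain l (A s) (P s) ∧ ¬ ∃ i, ∀ c ∈ l, c = i) ∧
    ∀ h : S.H,
      G.E (Sum.elim (fun q => P q.1 q.2) Sum.inr h) =
        Sum.elim (fun q => P q.1 q.2) Sum.inr (S.E h)

/-- `S` is the scheme of the 2-point graph `G`: all melonic 2-point subgraphs are removed,
then all maximal chains are replaced with chain-vertices of the same type. -/
def IsSchemeOf (S : SchemeGraph) (G : TwoPointGraph) : Prop :=
  ∃ G₀ : TwoPointGraph, G.IsMelonFreeCore G₀ ∧ IsChainReplacement G₀ S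

/-- `S` is a scheme of degree `ω`, i.e. the scheme of some 2-point graph of degree `ω`. -/
def IsSchemeOfDegree (ω : ℚ) (S : SchemeGraph) : Prop :=
  ∃ G : TwoPointGraph, G.degree = ω ∧ IsSchemeOf S G

/-- The set of (isomorphism classes of) schemes of degree `ω`. -/
def schemesOfDegree (ω : ℚ) : Set (Quotient (Graph.isoSetoid SchemeNode 2)) :=
  {s | ∃ S : SchemeGraph, IsSchemeOfDegree ω S ∧ Quotient.mk _ S = s}

/-- The number of chain-vertices (broken or not). -/
noncomputable def numChainVertices (S : SchemeGraph) : ℕ :=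
  Nat.card {s : S.V // (∃ i, S.kind s = .chain i) ∨ S.kind s = .broken}

end QuarticTensor

/-!
Graphs are replaced by *nets* (`Net`): half-edges with an involution `E` for the edges of color `0`
and involutions `X 0`, `X 1`, `X 2` for the edges of the bubbles. Nets may be disconnected, and may
contain *pairs*, which are marks on the edges of color `0` of weight zero.

**Degree and genera.** The colors `0`, `j`, `k` of a net define a closed surface, a jacket, in which
the faces of the third color `i` are curves. The degree is half the sum of the genera of the three
jackets, so it is nonnegative (`Net.deg_nonneg`). More precisely, it is at least half the number of
curves of color `i` that are independent in the homology modulo two of a jacket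
(`Net.le_two_mul_deg`). Two kinds of configurations give such curves and are therefore bounded in
number by the degree: faces through an odd number of tetrahedra, which intersect themselves an odd
number of times (`Net.card_odd_le`), and overlapping dipoles, whose two faces of length two cross
once (`Net.card_center_le`).

**Size of a net.** In terms of the curvature `2 / l - 1 / 2` of a face of length `l` at each of
its half-edges, the total curvature is controlled by the degree. Faces of length one or three are odd
or close to a tadpole. If faces of length two are also under control, then so are the faces of length
at least five, and all other faces have length four. In a region where all faces have length four,
the relations between the involutions `E`, `X 0`, `X 1` are those of a finite group, so that a
connected component that contains a large flat ball has at most `64` half-edges. Hence the size of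
the net is bounded (`Net.card_le`).

**Vacuum graphs.** A face of length two is a tadpole, or a dipole that is isolated or overlaps
another dipole; pillows are isolated dipoles. The bound on the number of bubbles in terms of the
degree and of the number of isolated dipoles follows (`Graph.exists_card_le_of_isolated`).

**Schemes.** Removing a melon does not increase the degree (`Graph.degree_le_of_melonRemoval`).
In a scheme with `m` chain-vertices, cut each chain-vertex between its two sides, which become pairs.
If the resulting net `Graph.cutNet` has `k` components, its degree is at most `ω - 1 - m + k`, and
`k ≤ m + 1` (`Graph.Replacement.deg_cutNet_le`, `Graph.deg_cutNet_le`). Each component meets a side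
of a chain-vertex. A component of degree zero that does not contain the legs meets at least three of
them (`Graph.Replacement.five_le_card_pairs`): otherwise its curvature forces a face of length two,
hence a tadpole, overlapping dipoles or both sides of a chain, and without tetrahedra the component
would close a chain into a melon or join two maximal chains. Counting the `2 m` sides gives
`m = 0` or `m ≤ 6 ω - 2` (`Graph.Replacement.card_chainNodes_le`), which is stronger than
`m ≤ 7 ω - 1` for `ω ≥ 1 / 2`. The size bound, applied to the cut scheme, then leaves finitely many
schemes of each degree.
-/

namespace QuarticTensor

/-! ### Classes of generated equivalence relations -/

open scoped Classical in
/-- The class of `h` under the equivalence relation generated by `r`, as a finite set. -/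
noncomputable def cls {H : Type*} [Fintype H] (r : H → H → Prop) (h : H) : Finset H :=
  Finset.univ.filter fun y => Quot.mk r h = Quot.mk r y

section Counting

variable {H : Type*} [Fintype H]

theorem mem_cls {r : H → H → Prop} {h y : H} : y ∈ cls r h ↔ Quot.mk r h = Quot.mk r y := by
  simp [cls]

theorem self_mem_cls (r : H → H → Prop) (h : H) : h ∈ cls r h := mem_cls.2 rfl

theorem cls_eq_of_mem {r : H → H → Prop} {h y : H} (hy : y ∈ cls r h) : cls r y = cls r h := by
  rw [mem_cls] at hy
  ext z
  rw [mem_cls, mem_cls, hy]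

theorem card_cls_pos (r : H → H → Prop) (h : H) : 0 < (cls r h).card :=
  Finset.card_pos.2 ⟨h, self_mem_cls r h⟩

/-- A set containing `h` and stable under `r` in both directions contains the class of `h`. -/
theorem cls_subset {r : H → H → Prop} {h : H} {A : Finset H} (hh : h ∈ A)
    (hA : ∀ x y, r x y → (x ∈ A ↔ y ∈ A)) : cls r h ⊆ A := by
  intro y hy
  rw [mem_cls] at hy
  have : Quot.lift (fun x => x ∈ A) (fun x y hxy => propext (hA x y hxy)) (Quot.mk r y) := by
    rw [← hy]; exact hh
  exact this

open scoped Classical in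
/-- A sum over all points can be averaged over the classes. -/
theorem sum_card_quot (r : H → H → Prop) (f : H → ℚ) :
    ∑ h, (∑ y ∈ cls r h, f y) / ((cls r h).card : ℚ) = ∑ h, f h := by
  have : ∀ h, (∑ y ∈ cls r h, f y) / ((cls r h).card : ℚ)
      = ∑ y, if Quot.mk r h = Quot.mk r y then f y / ((cls r y).card : ℚ) else 0 := by
    intro h
    rw [Finset.sum_div, ← Finset.sum_filter]
    refine Finset.sum_congr rfl fun y hy => ?_
    rw [cls_eq_of_mem (h := h) hy]
  simp_rw [this]
  rw [Finset.sum_comm]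
  refine Finset.sum_congr rfl fun y _ => ?_
  have h2 : ∀ h, (if Quot.mk r h = Quot.mk r y then f y / ((cls r y).card : ℚ) else 0)
      = if h ∈ cls r y then f y / ((cls r y).card : ℚ) else 0 := by
    intro h
    simp only [mem_cls, eq_comm]
  simp_rw [h2]
  rw [Finset.sum_ite_mem, Finset.univ_inter, Finset.sum_const, nsmul_eq_mul]
  have := card_cls_pos r y
  field_simp

open scoped Classical in
/-- The classes are counted by weighting each point with the inverse of the size of its class. -/
theorem card_quot_eq_sum (r : H → H → Prop) :
    (Nat.card (Quot r) : ℚ) = ∑ h, 1 / ((cls r h).card : ℚ) := by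
  have : Fintype (Quot r) := Fintype.ofFinite _
  rw [← Finset.sum_fiberwise (s := Finset.univ) (g := fun h => Quot.mk r h)]
  have : ∀ q : Quot r,
      ∑ h ∈ Finset.univ.filter (fun h => Quot.mk r h = q), 1 / ((cls r h).card : ℚ) = 1 := by
    intro q
    induction q using Quot.ind with
    | mk a =>
    have e : Finset.univ.filter (fun h => Quot.mk r h = Quot.mk r a) = cls r a := by
      ext y; simp [cls, eq_comm]
    rw [e]
    have : ∀ y ∈ cls r a, 1 / ((cls r y).card : ℚ) = 1 / ((cls r a).card : ℚ) := by
      intro y hy; rw [cls_eq_of_mem hy]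
    rw [Finset.sum_congr rfl this, Finset.sum_const, nsmul_eq_mul]
    have := card_cls_pos r a
    field_simp
  rw [Finset.sum_congr rfl (fun q _ => this q)]
  simp

end Counting

section QuotCard

variable {H : Type*} [Finite H]

/-- A coarser relation has fewer classes. -/
theorem card_quot_le_of_imp {r r' : H → H → Prop}
    (h : ∀ x y, r x y → Quot.mk r' x = Quot.mk r' y) : Nat.card (Quot r') ≤ Nat.card (Quot r) := by
  refine Nat.card_le_card_of_surjective (Quot.lift (Quot.mk r') h) ?_
  intro q
  induction q using Quot.ind with
  | mk a => exact ⟨Quot.mk r a, rfl⟩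

open scoped Classical in
/-- Identifying two more points removes at most one class. -/
theorem card_quot_le_add_one (r : H → H → Prop) (a b : H) :
    Nat.card (Quot r) ≤ Nat.card (Quot fun x y => r x y ∨ (x = a ∧ y = b)) + 1 := by
  set r' : H → H → Prop := fun x y => r x y ∨ (x = a ∧ y = b) with hr'
  let f : Quot r → Quot r' := Quot.lift (Quot.mk r') fun x y h => Quot.sound (Or.inl h)
  let g : Quot r' → Quot r := Quot.lift
    (fun x => if Quot.mk r x = Quot.mk r b then Quot.mk r a else Quot.mk r x) (by
      rintro x y (h | ⟨rfl, rfl⟩)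
      · simp only [Quot.sound h]
      · simp)
  have hgf : ∀ q, q ≠ Quot.mk r b → g (f q) = q := by
    intro q
    induction q using Quot.ind with
    | mk x => intro hx; simp [f, g, hx]
  have hinj : Function.Injective
      (fun q : Quot r => if q = Quot.mk r b then none else some (f q)) := by
    intro q q' h
    by_cases h1 : q = Quot.mk r b <;> by_cases h2 : q' = Quot.mk r b <;> simp [h1, h2] at h ⊢
    rw [← hgf q h1, ← hgf q' h2, h]
  have := Nat.card_le_card_of_injective _ hinj
  simpa [Finite.card_option] using this

/-- Identifying two inequivalent points removes a class. -/
theorem card_quot_add_one_le (r : H → H → Prop) (a b : H) (h : Quot.mk r a ≠ Quot.mk r b) :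
    Nat.card (Quot fun x y => r x y ∨ (x = a ∧ y = b)) + 1 ≤ Nat.card (Quot r) := by
  set r' : H → H → Prop := fun x y => r x y ∨ (x = a ∧ y = b) with hr'
  let f : Quot r → Quot r' := Quot.lift (Quot.mk r') fun x y h => Quot.sound (Or.inl h)
  have := Fintype.ofFinite (Quot r)
  have := Fintype.ofFinite (Quot r')
  rw [Nat.card_eq_fintype_card, Nat.card_eq_fintype_card]
  refine Fintype.card_lt_of_surjective_not_injective f ?_ ?_
  · intro q
    induction q using Quot.ind with
    | mk a => exact ⟨Quot.mk r a, rfl⟩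
  · intro hf
    exact h (hf (Quot.sound (Or.inr ⟨rfl, rfl⟩)))

end QuotCard

section Involutions

variable {H : Type*}

theorem even_card_of_invol {A : Finset H} {f : H → H} (hf : ∀ h, f (f h) = h) (hne : ∀ h, f h ≠ h)
    (hA : ∀ h ∈ A, f h ∈ A) : Even A.card := by
  have : ∑ x ∈ A, (1 : ZMod 2) = 0 :=
    Finset.sum_involution (fun a _ => f a) (fun _ _ => by decide) (fun a _ _ => hne a)
      (fun a ha => hA a ha) (fun a _ => hf a)
  rw [Finset.sum_const, nsmul_eq_mul, mul_one] at this
  exact (ZMod.natCast_eq_zero_iff_even).1 this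

theorem sum_eq_zero_of_invol {A : Finset H} {f : H → H} (hf : ∀ h, f (f h) = h)
    (hne : ∀ h, f h ≠ h) (hA : ∀ h ∈ A, f h ∈ A) (g : H → ZMod 2) (hg : ∀ h ∈ A, g (f h) = g h) :
    ∑ x ∈ A, g x = 0 :=
  Finset.sum_involution (fun a _ => f a)
    (fun a ha => by rw [hg a ha]; exact CharTwo.add_self_eq_zero _) (fun a _ _ => hne a)
    (fun a ha => hA a ha) (fun a _ => hf a)

/-- A fixed-point free involution of a finite set has a transversal. -/
theorem exists_transversal [Finite H] (A : Finset H) {f : H → H} (hf : ∀ h, f (f h) = h)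
    (hne : ∀ h, f h ≠ h) (hA : ∀ h ∈ A, f h ∈ A) :
    ∃ T ⊆ A, (∀ h ∈ A, (h ∈ T ↔ f h ∉ T)) ∧ 2 * T.card = A.card := by
  classical
  have := Fintype.ofFinite H
  let e := Fintype.equivFin H
  refine ⟨A.filter fun h => e h < e (f h), Finset.filter_subset _ _, ?_, ?_⟩
  · intro h hh
    have := hA h hh
    have h3 : e h ≠ e (f h) := fun h' => hne h (e.injective h').symm
    simp only [Finset.mem_filter, hh, this, true_and, hf, not_lt]
    exact ⟨le_of_lt, fun h' => lt_of_le_of_ne h' h3⟩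
  · have h1 := Finset.card_filter_add_card_filter_not (s := A) (fun h => e h < e (f h))
    have h2 : (A.filter fun h => ¬ e h < e (f h)).card = (A.filter fun h => e h < e (f h)).card := by
      refine Finset.card_bij' (fun h _ => f h) (fun h _ => f h) ?_ ?_ ?_ ?_
      · intro h hh
        simp only [Finset.mem_filter, not_lt, hf] at hh ⊢
        exact ⟨hA h hh.1, lt_of_le_of_ne hh.2 fun h' => hne h (e.injective h')⟩
      · intro h hh
        simp only [Finset.mem_filter, not_lt, hf] at hh ⊢
        exact ⟨hA h hh.1, hh.2.le⟩
      · intro h _; exact hf h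
      · intro h _; exact hf h
    omega

/-- The two ends of a path are joined: if the involution `X` is disabled on an `X`-stable finite
set `F`, then any point of `F` is still connected to another point of `F`. -/
theorem exists_path_end [Finite H] {E X : H → H} (hE : ∀ h, E (E h) = h) (hEne : ∀ h, E h ≠ h)
    (hX : ∀ h, X (X h) = h) (hXne : ∀ h, X h ≠ h) (F : Set H) (hF : ∀ h ∈ F, X h ∈ F) {a : H}
    (ha : a ∈ F) :
    ∃ b ∈ F, b ≠ a ∧ Quot.mk (fun x y => E x = y ∨ (x ∉ F ∧ X x = y)) a = Quot.mk _ b := by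
  classical
  have := Fintype.ofFinite H
  set r : H → H → Prop := fun x y => E x = y ∨ (x ∉ F ∧ X x = y) with hr
  by_contra! hcon
  have h1 : Even (cls r a).card := by
    refine even_card_of_invol hE hEne fun h hh => ?_
    rw [mem_cls] at hh ⊢
    rw [hh]; exact Quot.sound (Or.inl rfl)
  have h2 : Even ((cls r a).erase a).card := by
    refine even_card_of_invol hX hXne fun h hh => ?_
    rw [Finset.mem_erase, mem_cls] at hh ⊢
    have hhF : h ∉ F := fun hf => hcon h hf hh.1 hh.2
    have hXF : X h ∉ F := fun hf => hhF (by simpa [hX] using hF _ hf)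
    refine ⟨fun h' => hXF (h' ▸ ha), ?_⟩
    rw [hh.2]; exact Quot.sound (Or.inr ⟨hhF, rfl⟩)
  rw [Finset.card_erase_of_mem (self_mem_cls r a)] at h2
  have := card_cls_pos r a
  rcases h1 with ⟨x, hx⟩
  rcases h2 with ⟨y, hy⟩
  omega

end Involutions

/-! ### Homology modulo two of three involutions -/

/-- Functions modulo two constant on the classes of `r`. -/
def Inv {H : Type*} (r : H → H → Prop) : Submodule (ZMod 2) (H → ZMod 2) where
  carrier := {f | ∀ x y, r x y → f x = f y}
  add_mem' := fun hf hg x y h => by simp [hf x y h, hg x y h]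
  zero_mem' := fun _ _ _ => rfl
  smul_mem' := fun c f hf x y h => by simp [hf x y h]

/-- The space of functions constant on the classes has the number of classes as its dimension. -/
theorem finrank_Inv {H : Type*} [Finite H] (r : H → H → Prop) :
    Module.finrank (ZMod 2) (Inv r) = Nat.card (Quot r) := by
  have := Fintype.ofFinite (Quot r)
  let e : Inv r ≃ₗ[ZMod 2] (Quot r → ZMod 2) :=
    { toFun := fun f => Quot.lift f.1 f.2
      map_add' := fun f g => by
        ext q; induction q using Quot.ind with
        | mk a => rfl
      map_smul' := fun f g => by
        ext q; induction q using Quot.ind with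
        | mk a => rfl
      invFun := fun g => ⟨fun x => g (Quot.mk r x), fun x y h => congrArg g (Quot.sound h)⟩
      left_inv := fun f => by ext x; rfl
      right_inv := fun g => by
        ext q; induction q using Quot.ind with
        | mk a => rfl }
  rw [e.finrank_eq, Module.finrank_pi, Nat.card_eq_fintype_card]

/-- Two points are joined by one of the maps `α`, `β`. -/
def rel2 {H : Type*} (α β : H → H) : H → H → Prop := fun x y => α x = y ∨ β x = y

/-- Two points are joined by one of the maps `α`, `β`, `γ`. -/
def rel3 {H : Type*} (α β γ : H → H) : H → H → Prop := fun x y => α x = y ∨ β x = y ∨ γ x = y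

section Euler

variable {H : Type*}

theorem mem_Inv1 {α : H → H} {f : H → ZMod 2} :
    f ∈ Inv (fun x y => α x = y) ↔ ∀ x, f (α x) = f x :=
  ⟨fun h x => (h x _ rfl).symm, fun h x y hxy => by rw [← hxy, h]⟩

theorem mem_Inv2 {α β : H → H} {f : H → ZMod 2} :
    f ∈ Inv (rel2 α β) ↔ (∀ x, f (α x) = f x) ∧ ∀ x, f (β x) = f x :=
  ⟨fun h => ⟨fun x => (h x _ (Or.inl rfl)).symm, fun x => (h x _ (Or.inr rfl)).symm⟩,
    fun h x y hxy => by rcases hxy with rfl | rfl <;> simp [h.1, h.2]⟩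

theorem mem_Inv3 {α β γ : H → H} {f : H → ZMod 2} :
    f ∈ Inv (rel3 α β γ) ↔ (∀ x, f (α x) = f x) ∧ (∀ x, f (β x) = f x) ∧ ∀ x, f (γ x) = f x :=
  ⟨fun h => ⟨fun x => (h x _ (Or.inl rfl)).symm, fun x => (h x _ (Or.inr (Or.inl rfl))).symm,
    fun x => (h x _ (Or.inr (Or.inr rfl))).symm⟩,
    fun h x y hxy => by rcases hxy with rfl | rfl | rfl <;> simp [h.1, h.2.1, h.2.2]⟩

theorem two_mul_finrank_Inv1 [Finite H] {α : H → H} (hα : ∀ h, α (α h) = h) (hne : ∀ h, α h ≠ h) :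
    2 * Module.finrank (ZMod 2) (Inv fun x y => α x = y) = Nat.card H := by
  classical
  have := Fintype.ofFinite H
  rw [finrank_Inv]
  have h1 := card_quot_eq_sum (fun x y : H => α x = y)
  have h2 : ∀ h, cls (fun x y : H => α x = y) h = {h, α h} := by
    intro h
    apply Finset.Subset.antisymm
    · refine cls_subset (by simp) ?_
      rintro x y rfl
      simp only [Finset.mem_insert, Finset.mem_singleton]
      constructor
      · rintro (rfl | rfl)
        · exact Or.inr rfl
        · exact Or.inl (hα _)
      · rintro (h' | h')
        · right; rw [← h', hα]
        · left; rw [← hα x, h', hα]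
    · intro y hy
      simp only [Finset.mem_insert, Finset.mem_singleton] at hy
      rcases hy with rfl | rfl
      · exact self_mem_cls _ _
      · exact mem_cls.2 (Quot.sound rfl)
  have h3 : ∀ h, ((cls (fun x y : H => α x = y) h).card : ℚ) = 2 := by
    intro h
    rw [h2, Finset.card_pair (hne h).symm]; norm_num
  simp_rw [h3] at h1
  rw [Finset.sum_const, nsmul_eq_mul, Finset.card_univ] at h1
  rw [Nat.card_eq_fintype_card (α := H)]
  have : (2 * Nat.card (Quot fun x y : H => α x = y) : ℚ) = Fintype.card H := by
    rw [h1]; ring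
  exact_mod_cast this

/-- The image of the boundary map from edges to points has codimension at most the number of
connected components. -/
theorem card_le_finrank_sup [Finite H] {α β γ : H → H} (hα : ∀ h, α (α h) = h)
    (hβ : ∀ h, β (β h) = h) (hγ : ∀ h, γ (γ h) = h) :
    Nat.card H ≤ Module.finrank (ZMod 2) ((Inv (fun x y => α x = y) ⊔ Inv (fun x y => β x = y) ⊔
      Inv (fun x y => γ x = y) : Submodule (ZMod 2) (H → ZMod 2))) + Nat.card (Quot (rel3 α β γ)) := by
  classical
  have := Fintype.ofFinite H
  set U : Submodule (ZMod 2) (H → ZMod 2) := Inv (fun x y => α x = y) ⊔ Inv (fun x y => β x = y) ⊔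
      Inv (fun x y => γ x = y) with hU
  have h1 := Subspace.finrank_add_finrank_dualAnnihilator_eq U
  rw [Module.finrank_pi, ← Nat.card_eq_fintype_card] at h1
  rw [← h1, ← finrank_Inv]
  refine Nat.add_le_add_left ?_ _
  have key : ∀ (δ : H → H), (∀ h, δ (δ h) = h) → Inv (fun x y => δ x = y) ≤ U →
      ∀ ψ ∈ U.dualAnnihilator, ∀ h,
        ψ (Pi.single (δ h) (1 : ZMod 2)) = ψ (Pi.single h (1 : ZMod 2)) := by
    intro δ hδ hle ψ hψ h
    -- `ψ` vanishes on the indicator of each edge `{h, δ h}`, so it takes the same value at the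
    -- two ends.
    have hu : (Pi.single h (1 : ZMod 2) + Pi.single (δ h) 1 : H → ZMod 2) ∈ U := by
      refine hle (mem_Inv1.2 fun x => ?_)
      have e1 : δ x = h ↔ x = δ h := ⟨fun e => by rw [← e, hδ], fun e => by rw [e, hδ]⟩
      have e2 : δ x = δ h ↔ x = h := ⟨fun e => by rw [← hδ x, e, hδ], fun e => by rw [e]⟩
      simp only [Pi.add_apply, Pi.single_apply, e1, e2]
      ring
    have := (Submodule.mem_dualAnnihilator ψ).1 hψ _ hu
    rw [map_add] at this
    exact ((CharTwo.add_eq_zero).1 this).symm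
  -- an annihilator is determined by its values on the points, which are constant on components
  let L : U.dualAnnihilator →ₗ[ZMod 2] Inv (rel3 α β γ) :=
    { toFun := fun ψ => ⟨fun h => ψ.1 (Pi.single h 1), mem_Inv3.2
        ⟨key α hα (le_sup_of_le_left le_sup_left) ψ.1 ψ.2,
         key β hβ (le_sup_of_le_left le_sup_right) ψ.1 ψ.2,
         key γ hγ le_sup_right ψ.1 ψ.2⟩⟩
      map_add' := fun _ _ => rfl
      map_smul' := fun _ _ => rfl }
  refine LinearMap.finrank_le_finrank_of_injective (f := L) ?_
  intro ψ ψ' h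
  refine Subtype.ext (LinearMap.pi_ext' fun i => LinearMap.ext_ring ?_)
  exact congrFun (congrArg Subtype.val h) i

set_option maxHeartbeats 800000 in
/-- Euler's inequality for the (possibly non-orientable) closed surface glued from three
fixed-point free involutions, with the number of independent cycles as a correction: the cycles
`a i + b i + c i` are detected by the functionals `φ i`, which vanish on boundaries. -/
theorem euler_le [Finite H] {α β γ : H → H} (hα : ∀ h, α (α h) = h) (hβ : ∀ h, β (β h) = h)
    (hγ : ∀ h, γ (γ h) = h) (hα' : ∀ h, α h ≠ h) (hβ' : ∀ h, β h ≠ h) (hγ' : ∀ h, γ h ≠ h)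
    {N : ℕ} (a b c : Fin N → H → ZMod 2) (ha : ∀ i, a i ∈ Inv fun x y => α x = y)
    (hb : ∀ i, b i ∈ Inv fun x y => β x = y) (hc : ∀ i, c i ∈ Inv fun x y => γ x = y)
    (habc : ∀ i, a i + b i + c i = 0) (φ : Fin N → (H → ZMod 2) →ₗ[ZMod 2] ZMod 2)
    (hφ : ∀ i, ∀ f ∈ Inv (rel2 α β), φ i f = 0) (hφ' : ∀ i, ∀ f ∈ Inv (rel2 β γ), φ i f = 0)
    (hpair : ∀ i j, φ i (b j) = if i = j then 1 else 0) :
    2 * (Nat.card (Quot (rel2 α β)) + Nat.card (Quot (rel2 α γ)) + Nat.card (Quot (rel2 β γ)))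
      + 2 * N ≤ Nat.card H + 4 * Nat.card (Quot (rel3 α β γ)) := by
  classical
  have := Fintype.ofFinite H
  let Kα := Inv fun x y => α x = y
  let Kβ := Inv fun x y => β x = y
  let Kγ := Inv fun x y => γ x = y
  -- chain complex of the surface: `d2` goes from faces to edges, `d1` from edges to points; an
  -- edge of each type is a class of one involution
  let d1 : (Kα × Kβ × Kγ) →ₗ[ZMod 2] (H → ZMod 2) :=
    Kα.subtype.coprod (Kβ.subtype.coprod Kγ.subtype)
  have hd1 : ∀ p, d1 p = p.1.1 + (p.2.1.1 + p.2.2.1) := fun p => rfl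
  have r1 : LinearMap.range d1 = Kα ⊔ Kβ ⊔ Kγ := by
    simp only [d1, LinearMap.range_coprod, Submodule.range_subtype, sup_assoc]
  have n1 := LinearMap.finrank_range_add_finrank_ker d1
  have n1' := card_le_finrank_sup hα hβ hγ
  rw [r1, Module.finrank_prod, Module.finrank_prod] at n1
  have kα : 2 * Module.finrank (ZMod 2) Kα = _ := two_mul_finrank_Inv1 hα hα'
  have kβ : 2 * Module.finrank (ZMod 2) Kβ = _ := two_mul_finrank_Inv1 hβ hβ'
  have kγ : 2 * Module.finrank (ZMod 2) Kγ = _ := two_mul_finrank_Inv1 hγ hγ'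
  have i1 : ∀ {f}, f ∈ Inv (rel2 α β) → f ∈ Kα ∧ f ∈ Kβ := fun h =>
    ⟨mem_Inv1.2 (mem_Inv2.1 h).1, mem_Inv1.2 (mem_Inv2.1 h).2⟩
  have i2 : ∀ {f}, f ∈ Inv (rel2 α γ) → f ∈ Kα ∧ f ∈ Kγ := fun h =>
    ⟨mem_Inv1.2 (mem_Inv2.1 h).1, mem_Inv1.2 (mem_Inv2.1 h).2⟩
  have i3 : ∀ {f}, f ∈ Inv (rel2 β γ) → f ∈ Kβ ∧ f ∈ Kγ := fun h =>
    ⟨mem_Inv1.2 (mem_Inv2.1 h).1, mem_Inv1.2 (mem_Inv2.1 h).2⟩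
  let d2 : (Inv (rel2 α β) × Inv (rel2 α γ) × Inv (rel2 β γ)) →ₗ[ZMod 2] LinearMap.ker d1 :=
    { toFun := fun p => ⟨(⟨p.1.1 + p.2.1.1, Kα.add_mem (i1 p.1.2).1 (i2 p.2.1.2).1⟩,
          ⟨p.1.1 + p.2.2.1, Kβ.add_mem (i1 p.1.2).2 (i3 p.2.2.2).1⟩,
          ⟨p.2.1.1 + p.2.2.1, Kγ.add_mem (i2 p.2.1.2).2 (i3 p.2.2.2).2⟩), by
        rw [LinearMap.mem_ker, hd1]
        have e : ∀ x : H → ZMod 2, x + x = 0 := fun x => by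
          ext h; exact CharTwo.add_self_eq_zero _
        calc (p.1.1 + p.2.1.1) + ((p.1.1 + p.2.2.1) + (p.2.1.1 + p.2.2.1))
            = (p.1.1 + p.1.1) + (p.2.1.1 + p.2.1.1) + (p.2.2.1 + p.2.2.1) := by abel
          _ = 0 := by simp only [e]⟩
      map_add' := fun p q => by
        refine Subtype.ext (Prod.ext (Subtype.ext ?_) (Prod.ext (Subtype.ext ?_) (Subtype.ext ?_)))
        all_goals
          simp only [Prod.fst_add, Prod.snd_add, Submodule.coe_add]
          abel
      map_smul' := fun t p => by
        refine Subtype.ext (Prod.ext (Subtype.ext ?_) (Prod.ext (Subtype.ext ?_) (Subtype.ext ?_)))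
        all_goals
          simp }
  have n2 := LinearMap.finrank_range_add_finrank_ker d2
  rw [Module.finrank_prod, Module.finrank_prod, finrank_Inv, finrank_Inv, finrank_Inv] at n2
  -- the kernel of `d2` consists of functions constant on the connected components
  have n2' : Module.finrank (ZMod 2) (LinearMap.ker d2) ≤ Nat.card (Quot (rel3 α β γ)) := by
    rw [← finrank_Inv]
    have hk : ∀ p : LinearMap.ker d2, p.1.1.1 = p.1.2.1.1 ∧ p.1.1.1 = p.1.2.2.1 := by
      rintro ⟨p, hp⟩
      rw [LinearMap.mem_ker] at hp
      have h1 := congrArg (fun x => x.1.1.1) hp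
      have h2 := congrArg (fun x => x.1.2.1.1) hp
      constructor
      · ext h; exact CharTwo.add_eq_zero.1 (congrFun h1 h)
      · ext h; exact CharTwo.add_eq_zero.1 (congrFun h2 h)
    let L : LinearMap.ker d2 →ₗ[ZMod 2] Inv (rel3 α β γ) :=
      { toFun := fun p => ⟨p.1.1.1, mem_Inv3.2 ⟨(mem_Inv2.1 p.1.1.2).1, (mem_Inv2.1 p.1.1.2).2, by
          rw [(hk p).1]; exact (mem_Inv2.1 p.1.2.1.2).2⟩⟩
        map_add' := fun _ _ => rfl
        map_smul' := fun _ _ => rfl }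
    refine LinearMap.finrank_le_finrank_of_injective (f := L) ?_
    intro p q h
    have h0 : p.1.1.1 = q.1.1.1 := congrArg (fun f : Inv (rel3 α β γ) => f.1) h
    refine Subtype.ext (Prod.ext (Subtype.ext h0) (Prod.ext (Subtype.ext ?_) (Subtype.ext ?_)))
    · rw [← (hk p).1, ← (hk q).1, h0]
    · rw [← (hk p).2, ← (hk q).2, h0]
  -- `Φ` is onto and kills the image of `d2`, so the first homology has dimension at least `N`
  let Φ : LinearMap.ker d1 →ₗ[ZMod 2] (Fin N → ZMod 2) :=
    LinearMap.pi fun i => (φ i).comp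
      (Kβ.subtype.comp ((LinearMap.fst _ _ _).comp ((LinearMap.snd _ _ _).comp
        (LinearMap.ker d1).subtype)))
  have hΦ : ∀ p i, Φ p i = φ i p.1.2.1.1 := fun p i => rfl
  have n3 := LinearMap.finrank_range_add_finrank_ker Φ
  have hsurj : LinearMap.range Φ = ⊤ := by
    rw [LinearMap.range_eq_top]
    intro t
    let z : Fin N → LinearMap.ker d1 := fun j => ⟨(⟨a j, ha j⟩, ⟨b j, hb j⟩, ⟨c j, hc j⟩), by
      rw [LinearMap.mem_ker, hd1, ← add_assoc]; exact habc j⟩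
    refine ⟨∑ j, t j • z j, ?_⟩
    ext i
    rw [map_sum, Finset.sum_apply]
    have hz : ∀ j, Φ (t j • z j) i = if i = j then t j else 0 := by
      intro j
      rw [map_smul, Pi.smul_apply, hΦ]
      change t j • φ i (b j) = _
      rw [hpair]
      split_ifs <;> simp
    simp only [hz, Finset.sum_ite_eq, Finset.mem_univ, if_true]
  rw [hsurj, finrank_top, Module.finrank_pi, Fintype.card_fin] at n3
  have n4 : Module.finrank (ZMod 2) (LinearMap.range d2) ≤
      Module.finrank (ZMod 2) (LinearMap.ker Φ) := by
    refine Submodule.finrank_mono ?_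
    rintro _ ⟨p, rfl⟩
    rw [LinearMap.mem_ker]
    ext i
    rw [hΦ]
    change φ i (p.1.1 + p.2.2.1) = 0
    rw [map_add, hφ i _ p.1.2, hφ' i _ p.2.2.2, add_zero]
  change Nat.card H ≤ Module.finrank (ZMod 2) (Kα ⊔ Kβ ⊔ Kγ : Submodule _ _) + _ at n1'
  omega

end Euler

/-! ### Nets -/

/-- A closed graph of the quartic model, seen from its half-edges of color `0`: the fixed-point free
involution `E` follows the edges of color `0`, and `X c` the edges of color `c` of the bubbles. A
half-edge of kind `none` belongs to a *pair*: two half-edges joined by an edge of each color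
`1, 2, 3`, that is, a mark on an edge of color `0`. Nets need not be connected. -/
structure Net (H : Type) where
  E : H → H
  X : Color → H → H
  kind : H → Option Bubble
  E_invol : ∀ h, E (E h) = h
  E_ne : ∀ h, E h ≠ h
  X_invol : ∀ c h, X c (X c h) = h
  X_ne : ∀ c h, X c h ≠ h
  kind_X : ∀ c h, kind (X c h) = kind h
  tetra_mul : ∀ {h i j k}, kind h = some .tetra → i ≠ j → j ≠ k → i ≠ k → X i (X j h) = X k h
  pillow_eq : ∀ {h i j k}, kind h = some (.pillow i) → j ≠ i → k ≠ i → X j h = X k h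
  pillow_comm : ∀ {h i j}, kind h = some (.pillow i) → j ≠ i → X i (X j h) = X j (X i h)
  pillow_ne : ∀ {h i j}, kind h = some (.pillow i) → j ≠ i → X i h ≠ X j h
  pair_eq : ∀ {h i j}, kind h = none → X i h = X j h

/-- The contribution of a half-edge to the degree. -/
def halfEdgeWeight : Option Bubble → ℚ
  | none => 0
  | some .tetra => 3 / 8
  | some (.pillow _) => 1 / 2

/-- A lower bound for the contribution of a half-edge to the number of cycles alternating two colors
different from `i`. -/
def jacketWeight (i : Color) : Option Bubble → ℚ
  | none => 1 / 2
  | some .tetra => 1 / 4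
  | some (.pillow a) => if a = i then 1 / 2 else 1 / 4

theorem Color.third {i j k c : Color} (hij : i ≠ j) (hjk : j ≠ k) (hik : i ≠ k) :
    c = i ∨ c = j ∨ c = k := by
  revert i j k c; decide

theorem Color.exists_third (i j : Color) : ∃ k, k ≠ i ∧ k ≠ j := by
  revert i j; decide

namespace Net

variable {H : Type} (N : Net H)

theorem X_inj (c : Color) {h h' : H} : N.X c h = N.X c h' ↔ h = h' :=
  ⟨fun e => by rw [← N.X_invol c h, e, N.X_invol], fun e => by rw [e]⟩

theorem E_inj {h h' : H} : N.E h = N.E h' ↔ h = h' :=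
  ⟨fun e => by rw [← N.E_invol h, e, N.E_invol], fun e => by rw [e]⟩

theorem X_comm (c d : Color) (h : H) : N.X c (N.X d h) = N.X d (N.X c h) := by
  by_cases hcd : c = d
  · rw [hcd]
  obtain ⟨k, hkc, hkd⟩ := Color.exists_third c d
  rcases hk : N.kind h with _ | (_ | i)
  · rw [N.pair_eq (i := d) (j := c) hk, N.pair_eq (h := N.X c h) (i := d) (j := c)]
    rw [N.kind_X, hk]
  · rw [N.tetra_mul hk hcd hkd.symm hkc.symm, N.tetra_mul hk (Ne.symm hcd) hkc.symm hkd.symm]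
  · by_cases hc : c = i
    · subst hc; exact N.pillow_comm hk (Ne.symm hcd)
    · by_cases hd : d = i
      · subst hd; exact (N.pillow_comm hk hcd).symm
      · rw [N.pillow_eq hk hd hc, N.pillow_eq (h := N.X c h) (i := i) (j := d) (k := c) _ hd hc]
        rw [N.kind_X, hk]

/-- In a tetrahedron, edges of different colors lead to different vertices. -/
theorem tetra_ne {h : H} {i j : Color} (hk : N.kind h = some .tetra) (hij : i ≠ j) :
    N.X i h ≠ N.X j h := by
  obtain ⟨k, hki, hkj⟩ := Color.exists_third i j
  intro e
  have h1 := N.tetra_mul hk hij hkj.symm hki.symm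
  rw [← e, N.X_invol] at h1
  exact N.X_ne k h h1.symm

/-- Two half-edges are joined by an edge of some color. -/
def conn : H → H → Prop := fun x y => N.E x = y ∨ ∃ c, N.X c x = y

/-- The number of connected components. -/
noncomputable def comps : ℕ := Nat.card (Quot N.conn)

/-- Cycles alternating the colors `0` and `c`. -/
abbrev face (c : Color) : H → H → Prop := rel2 N.E (N.X c)

/-- The half-edges on the face of color `c` through `h`. -/
noncomputable abbrev orb [Fintype H] (c : Color) (h : H) : Finset H := cls (N.face c) h

/-- The degree, summed over the connected components. -/
noncomputable def deg [Fintype H] : ℚ :=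
  3 * (N.comps : ℚ) + ∑ h, halfEdgeWeight (N.kind h) - ∑ c, (Nat.card (Quot (N.face c)) : ℚ)

/-- A union of faces of color `i` that avoids the pillows. -/
structure IsCurve (i : Color) (S : Finset H) : Prop where
  E_mem : ∀ h ∈ S, N.E h ∈ S
  X_mem : ∀ h ∈ S, N.X i h ∈ S
  kind_mem : ∀ h ∈ S, N.kind h = some .tetra ∨ N.kind h = none

/-- A choice of one of the two half-edges each time that the curve `S` passes a tetrahedron. -/
structure IsTransversal (i : Color) (S T : Finset H) : Prop where
  subset : T ⊆ S
  kind_eq : ∀ h ∈ T, N.kind h = some .tetra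
  iff_not : ∀ h ∈ S, N.kind h = some .tetra → (h ∈ T ↔ N.X i h ∉ T)

theorem IsCurve.X_mem_iff {N : Net H} {i : Color} {S : Finset H} (hS : N.IsCurve i S) {h : H} :
    N.X i h ∈ S ↔ h ∈ S :=
  ⟨fun hh => by simpa [N.X_invol] using hS.X_mem _ hh, hS.X_mem h⟩

/-- The edges of colors `j` and `k` of a bubble form cycles with at most four half-edges. -/
theorem card_node_cls_le [Fintype H] (j k : Color) (h : H) :
    (cls (rel2 (N.X j) (N.X k)) h).card ≤ 4 := by
  classical
  have : cls (rel2 (N.X j) (N.X k)) h ⊆ {h, N.X j h, N.X k h, N.X j (N.X k h)} := by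
    refine cls_subset (by simp) ?_
    have key : ∀ x, x ∈ ({h, N.X j h, N.X k h, N.X j (N.X k h)} : Finset H) →
        N.X j x ∈ ({h, N.X j h, N.X k h, N.X j (N.X k h)} : Finset H) ∧
        N.X k x ∈ ({h, N.X j h, N.X k h, N.X j (N.X k h)} : Finset H) := by
      intro x hx
      simp only [Finset.mem_insert, Finset.mem_singleton] at hx ⊢
      have e := N.X_comm j k h
      rcases hx with rfl | rfl | rfl | rfl <;> simp [N.X_invol, N.X_comm k j]
    rintro x y (rfl | rfl)
    · exact ⟨fun h => (key x h).1, fun h => by simpa [N.X_invol] using (key _ h).1⟩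
    · exact ⟨fun h => (key x h).2, fun h => by simpa [N.X_invol] using (key _ h).2⟩
  exact (Finset.card_le_card this).trans Finset.card_le_four

/-- In a pillow of color `i`, the edges of the two other colors are parallel. -/
theorem card_pillow_cls_le [Fintype H] {i j k : Color} (hj : j ≠ i) (hk : k ≠ i) {h : H}
    (hh : N.kind h = none ∨ N.kind h = some (.pillow i)) :
    (cls (rel2 (N.X j) (N.X k)) h).card ≤ 2 := by
  classical
  have key : ∀ x, N.kind x = N.kind h → N.X k x = N.X j x := by
    intro x hx
    rcases hh with h' | h'
    · exact N.pair_eq (hx.trans h')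
    · exact N.pillow_eq (hx.trans h') hk hj
  have : cls (rel2 (N.X j) (N.X k)) h ⊆ {h, N.X j h} := by
    refine cls_subset (by simp) ?_
    have e1 : ∀ x, x ∈ ({h, N.X j h} : Finset H) → N.X k x = N.X j x := by
      intro x hx
      simp only [Finset.mem_insert, Finset.mem_singleton] at hx
      rcases hx with rfl | rfl
      · exact key _ rfl
      · exact key _ (N.kind_X _ _)
    have e2 : ∀ x, x ∈ ({h, N.X j h} : Finset H) → N.X j x ∈ ({h, N.X j h} : Finset H) := by
      intro x hx
      simp only [Finset.mem_insert, Finset.mem_singleton] at hx ⊢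
      rcases hx with rfl | rfl
      · exact Or.inr rfl
      · exact Or.inl (N.X_invol _ _)
    rintro x y (rfl | rfl)
    · exact ⟨fun h => e2 x h, fun h => by simpa [N.X_invol] using e2 _ h⟩
    · exact ⟨fun h => by rw [e1 x h]; exact e2 x h, fun h => by
        have := e2 _ h
        rwa [← e1 _ h, N.X_invol] at this⟩
  exact (Finset.card_le_card this).trans Finset.card_le_two

/-- The weights are a lower bound on the number of cycles of colors `j` and `k`, which are faces
of the jacket. -/
theorem sum_jacketWeight_le [Fintype H] {i j k : Color} (hij : i ≠ j) (hik : i ≠ k) :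
    ∑ h, jacketWeight i (N.kind h) ≤ (Nat.card (Quot (rel2 (N.X j) (N.X k))) : ℚ) := by
  rw [card_quot_eq_sum]
  refine Finset.sum_le_sum fun h _ => ?_
  have h4 : ((cls (rel2 (N.X j) (N.X k)) h).card : ℚ) ≤ 4 := by
    exact_mod_cast N.card_node_cls_le j k h
  have h0 : (0 : ℚ) < ((cls (rel2 (N.X j) (N.X k)) h).card : ℚ) := by
    exact_mod_cast card_cls_pos _ h
  have q4 : (1 / 4 : ℚ) ≤ 1 / ((cls (rel2 (N.X j) (N.X k)) h).card : ℚ) :=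
    one_div_le_one_div_of_le h0 h4
  have q2 : (N.kind h = none ∨ N.kind h = some (.pillow i)) →
      (1 / 2 : ℚ) ≤ 1 / ((cls (rel2 (N.X j) (N.X k)) h).card : ℚ) := fun hh =>
    one_div_le_one_div_of_le h0 (by exact_mod_cast N.card_pillow_cls_le hij.symm hik.symm hh)
  rcases hk : N.kind h with _ | (_ | a)
  · exact q2 (Or.inl hk)
  · exact q4
  · simp only [jacketWeight]
    split_ifs with ha
    · exact q2 (Or.inr (ha ▸ hk))
    · exact q4

open scoped Classical in
/-- Following only the colors `0`, `j`, `k`, each pillow of the third color may disconnect the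
graph once. -/
theorem card_jacket_comps_le [Fintype H] {i j k : Color} (hij : i ≠ j) (hjk : j ≠ k) (hik : i ≠ k) :
    (Nat.card (Quot (rel3 N.E (N.X j) (N.X k))) : ℚ) ≤ N.comps +
      ∑ h, if N.kind h = some (.pillow i) then (1 / 4 : ℚ) else 0 := by
  -- `Q` gathers the half-edges of the pillows of color `i`; its orbits are these pillows
  let Q : Type := {h : H // N.kind h = some (.pillow i)}
  let x (c : Color) : Q → Q := fun h => ⟨N.X c h.1, (N.kind_X c h.1).trans h.2⟩
  have hxx : ∀ c h, x c (x c h) = h := fun c h => Subtype.ext (N.X_invol _ _)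
  have hxc : ∀ h, x j (x i h) = x i (x j h) := fun h => Subtype.ext (N.X_comm _ _ _)
  have hQ : (Nat.card (Quot (rel2 (x i) (x j))) : ℚ) ≤
      ∑ h, if N.kind h = some (.pillow i) then (1 / 4 : ℚ) else 0 := by
    rw [card_quot_eq_sum, ← Finset.sum_filter]
    rw [Finset.sum_subtype (p := fun h => N.kind h = some (.pillow i))
      (Finset.univ.filter fun h => N.kind h = some (.pillow i)) (by simp) (fun _ => (1 / 4 : ℚ))]
    refine Finset.sum_le_sum fun h _ => ?_
    refine one_div_le_one_div_of_le (by norm_num) ?_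
    have h4 : ({h, x i h, x j h, x i (x j h)} : Finset Q).card = 4 := by
      have n1 : ∀ c (h : Q), x c h ≠ h := fun c h e => N.X_ne c h.1 (congrArg Subtype.val e)
      have n2 : ∀ h : Q, x i h ≠ x j h := fun h e =>
        N.pillow_ne h.2 hij.symm (congrArg Subtype.val e)
      have n3 : h ≠ x i (x j h) := fun e => n2 h (by rw [← hxx i (x j h), ← e])
      have n4 : x i h ≠ x i (x j h) := fun e => n1 j h (by rw [← hxx i (x j h), ← e, hxx])
      rw [Finset.card_insert_of_notMem, Finset.card_insert_of_notMem, Finset.card_insert_of_notMem,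
        Finset.card_singleton]
      · simpa using (n1 i (x j h)).symm
      · simpa using ⟨n2 h, n4⟩
      · simpa using ⟨(n1 i h).symm, (n1 j h).symm, n3⟩
    have hsub : ({h, x i h, x j h, x i (x j h)} : Finset Q) ⊆ cls (rel2 (x i) (x j)) h := by
      have s1 : x i h ∈ cls (rel2 (x i) (x j)) h := mem_cls.2 (Quot.sound (Or.inl rfl))
      have s2 : x j h ∈ cls (rel2 (x i) (x j)) h := mem_cls.2 (Quot.sound (Or.inr rfl))
      have s3 : x i (x j h) ∈ cls (rel2 (x i) (x j)) h :=
        mem_cls.2 ((mem_cls.1 s2).trans (Quot.sound (Or.inl rfl)))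
      intro y hy
      simp only [Finset.mem_insert, Finset.mem_singleton] at hy
      rcases hy with rfl | rfl | rfl | rfl
      · exact self_mem_cls _ _
      · exact s1
      · exact s2
      · exact s3
    have := Finset.card_le_card hsub
    rw [h4] at this
    exact_mod_cast this
  -- the defect of invariance along the edges of color `i` is one value for each pillow of `Q`,
  -- and a function without defect is constant on the connected components
  let L : Inv (rel3 N.E (N.X j) (N.X k)) →ₗ[ZMod 2] Inv (rel2 (x i) (x j)) :=
    { toFun := fun f => ⟨fun h => f.1 h.1 + f.1 (N.X i h.1), mem_Inv2.2 ⟨fun h => by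
          simp only [x, N.X_invol]; exact add_comm _ _, fun h => by
          simp only [x]
          rw [N.X_comm i j, (mem_Inv3.1 f.2).2.1, (mem_Inv3.1 f.2).2.1]⟩⟩
      map_add' := fun f g => by
        ext h
        simp only [Submodule.coe_add, Pi.add_apply]
        ring
      map_smul' := fun t f => by
        ext h
        simp [mul_add] }
  have n1 := LinearMap.finrank_range_add_finrank_ker L
  have n2 : Module.finrank (ZMod 2) (LinearMap.range L) ≤ Nat.card (Quot (rel2 (x i) (x j))) := by
    rw [← finrank_Inv]; exact Submodule.finrank_le _
  have n3 : Module.finrank (ZMod 2) (LinearMap.ker L) ≤ N.comps := by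
    rw [comps, ← finrank_Inv]
    have hf : ∀ f : LinearMap.ker L, f.1.1 ∈ Inv N.conn := by
      rintro ⟨⟨f, hf⟩, hL⟩
      rw [mem_Inv3] at hf
      rw [LinearMap.mem_ker] at hL
      have hi : ∀ h, f (N.X i h) = f h := by
        intro h
        rcases hk : N.kind h with _ | (_ | a)
        · rw [N.pair_eq (i := i) (j := j) hk, hf.2.1]
        · rw [← N.tetra_mul hk hjk hik.symm hij.symm, hf.2.1, hf.2.2]
        · by_cases ha : a = i
          · subst ha
            have := congrFun (congrArg Subtype.val hL) ⟨h, hk⟩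
            exact (CharTwo.add_eq_zero.1 this).symm
          · rcases Color.third (c := a) hij hjk hik with rfl | rfl | rfl
            · exact absurd rfl ha
            · rw [N.pillow_eq hk hij hjk.symm, hf.2.2]
            · rw [N.pillow_eq hk hik hjk, hf.2.1]
      rintro y z (rfl | ⟨c, rfl⟩)
      · exact (hf.1 y).symm
      · rcases Color.third (c := c) hij hjk hik with rfl | rfl | rfl
        · exact (hi y).symm
        · exact (hf.2.1 y).symm
        · exact (hf.2.2 y).symm
    let M : LinearMap.ker L →ₗ[ZMod 2] Inv N.conn :=
      { toFun := fun f => ⟨f.1.1, hf f⟩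
        map_add' := fun _ _ => rfl
        map_smul' := fun _ _ => rfl }
    refine LinearMap.finrank_le_finrank_of_injective (f := M) ?_
    intro f g h
    exact Subtype.ext (Subtype.ext (congrArg (fun u : Inv N.conn => u.1) h))
  rw [finrank_Inv] at n1
  have : (Nat.card (Quot (rel3 N.E (N.X j) (N.X k))) : ℚ) ≤
      N.comps + Nat.card (Quot (rel2 (x i) (x j))) := by
    have : Nat.card (Quot (rel3 N.E (N.X j) (N.X k))) ≤
      N.comps + Nat.card (Quot (rel2 (x i) (x j))) := by omega
    exact_mod_cast this
  linarith

open scoped Classical in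
/-- Euler's inequality for the jacket of the colors `j` and `k`, whose straight curves are the faces
of the third color `i`. The curves `S a` and `S' b` cross an odd number of times exactly when
`a = b`; such curves are independent in the homology of the jacket. -/
theorem jacket_le [Fintype H] {i j k : Color} (hij : i ≠ j) (hjk : j ≠ k) (hik : i ≠ k) {M : ℕ}
    (S S' T : Fin M → Finset H) (hS : ∀ a, N.IsCurve i (S a)) (hS' : ∀ a, N.IsCurve i (S' a))
    (hT : ∀ a, N.IsTransversal i (S' a) (T a))
    (hpair : ∀ a b, (((T b).filter fun t => ¬ (t ∈ S a ↔ N.X j t ∈ S a)).card : ZMod 2) =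
      if a = b then 1 else 0) :
    2 * ((Nat.card (Quot (N.face j)) : ℚ) + Nat.card (Quot (N.face k)) +
      ∑ h, jacketWeight i (N.kind h)) + 2 * M ≤
      Nat.card H + 4 * (N.comps + ∑ h, if N.kind h = some (.pillow i) then (1 / 4 : ℚ) else 0) := by
  -- indicator functions modulo two
  let ind (A : Finset H) (h : H) : ZMod 2 := if h ∈ A then 1 else 0
  have hTk : ∀ a h, h ∈ T a → N.kind h = some .tetra := fun a => (hT a).kind_eq
  have ind_zero : ∀ a h, N.kind h ≠ some .tetra → ind (T a) h = 0 := by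
    intro a h hh
    exact if_neg fun h' => hh (hTk a h h')
  let P : Finset H := Finset.univ.filter fun h => N.kind h = none
  -- crossing form with `S a`: sum over the half-edges of `S a` whose edge of color `j` leaves it
  let φ : Fin M → (H → ZMod 2) →ₗ[ZMod 2] ZMod 2 := fun a =>
    ∑ h ∈ (S a).filter (fun h => N.X j h ∉ S a), LinearMap.proj h
  have hφ : ∀ a f, φ a f = ∑ h ∈ (S a).filter (fun h => N.X j h ∉ S a), f h := by
    intro a f; simp [φ]
  have hrel : ∀ a, ∀ h ∈ S a, N.X j h ∉ S a → N.kind h = some .tetra := by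
    intro a h h1 h2
    rcases (hS a).kind_mem h h1 with h3 | h3
    · exact h3
    · rw [N.pair_eq (i := j) (j := i) h3] at h2
      exact absurd ((hS a).X_mem h h1) h2
  -- the cycle `S' b` is split into an edge part of color `0` and corrections inside the bubbles,
  -- which the transversal `T b` distributes over the colors `j` and `k`
  have main := euler_le (α := N.E) (β := N.X j) (γ := N.X k) N.E_invol (N.X_invol j) (N.X_invol k)
    N.E_ne (N.X_ne j) (N.X_ne k)
    (fun a => ind (S' a))
    (fun a h => ind (T a) h + ind (T a) (N.X j h) + ind (S' a ∩ P) h)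
    (fun a h => ind (T a) (N.X j h) + ind (T a) (N.X i h))
    (fun a => mem_Inv1.2 fun h => by
      have : N.E h ∈ S' a ↔ h ∈ S' a :=
        ⟨fun hh => by simpa [N.E_invol] using (hS' a).E_mem _ hh, (hS' a).E_mem h⟩
      simp only [ind, this])
    (fun a => mem_Inv1.2 fun h => by
      have : N.X j h ∈ S' a ∩ P ↔ h ∈ S' a ∩ P := by
        simp only [P, Finset.mem_inter, Finset.mem_filter, Finset.mem_univ, true_and, N.kind_X]
        refine and_congr_left fun h0 => ?_
        rw [N.pair_eq (i := j) (j := i) h0, (hS' a).X_mem_iff]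
      simp only [ind, this, N.X_invol]
      ring)
    (fun a => mem_Inv1.2 fun h => by
      by_cases hk : N.kind h = some .tetra
      · rw [N.tetra_mul hk hjk hik.symm hij.symm, N.tetra_mul hk hik hjk.symm hij]
        ring
      · have hk' : ∀ c, N.kind (N.X c h) ≠ some .tetra := fun c => by rwa [N.kind_X]
        have hk'' : ∀ c d, N.kind (N.X c (N.X d h)) ≠ some .tetra := fun c d => by
          rw [N.kind_X]; exact hk' d
        simp only [ind_zero _ _ (hk' _), ind_zero _ _ (hk'' _ _)])
    (fun a => by
      ext h
      simp only [Pi.add_apply, Pi.zero_apply]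
      rcases hk : N.kind h with _ | (_ | c)
      · have hn : ∀ c, N.kind (N.X c h) ≠ some .tetra := fun c => by simp [N.kind_X, hk]
        have hn' : N.kind h ≠ some .tetra := by simp [hk]
        rw [ind_zero _ _ (hn _), ind_zero _ _ (hn _), ind_zero _ _ hn']
        have : h ∈ S' a ∩ P ↔ h ∈ S' a := by simp [P, hk]
        simp only [ind, this]
        split_ifs <;> decide
      · have hn : ind (S' a ∩ P) h = 0 := if_neg (by simp [P, hk])
        have : ind (S' a) h = ind (T a) h + ind (T a) (N.X i h) := by
          simp only [ind]
          by_cases h1 : h ∈ S' a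
          · have := (hT a).iff_not h h1 hk
            by_cases h2 : h ∈ T a
            · have h3 := this.1 h2
              simp [h1, h2, h3]
            · have h3 : N.X i h ∈ T a := by
                by_contra h3; exact h2 (this.2 h3)
              simp [h1, h2, h3]
          · have h2 : h ∉ T a := fun h2 => h1 ((hT a).subset h2)
            have h3 : N.X i h ∉ T a := fun h3 =>
              h1 ((hS' a).X_mem_iff.1 ((hT a).subset h3))
            simp [h1, h2, h3]
        rw [this, hn]
        generalize ind (T a) h = p, ind (T a) (N.X i h) = q, ind (T a) (N.X j h) = r
        revert p q r; decide
      · have hn : ∀ c, N.kind (N.X c h) ≠ some .tetra := fun c => by simp [N.kind_X, hk]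
        have hn' : N.kind h ≠ some .tetra := by simp [hk]
        rw [ind_zero _ _ (hn _), ind_zero _ _ (hn _), ind_zero _ _ hn']
        have h1 : h ∉ S' a := fun h1 => by
          rcases (hS' a).kind_mem h h1 with h2 | h2 <;> simp [hk] at h2
        simp [ind, h1])
    φ
    (fun a f hf => by
      rw [hφ]
      rw [mem_Inv2] at hf
      have h1 := Finset.sum_filter_add_sum_filter_not (S a) (fun h => N.X j h ∉ S a) f
      have h2 : ∑ h ∈ S a, f h = 0 :=
        sum_eq_zero_of_invol N.E_invol N.E_ne (hS a).E_mem f fun h _ => hf.1 h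
      have h3 : ∑ h ∈ (S a).filter (fun h => ¬ N.X j h ∉ S a), f h = 0 := by
        refine sum_eq_zero_of_invol (N.X_invol j) (N.X_ne j) ?_ f fun h _ => hf.2 h
        intro h hh
        simp only [Finset.mem_filter, not_not, N.X_invol] at hh ⊢
        exact hh.symm
      rw [h2, h3, add_zero] at h1
      exact h1)
    (fun a f hf => by
      rw [hφ]
      rw [mem_Inv2] at hf
      refine sum_eq_zero_of_invol (N.X_invol i) (N.X_ne i) ?_ f ?_
      · intro h hh
        simp only [Finset.mem_filter] at hh ⊢
        refine ⟨(hS a).X_mem _ hh.1, ?_⟩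
        rw [N.X_comm, (hS a).X_mem_iff]
        exact hh.2
      · intro h hh
        simp only [Finset.mem_filter] at hh
        rw [← N.tetra_mul (hrel a h hh.1 hh.2) hjk hik.symm hij.symm, hf.1, hf.2])
    (fun a b => by
      rw [hφ, ← hpair a b]
      have h1 : ∀ h ∈ (S a).filter (fun h => N.X j h ∉ S a),
          ind (T b) h + ind (T b) (N.X j h) + ind (S' b ∩ P) h =
            ind (T b) h + ind (T b) (N.X j h) := by
        intro h hh
        simp only [Finset.mem_filter] at hh
        have : h ∉ S' b ∩ P := by simp [P, hrel a h hh.1 hh.2]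
        simp [ind, this]
      rw [Finset.sum_congr rfl h1, Finset.sum_add_distrib]
      have h2 : ∑ h ∈ (S a).filter (fun h => N.X j h ∉ S a), ind (T b) h =
          (((T b).filter fun t => t ∈ S a ∧ N.X j t ∉ S a).card : ZMod 2) := by
        simp only [ind, Finset.sum_boole]
        congr 2
        ext h
        simp only [Finset.mem_filter]
        tauto
      have h3 : ∑ h ∈ (S a).filter (fun h => N.X j h ∉ S a), ind (T b) (N.X j h) =
          (((T b).filter fun t => N.X j t ∈ S a ∧ t ∉ S a).card : ZMod 2) := by
        simp only [ind, Finset.sum_boole]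
        congr 1
        refine Finset.card_bij' (fun h _ => N.X j h) (fun h _ => N.X j h) ?_ ?_ ?_ ?_
        · intro h hh
          simp only [Finset.mem_filter, N.X_invol] at hh ⊢
          exact ⟨hh.2, hh.1⟩
        · intro h hh
          simp only [Finset.mem_filter, N.X_invol] at hh ⊢
          exact ⟨hh.2, hh.1⟩
        · intro h _; exact N.X_invol _ _
        · intro h _; exact N.X_invol _ _
      rw [h2, h3, ← Nat.cast_add, ← Finset.card_union_of_disjoint]
      · congr 2
        ext h
        simp only [Finset.mem_union, Finset.mem_filter]
        tauto
      · rw [Finset.disjoint_left]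
        intro h h1 h2
        simp only [Finset.mem_filter] at h1 h2
        exact h1.2.2 h2.2.1)
  have main' : (2 * (Nat.card (Quot (N.face j)) + Nat.card (Quot (N.face k)) +
      Nat.card (Quot (rel2 (N.X j) (N.X k)))) + 2 * M : ℚ) ≤
      Nat.card H + 4 * Nat.card (Quot (rel3 N.E (N.X j) (N.X k))) := by
    exact_mod_cast main
  have q1 := N.sum_jacketWeight_le hij hik
  have q2 := N.card_jacket_comps_le hij hjk hik
  linarith

open scoped Classical in
/-- The Euler characteristics of the three jackets add up to the degree. -/
theorem sum_weights [Fintype H] : ∑ i : Color, (2 * ∑ h, jacketWeight i (N.kind h) -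
      4 * ∑ h, if N.kind h = some (.pillow i) then (1 / 4 : ℚ) else 0) =
    3 * Nat.card H - 4 * ∑ h, halfEdgeWeight (N.kind h) := by
  rw [Nat.card_eq_fintype_card]
  have e : (3 * Fintype.card H : ℚ) = ∑ h : H, (3 : ℚ) := by simp [mul_comm]
  rw [e]
  simp only [Finset.mul_sum, ← Finset.sum_sub_distrib]
  rw [Finset.sum_comm]
  refine Finset.sum_congr rfl fun h _ => ?_
  rcases N.kind h with _ | (_ | c)
  · simp [jacketWeight, halfEdgeWeight]
  · simp [jacketWeight, halfEdgeWeight]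
    try norm_num
  · fin_cases c <;> simp [jacketWeight, halfEdgeWeight, Fin.sum_univ_three] <;> norm_num

open scoped Classical in
/-- The degree is half the sum of the (non-orientable) genera of the jackets, hence it is at least
half the number of independent curves in a jacket. -/
theorem le_two_mul_deg [Fintype H] {i j k : Color} (hij : i ≠ j) (hjk : j ≠ k) (hik : i ≠ k)
    {M : ℕ} (S S' T : Fin M → Finset H) (hS : ∀ a, N.IsCurve i (S a))
    (hS' : ∀ a, N.IsCurve i (S' a)) (hT : ∀ a, N.IsTransversal i (S' a) (T a))
    (hpair : ∀ a b, (((T b).filter fun t => ¬ (t ∈ S a ↔ N.X j t ∈ S a)).card : ZMod 2) =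
      if a = b then 1 else 0) :
    (M : ℚ) ≤ 2 * N.deg := by
  have h1 := N.jacket_le hij hjk hik S S' T hS hS' hT hpair
  -- for the two other jackets, no curve is needed
  have h0 : ∀ {i j k : Color}, i ≠ j → j ≠ k → i ≠ k → _ := fun {i j k} hij hjk hik =>
    N.jacket_le (i := i) (j := j) (k := k) hij hjk hik (M := 0) Fin.elim0 Fin.elim0 Fin.elim0
      (fun a => a.elim0) (fun a => a.elim0) (fun a => a.elim0) (fun a => a.elim0)
  have h2 := h0 hij.symm hik hjk
  have h3 := h0 hik.symm hij hjk.symm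
  have hw := N.sum_weights
  have hsum : ∀ f : Color → ℚ, ∑ c, f c = f i + f j + f k := by
    intro f
    rw [Fin.sum_univ_three]
    clear h1 h2 h3 hw hpair hT hS hS' h0
    revert hij hjk hik
    fin_cases i <;> fin_cases j <;> fin_cases k <;> intro hij hjk hik <;>
      first
      | exact absurd rfl hij
      | exact absurd rfl hjk
      | exact absurd rfl hik
      | (simp; try ring)
  rw [hsum] at hw
  rw [deg, hsum]
  push_cast at h2 h3
  linarith

/-- The degree is half the sum of the genera of the jackets. -/
theorem deg_nonneg [Fintype H] : 0 ≤ N.deg := by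
  have := N.le_two_mul_deg (i := 0) (j := 1) (k := 2) (by decide) (by decide) (by decide) (M := 0)
    Fin.elim0 Fin.elim0 Fin.elim0
      (fun a => a.elim0) (fun a => a.elim0) (fun a => a.elim0) (fun a => a.elim0)
  push_cast at this
  linarith

end Net

/-! ### Sparse families of curves -/

/-- Greedy selection: if every item is in conflict with at most `t` items, then a proportion `1 / t`
of the items can be chosen without conflicts. -/
theorem exists_conflict_free {ι : Type*} (r : ι → ι → Prop) (hsymm : ∀ a b, r a b → r b a) (t : ℕ)
    (I : Finset ι) (hrefl : ∀ a ∈ I, r a a)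
    (ht : ∀ a ∈ I, ∀ B ⊆ I, (∀ b ∈ B, r a b) → B.card ≤ t) :
    ∃ J ⊆ I, (∀ a ∈ J, ∀ b ∈ J, a ≠ b → ¬ r a b) ∧ I.card ≤ t * J.card := by
  classical
  induction I using Finset.strongInduction with
  | H I ih =>
  rcases I.eq_empty_or_nonempty with rfl | ⟨a, ha⟩
  · exact ⟨∅, by simp⟩
  · have hlt : I.filter (fun b => ¬ r a b) ⊂ I :=
      Finset.filter_ssubset.2 ⟨a, ha, by simpa using hrefl a ha⟩
    obtain ⟨J, hJ, hJ1, hJ2⟩ := ih _ hlt (fun b hb => hrefl b (Finset.mem_filter.1 hb).1)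
      (fun b hb B hB h => ht b (Finset.mem_filter.1 hb).1 B (hB.trans (Finset.filter_subset _ _)) h)
    have haJ : ∀ b ∈ J, ¬ r a b := fun b hb => (Finset.mem_filter.1 (hJ hb)).2
    have hnot : a ∉ J := fun h => haJ a h (hrefl a ha)
    refine ⟨insert a J, ?_, ?_, ?_⟩
    · exact Finset.insert_subset ha (hJ.trans (Finset.filter_subset _ _))
    · intro b hb c hc hbc
      rw [Finset.mem_insert] at hb hc
      rcases hb with rfl | hb <;> rcases hc with rfl | hc
      · exact absurd rfl hbc
      · exact haJ c hc
      · exact fun h => haJ b hb (hsymm _ _ h)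
      · exact hJ1 b hb c hc hbc
    · have h1 := Finset.card_filter_add_card_filter_not (s := I) (fun b => r a b)
      have h2 := ht a ha (I.filter fun b => r a b) (Finset.filter_subset _ _)
        (fun b hb => (Finset.mem_filter.1 hb).2)
      rw [Finset.card_insert_of_notMem hnot, mul_add]
      omega

namespace Net

variable {H : Type} (N : Net H)

/-- `y` is `x`, or is joined to `x` by one edge of a bubble. -/
def Adj (x y : H) : Prop := y = x ∨ ∃ d, y = N.X d x

variable {N} in
theorem Adj.symm {x y : H} (h : N.Adj x y) : N.Adj y x := by
  rcases h with rfl | ⟨d, rfl⟩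
  · exact Or.inl rfl
  · exact Or.inr ⟨d, (N.X_invol d x).symm⟩

theorem adj_X (x : H) (d : Color) : N.Adj x (N.X d x) := Or.inr ⟨d, rfl⟩

variable {N} in
theorem Adj.X {x y : H} (hx : N.kind x = some .tetra) (h : N.Adj x y) (c : Color) :
    N.Adj x (N.X c y) := by
  rcases h with rfl | ⟨d, rfl⟩
  · exact N.adj_X _ _
  · by_cases hcd : c = d
    · rw [hcd, N.X_invol]; exact Or.inl rfl
    · obtain ⟨k, hkc, hkd⟩ := Color.exists_third c d
      rw [N.tetra_mul hx hcd hkd.symm hkc.symm]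
      exact N.adj_X _ _

variable {N} in
theorem Adj.kind_eq {x y : H} (h : N.Adj x y) : N.kind y = N.kind x := by
  rcases h with rfl | ⟨d, rfl⟩
  · rfl
  · exact N.kind_X _ _

variable {N} in
theorem Adj.trans {x y z : H} (hx : N.kind x = some .tetra) (h : N.Adj x y) (h' : N.Adj y z) :
    N.Adj x z := by
  rcases h' with rfl | ⟨d, rfl⟩
  · exact h
  · exact h.X hx d

open scoped Classical in
/-- The half-edges adjacent to `x`. -/
noncomputable def nbhd (x : H) : Finset H := {x, N.X 0 x, N.X 1 x, N.X 2 x}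

theorem mem_nbhd {x y : H} : y ∈ N.nbhd x ↔ N.Adj x y := by
  simp only [nbhd, Finset.mem_insert, Finset.mem_singleton, Adj, Fin.exists_fin_succ]
  simp

theorem card_nbhd_le (x : H) : (N.nbhd x).card ≤ 4 := by
  classical exact Finset.card_le_four

/-- Two sets of half-edges that share no bubble. -/
def Far (A B : Finset H) : Prop := ∀ y ∈ A, ∀ z ∈ B, ¬ N.Adj y z

/-- Among items with small supports, a positive proportion have pairwise distant supports. -/
theorem exists_far (I : Finset H) (U : H → Finset H) (s t : ℕ)
    (hne : ∀ h ∈ I, (U h).Nonempty) (hs : ∀ h ∈ I, (U h).card ≤ s)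
    (ht : ∀ z, ∀ B ⊆ I, (∀ h ∈ B, z ∈ U h) → B.card ≤ t) :
    ∃ J ⊆ I, (∀ a ∈ J, ∀ b ∈ J, a ≠ b → N.Far (U a) (U b)) ∧ I.card ≤ s * (4 * t) * J.card := by
  classical
  obtain ⟨J, h1, h2, h3⟩ := exists_conflict_free
    (fun a b => ∃ y ∈ U a, ∃ z ∈ U b, N.Adj y z)
    (by rintro a b ⟨y, hy, z, hz, h⟩; exact ⟨z, hz, y, hy, h.symm⟩) (s * (4 * t)) I
    (fun a ha => by
      obtain ⟨y, hy⟩ := hne a ha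
      exact ⟨y, hy, y, hy, Or.inl rfl⟩)
    (fun a ha B hB hr => by
      have hsub : B ⊆ (U a).biUnion fun y => (N.nbhd y).biUnion fun z => B.filter fun b => z ∈ U b := by
        intro b hb
        obtain ⟨y, hy, z, hz, h⟩ := hr b hb
        simp only [Finset.mem_biUnion, Finset.mem_filter]
        exact ⟨y, hy, z, N.mem_nbhd.2 h, hb, hz⟩
      refine (Finset.card_le_card hsub).trans ?_
      refine (Finset.card_biUnion_le_card_mul _ _ (4 * t) fun y _ => ?_).trans
        (Nat.mul_le_mul_right _ (hs a ha))
      refine (Finset.card_biUnion_le_card_mul _ _ t fun z _ => ?_).trans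
        (Nat.mul_le_mul_right _ (N.card_nbhd_le y))
      exact ht z _ ((Finset.filter_subset _ _).trans hB) fun b hb => (Finset.mem_filter.1 hb).2)
  refine ⟨J, h1, fun a ha b hb hab y hy z hz h => h2 a ha b hb hab ⟨y, hy, z, hz, h⟩, h3⟩

/-- A tetrahedron in the middle of two overlapping dipoles of color `c`: the face of color `c`
through `y` has length two and goes through another tetrahedron, the face of color `c` through
`X c' y` has length two and goes through a third tetrahedron. -/
structure IsCenter (N : Net H) (c c' : Color) (y : H) : Prop where
  ne : c' ≠ c
  kind : N.kind y = some .tetra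
  kind₁ : N.kind (N.E y) = some .tetra
  kind₂ : N.kind (N.E (N.X c' y)) = some .tetra
  face₁ : N.E (N.X c y) = N.X c (N.E y)
  face₂ : N.E (N.X c (N.X c' y)) = N.X c (N.E (N.X c' y))
  not_adj₁ : ¬ N.Adj y (N.E y)
  not_adj₂ : ¬ N.Adj y (N.E (N.X c' y))
  not_adj₃ : ¬ N.Adj (N.E y) (N.E (N.X c' y))

open scoped Classical in
/-- The half-edges `y`, `X c y`, `E y`, `X c (E y)`. -/
noncomputable def square (c : Color) (y : H) : Finset H := {y, N.X c y, N.E y, N.X c (N.E y)}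

theorem mem_square {c : Color} {y z : H} : z ∈ N.square c y ↔
    z = y ∨ z = N.X c y ∨ z = N.E y ∨ z = N.X c (N.E y) := by
  simp [square]

/-- A face of length two between tetrahedra is a curve. -/
theorem isCurve_square {c : Color} {y : H} (hy : N.kind y = some .tetra)
    (hy' : N.kind (N.E y) = some .tetra) (hf : N.E (N.X c y) = N.X c (N.E y)) :
    N.IsCurve c (N.square c y) := by
  have hf' : N.E (N.X c (N.E y)) = N.X c y := by rw [← hf, N.E_invol]
  refine ⟨?_, ?_, ?_⟩
  · intro h hh
    rw [mem_square] at hh ⊢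
    rcases hh with rfl | rfl | rfl | rfl
    · simp
    · simp [hf]
    · simp [N.E_invol]
    · simp [hf']
  · intro h hh
    rw [mem_square] at hh ⊢
    rcases hh with rfl | rfl | rfl | rfl
    · simp
    · simp [N.X_invol]
    · simp
    · simp [N.X_invol]
  · intro h hh
    rw [mem_square] at hh
    rcases hh with rfl | rfl | rfl | rfl <;> simp [N.kind_X, hy, hy']

theorem card_square_le (c : Color) (y : H) : (N.square c y).card ≤ 4 := by
  classical exact Finset.card_le_four

/-- A half-edge lies on few squares. -/
theorem card_filter_square_le {c : Color} (z : H) (f : H → H) (hf : Function.Injective f)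
    (B : Finset H) (hB : ∀ h ∈ B, N.E (N.X c (f h)) = N.X c (N.E (f h)) ∧ z ∈ N.square c (f h)) :
    B.card ≤ 4 := by
  classical
  refine le_trans ?_ (N.card_square_le c z)
  refine Finset.card_le_card_of_injOn f ?_ hf.injOn
  intro h hh
  obtain ⟨h1, h2⟩ := hB h hh
  rw [mem_square] at h2
  rw [Finset.mem_coe, mem_square]
  rcases h2 with rfl | rfl | rfl | rfl
  · simp
  · simp [N.X_invol]
  · simp [N.E_invol]
  · right; right; right
    rw [← h1, N.E_invol, N.X_invol]

open scoped Classical in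
/-- The degree bounds the number of pairwise independent curves, for curves indexed by half-edges. -/
theorem card_le_two_mul_deg [Fintype H] {i j : Color} (hij : i ≠ j) (J : Finset H)
    (S S' T : H → Finset H) (hS : ∀ a ∈ J, N.IsCurve i (S a)) (hS' : ∀ a ∈ J, N.IsCurve i (S' a))
    (hT : ∀ a ∈ J, N.IsTransversal i (S' a) (T a))
    (hodd : ∀ a ∈ J, Odd ((T a).filter fun t => ¬ (t ∈ S a ↔ N.X j t ∈ S a)).card)
    (hfar : ∀ a ∈ J, ∀ b ∈ J, a ≠ b → N.Far (S a) (T b)) :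
    (J.card : ℚ) ≤ 2 * N.deg := by
  obtain ⟨k, hki, hkj⟩ := Color.exists_third i j
  let e := J.equivFin.symm
  refine N.le_two_mul_deg hij hkj.symm hki.symm (M := J.card) (fun a => S (e a)) (fun a => S' (e a))
    (fun a => T (e a)) (fun a => hS _ (e a).2) (fun a => hS' _ (e a).2) (fun a => hT _ (e a).2) ?_
  intro a b
  by_cases hab : a = b
  · subst hab
    rw [if_pos rfl]
    exact (ZMod.natCast_eq_one_iff_odd).2 (hodd _ (e a).2)
  · rw [if_neg hab]
    have hne : (e a : H) ≠ e b := fun h => hab (e.injective (Subtype.ext h))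
    have h0 := hfar _ (e a).2 _ (e b).2 hne
    rw [Finset.filter_false_of_mem]
    · simp
    · intro t ht
      rw [not_not]
      refine iff_of_false (fun h => h0 t h t ht (Or.inl rfl)) (fun h => ?_)
      exact h0 _ h t ht (Or.inr ⟨j, (N.X_invol j t).symm⟩)

variable [Fintype H]

theorem E_mem_orb {c : Color} {h y : H} (hy : y ∈ N.orb c h) : N.E y ∈ N.orb c h :=
  mem_cls.2 ((mem_cls.1 hy).trans (Quot.sound (Or.inl rfl)))

theorem X_mem_orb {c : Color} {h y : H} (hy : y ∈ N.orb c h) : N.X c y ∈ N.orb c h :=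
  mem_cls.2 ((mem_cls.1 hy).trans (Quot.sound (Or.inr rfl)))

theorem orb_subset {c : Color} {h : H} {A : Finset H} (hh : h ∈ A) (hE : ∀ x ∈ A, N.E x ∈ A)
    (hX : ∀ x ∈ A, N.X c x ∈ A) : N.orb c h ⊆ A := by
  refine cls_subset hh ?_
  rintro x y (rfl | rfl)
  · exact ⟨hE x, fun h => by simpa [N.E_invol] using hE _ h⟩
  · exact ⟨hX x, fun h => by simpa [N.X_invol] using hX _ h⟩

theorem even_card_orb (c : Color) (h : H) : Even (N.orb c h).card :=
  even_card_of_invol N.E_invol N.E_ne fun _ hy => N.E_mem_orb hy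

theorem two_le_card_orb (c : Color) (h : H) : 2 ≤ (N.orb c h).card := by
  have h1 := N.even_card_orb c h
  have h2 := card_cls_pos (N.face c) h
  rcases h1 with ⟨x, hx⟩
  simp only [orb] at hx ⊢
  omega

open scoped Classical in
/-- The half-edges of tetrahedra on a face. -/
noncomputable def tetraOrb (c : Color) (h : H) : Finset H :=
  (N.orb c h).filter fun y => N.kind y = some .tetra

/-- A face of color `c` without self-crossings that crosses an odd number of tetrahedra; it is a
one-sided curve in the jacket of the two other colors. -/
structure IsOddFace (c : Color) (h : H) : Prop where
  kind_mem : ∀ y ∈ N.orb c h, N.kind y = some .tetra ∨ N.kind y = none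
  simple : ∀ y ∈ N.tetraOrb c h, ∀ d, d ≠ c → N.X d y ∉ N.orb c h
  card_mod : (N.tetraOrb c h).card % 4 = 2

/-- Distant odd faces are independent in the homology of a jacket: each of them has odd
self-intersection. -/
theorem card_le_of_odd_of_far {c : Color} (J : Finset H) (hJ : ∀ h ∈ J, N.IsOddFace c h)
    (hfar : ∀ a ∈ J, ∀ b ∈ J, a ≠ b → N.Far (N.orb c a) (N.orb c b)) :
    (J.card : ℚ) ≤ 2 * N.deg := by
  classical
  -- any color `j ≠ c` gives a jacket in which the faces of color `c` are curves
  obtain ⟨j, hj, -⟩ := Color.exists_third c c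
  have hex : ∀ h, ∃ T ⊆ N.tetraOrb c h,
      (∀ y ∈ N.tetraOrb c h, (y ∈ T ↔ N.X c y ∉ T)) ∧ 2 * T.card = (N.tetraOrb c h).card := by
    intro h
    refine exists_transversal _ (N.X_invol c) (N.X_ne c) ?_
    intro y hy
    rw [tetraOrb, Finset.mem_filter] at hy ⊢
    exact ⟨N.X_mem_orb hy.1, (N.kind_X _ _).trans hy.2⟩
  choose T hT1 hT2 hT3 using hex
  have hsub : ∀ h, N.tetraOrb c h ⊆ N.orb c h := fun h => Finset.filter_subset _ _
  have hcurve : ∀ a ∈ J, N.IsCurve c (N.orb c a) := fun a ha =>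
    ⟨fun h hh => N.E_mem_orb hh, fun h hh => N.X_mem_orb hh, (hJ a ha).kind_mem⟩
  refine N.card_le_two_mul_deg hj.symm J (N.orb c) (N.orb c) T hcurve hcurve ?_ ?_ ?_
  · intro a ha
    refine ⟨(hT1 a).trans (hsub a), fun h hh => (Finset.mem_filter.1 (hT1 a hh)).2,
      fun h hh hk => hT2 a h (Finset.mem_filter.2 ⟨hh, hk⟩)⟩
  · intro a ha
    rw [Finset.filter_true_of_mem]
    · have h1 := (hJ a ha).card_mod
      have h2 := hT3 a
      rw [Nat.odd_iff]; omega
    · intro t ht h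
      exact (hJ a ha).simple t (hT1 a ht) j hj (h.1 (hsub a (hT1 a ht)))
  · intro a ha b hb hab y hy z hz
    exact hfar a ha b hb hab y hy z (hsub b (hT1 b hz))

/-- Few half-edges lie on short faces that meet a given set. -/
theorem card_filter_le_of_orb_le (c : Color) (s : ℕ) (D B : Finset H)
    (hs : ∀ h ∈ B, (N.orb c h).card ≤ s) (hB : ∀ h ∈ B, ∃ y ∈ N.orb c h, y ∈ D) :
    B.card ≤ D.card * s := by
  classical
  have hsub : B ⊆ D.biUnion fun y => B.filter fun h => y ∈ N.orb c h := by
    intro h hh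
    obtain ⟨y, hy, hyD⟩ := hB h hh
    simp only [Finset.mem_biUnion, Finset.mem_filter]
    exact ⟨y, hyD, hh, hy⟩
  refine (Finset.card_le_card hsub).trans (Finset.card_biUnion_le_card_mul _ _ s fun y _ => ?_)
  rcases (B.filter fun h => y ∈ N.orb c h).eq_empty_or_nonempty with he | ⟨h, hh⟩
  · rw [he]; simp
  · rw [Finset.mem_filter] at hh
    refine (Finset.card_le_card (t := N.orb c h) ?_).trans (hs h hh.1)
    intro z hz
    rw [Finset.mem_filter] at hz
    exact mem_cls.2 ((mem_cls.1 hh.2).trans (mem_cls.1 hz.2).symm)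

/-- There are boundedly many short odd faces, since a proportion of them are pairwise distant. -/
theorem card_odd_le {c : Color} (I : Finset H) (hI : ∀ h ∈ I, N.IsOddFace c h)
    (h6 : ∀ h ∈ I, (N.orb c h).card ≤ 6) : (I.card : ℚ) ≤ 288 * N.deg := by
  obtain ⟨J, hJ, hfar, hcard⟩ := N.exists_far I (N.orb c) 6 6
    (fun h _ => ⟨h, self_mem_cls _ _⟩) h6 (fun z B hB hz => by
      have := N.card_filter_le_of_orb_le c 6 {z} B (fun h hh => h6 h (hB hh))
        (fun h hh => ⟨z, hz h hh, by simp⟩)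
      simpa using this)
  have h1 := N.card_le_of_odd_of_far J (fun h hh => hI h (hJ hh)) hfar
  have h2 : (I.card : ℚ) ≤ 6 * (4 * 6) * J.card := by exact_mod_cast hcard
  linarith

open scoped Classical in
/-- Distant centers give independent curves: the two faces of length two of a center cross once, in
its middle tetrahedron, and the curves of distant centers do not cross. -/
theorem card_le_of_center_of_far {c c' : Color} (J : Finset H) (hJ : ∀ y ∈ J, N.IsCenter c c' y)
    (hfar : ∀ a ∈ J, ∀ b ∈ J, a ≠ b →
      N.Far (N.square c a ∪ N.square c (N.X c' a)) (N.square c b ∪ N.square c (N.X c' b))) :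
    (J.card : ℚ) ≤ 2 * N.deg := by
  classical
  rcases J.eq_empty_or_nonempty with rfl | ⟨a, ha⟩
  · simpa using N.deg_nonneg
  have hc := (hJ a ha).ne
  refine N.card_le_two_mul_deg hc.symm J (N.square c) (fun y => N.square c (N.X c' y))
    (fun y => {N.X c' y, N.E (N.X c' y)}) ?_ ?_ ?_ ?_ ?_
  · intro y hy
    exact N.isCurve_square (hJ y hy).kind (hJ y hy).kind₁ (hJ y hy).face₁
  · intro y hy
    exact N.isCurve_square ((N.kind_X _ _).trans (hJ y hy).kind) (hJ y hy).kind₂ (hJ y hy).face₂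
  · intro y hy
    have h := hJ y hy
    set x := N.X c' y with hx
    have hxk : N.kind x = some .tetra := (N.kind_X _ _).trans h.kind
    have hne : ¬ N.Adj x (N.E x) := fun h' => h.not_adj₂ ((N.adj_X y c').trans h.kind h')
    refine ⟨?_, ?_, ?_⟩
    · intro t ht
      rw [Finset.mem_insert, Finset.mem_singleton] at ht
      rw [mem_square]
      tauto
    · intro t ht
      rw [Finset.mem_insert, Finset.mem_singleton] at ht
      rcases ht with rfl | rfl
      · exact hxk
      · exact h.kind₂
    · intro t ht _
      have n1 : N.X c x ≠ N.E x := fun e => hne (e ▸ N.adj_X x c)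
      have n2 : N.X c (N.E x) ≠ x := fun e => hne (Adj.symm (Or.inr ⟨c, e.symm⟩))
      have n3 := N.X_ne c x
      have n4 := N.X_ne c (N.E x)
      rw [mem_square] at ht
      simp only [Finset.mem_insert, Finset.mem_singleton]
      rcases ht with rfl | rfl | rfl | rfl
      · simp [n1, n3]
      · simp [n1, n3, N.X_invol]
      · simp [n2, n4]
      · simp [n2, n4, N.X_invol]
  · intro y hy
    have h := hJ y hy
    have hE : N.E (N.X c' y) ∉ N.square c y ∧ N.X c' (N.E (N.X c' y)) ∉ N.square c y := by
      constructor
      · intro h'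
        rw [mem_square] at h'
        rcases h' with e | e | e | e
        · exact h.not_adj₂ (Or.inl e)
        · exact h.not_adj₂ (Or.inr ⟨_, e⟩)
        · exact h.not_adj₃ (Or.inl e)
        · exact h.not_adj₃ (Or.inr ⟨_, e⟩)
      · intro h'
        rw [mem_square] at h'
        have e0 : N.Adj (N.X c' (N.E (N.X c' y))) (N.E (N.X c' y)) :=
          (N.adj_X _ c').symm
        rcases h' with e | e | e | e <;> rw [e] at e0
        · exact h.not_adj₂ e0
        · exact h.not_adj₂ ((N.adj_X y c).trans h.kind e0)
        · exact h.not_adj₃ e0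
        · exact h.not_adj₃ ((N.adj_X _ c).trans h.kind₁ e0)
    have hx : N.X c' y ∉ N.square c y := by
      intro h'
      rw [mem_square] at h'
      rcases h' with e | e | e | e
      · exact N.X_ne _ _ e
      · exact N.tetra_ne h.kind h.ne e
      · exact h.not_adj₁ (Or.inr ⟨_, e.symm⟩)
      · exact h.not_adj₁ (Adj.trans h.kind (e ▸ N.adj_X y c') (N.adj_X _ c).symm)
    have hy0 : y ∈ N.square c y := N.mem_square.2 (Or.inl rfl)
    -- among the two passages of the second face, only the one in the middle tetrahedron lies on
    -- the first face
    have : ({N.X c' y, N.E (N.X c' y)} : Finset H).filter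
        (fun t => ¬ (t ∈ N.square c y ↔ N.X c' t ∈ N.square c y)) = {N.X c' y} := by
      rw [Finset.filter_insert, if_pos (by rw [N.X_invol]; tauto), Finset.filter_singleton,
        if_neg (by tauto)]
      simp
    rw [this]
    simp
  · intro a ha b hb hab y hy z hz
    refine hfar a ha b hb hab y (Finset.mem_union_left _ hy) z (Finset.mem_union_right _ ?_)
    rw [Finset.mem_insert, Finset.mem_singleton] at hz
    rw [mem_square]
    tauto

/-- There are boundedly many centers, since a proportion of them are pairwise distant. -/
theorem card_center_le {c c' : Color} (I : Finset H) (hI : ∀ y ∈ I, N.IsCenter c c' y) :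
    (I.card : ℚ) ≤ 512 * N.deg := by
  classical
  obtain ⟨J, hJ, hfar, hcard⟩ := N.exists_far I
    (fun y => N.square c y ∪ N.square c (N.X c' y)) 8 8
    (fun h _ => ⟨h, Finset.mem_union_left _ (N.mem_square.2 (Or.inl rfl))⟩)
    (fun h _ => (Finset.card_union_le _ _).trans
      (Nat.add_le_add (N.card_square_le _ _) (N.card_square_le _ _)))
    (fun z B hB hz => by
      have h1 : B ⊆ (B.filter fun h => z ∈ N.square c h) ∪
          B.filter fun h => z ∈ N.square c (N.X c' h) := by
        intro h hh
        have := hz h hh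
        simp only [Finset.mem_union, Finset.mem_filter] at this ⊢
        tauto
      refine (Finset.card_le_card h1).trans ((Finset.card_union_le _ _).trans ?_)
      change _ ≤ 4 + 4
      refine Nat.add_le_add ?_ ?_
      · exact N.card_filter_square_le z id Function.injective_id _ fun h hh =>
          ⟨(hI h (hB (Finset.mem_filter.1 hh).1)).face₁, (Finset.mem_filter.1 hh).2⟩
      · exact N.card_filter_square_le z (N.X c') (fun a b h => (N.X_inj c').1 h) _ fun h hh =>
          ⟨(hI h (hB (Finset.mem_filter.1 hh).1)).face₂, (Finset.mem_filter.1 hh).2⟩)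
  have h1 := N.card_le_of_center_of_far J (fun h hh => hI h (hJ hh)) hfar
  have h2 : (I.card : ℚ) ≤ 8 * (4 * 8) * J.card := by exact_mod_cast hcard
  linarith

/-- A tadpole: an edge of color `0` joining two half-edges of a tetrahedron. -/
def IsTadpole (N : Net H) (h : H) : Prop := N.kind h = some .tetra ∧ ∃ d, N.E h = N.X d h

/-- A face of length three through tetrahedra is odd, unless it contains a tadpole: it cannot visit
the same tetrahedron twice. -/
theorem isOddFace_of_card {c : Color} {h : H}
    (hk : ∀ y ∈ N.orb c h, N.kind y = some .tetra) (hcard : (N.orb c h).card = 6)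
    (htad : ∀ y ∈ N.orb c h, ¬ N.IsTadpole y) : N.IsOddFace c h := by
  classical
  have he : N.tetraOrb c h = N.orb c h := Finset.filter_true_of_mem hk
  refine ⟨fun y hy => Or.inl (hk y hy), ?_, by rw [he, hcard]⟩
  intro y hy d hd hdy
  rw [he] at hy
  obtain ⟨k, hkc, hkd⟩ := Color.exists_third c d
  have hky := hk y hy
  -- the face contains the four half-edges of a tetrahedron, which leaves too little room
  have h4 : N.X k y ∈ N.orb c h := by
    rw [← N.tetra_mul hky hd.symm hkd.symm hkc.symm]; exact N.X_mem_orb hdy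
  have hA : ∀ z, N.Adj y z → z ∈ N.orb c h := by
    rintro z (rfl | ⟨e, rfl⟩)
    · exact hy
    · rcases Color.third (c := e) hd.symm hkd.symm hkc.symm with rfl | rfl | rfl
      · exact N.X_mem_orb hy
      · exact hdy
      · exact h4
  have hcardA : (N.nbhd y).card = 4 := by
    have n1 : ∀ e, y ≠ N.X e y := fun e e' => N.X_ne e y e'.symm
    have n2 : ∀ {e f}, e ≠ f → N.X e y ≠ N.X f y := fun h => N.tetra_ne hky h
    rw [nbhd, Finset.card_insert_of_notMem, Finset.card_insert_of_notMem,
      Finset.card_insert_of_notMem, Finset.card_singleton]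
    · simpa using n2 (by decide)
    · simpa using ⟨n2 (by decide), n2 (by decide)⟩
    · simpa using ⟨n1 0, n1 1, n1 2⟩
  have hsub : N.nbhd y ⊆ N.orb c h := fun z hz => hA z (N.mem_nbhd.1 hz)
  have hsub' : (N.nbhd y).image N.E ⊆ N.orb c h \ N.nbhd y := by
    intro z hz
    obtain ⟨x, hx, rfl⟩ := Finset.mem_image.1 hz
    have hx' := N.mem_nbhd.1 hx
    have hxo := hA x hx'
    refine Finset.mem_sdiff.2 ⟨N.E_mem_orb hxo, fun h' => ?_⟩
    have h5 := N.mem_nbhd.1 h'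
    have h6 : N.Adj x (N.E x) := Adj.trans (hk x hxo) hx'.symm h5
    rcases h6 with h6 | h6
    · exact N.E_ne _ h6
    · exact htad x hxo ⟨hk x hxo, h6⟩
  have h7 := Finset.card_le_card hsub'
  rw [Finset.card_image_of_injective _ fun a b h => N.E_inj.1 h, Finset.card_sdiff_of_subset hsub,
    hcardA, hcard] at h7
  omega

/-- A tadpole closes a face of length one, which is odd. -/
theorem isOddFace_of_tadpole {d : Color} {h : H} (hk : N.kind h = some .tetra)
    (hE : N.E h = N.X d h) : N.IsOddFace d h ∧ (N.orb d h).card ≤ 6 := by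
  classical
  have ho : N.orb d h = {h, N.X d h} := by
    apply Finset.Subset.antisymm
    · refine N.orb_subset (by simp) ?_ ?_
      · intro x hx
        simp only [Finset.mem_insert, Finset.mem_singleton] at hx ⊢
        rcases hx with rfl | rfl
        · exact Or.inr hE
        · rw [← hE, N.E_invol]; simp
      · intro x hx
        simp only [Finset.mem_insert, Finset.mem_singleton] at hx ⊢
        rcases hx with rfl | rfl
        · exact Or.inr rfl
        · rw [N.X_invol]; simp
    · intro y hy
      simp only [Finset.mem_insert, Finset.mem_singleton] at hy
      rcases hy with rfl | rfl
      · exact self_mem_cls _ _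
      · exact N.X_mem_orb (self_mem_cls _ _)
  have hkk : ∀ y ∈ N.orb d h, N.kind y = some .tetra := by
    intro y hy
    rw [ho] at hy
    simp only [Finset.mem_insert, Finset.mem_singleton] at hy
    rcases hy with rfl | rfl
    · exact hk
    · exact (N.kind_X _ _).trans hk
  have hcard : (N.orb d h).card = 2 := by
    rw [ho, Finset.card_pair (N.X_ne d h).symm]
  have he : N.tetraOrb d h = N.orb d h := Finset.filter_true_of_mem hkk
  refine ⟨⟨fun y hy => Or.inl (hkk y hy), ?_, by rw [he, hcard]⟩, by omega⟩
  intro y hy e he' hy'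
  rw [he, ho] at hy
  rw [ho] at hy'
  simp only [Finset.mem_insert, Finset.mem_singleton] at hy hy'
  rcases hy with rfl | rfl
  · rcases hy' with h1 | h1
    · exact N.X_ne _ _ h1
    · exact N.tetra_ne hk he' h1
  · rcases hy' with h1 | h1
    · exact N.tetra_ne hk he' (by rw [← h1, N.X_invol, h1])
    · exact N.X_ne _ _ h1

end Net

namespace Net

variable {H : Type} (N : Net H)

/-! ### Faces as dihedral orbits -/

/-- One step along a face of color `c`. -/
def step (c : Color) (h : H) : H := N.E (N.X c h)

/-- The reflections of a face have no fixed point, hence `X c` is not a rotation. -/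
theorem X_ne_step_iterate (c : Color) (s : ℕ) (z : H) : N.X c z ≠ (N.step c)^[s] z := by
  induction s using Nat.twoStepInduction generalizing z with
  | zero => exact N.X_ne c z
  | one => exact fun h => N.E_ne (N.X c z) h.symm
  | more s ih _ =>
    intro h
    rw [Function.iterate_succ_apply', Function.iterate_succ_apply] at h
    refine ih (N.step c z) ?_
    have h2 : N.step c z = N.X c ((N.step c)^[s] (N.step c z)) := by
      rw [← N.E_invol (N.X c ((N.step c)^[s] (N.step c z)))]
      exact congrArg N.E h
    rw [← N.X_invol c ((N.step c)^[s] (N.step c z)), ← h2]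

theorem step_injective (c : Color) : Function.Injective (N.step c) := fun _ _ h =>
  (N.X_inj c).1 (N.E_inj.1 h)

/-- A face with `2 l` half-edges closes after `l` steps. -/
theorem step_iterate_eq [Fintype H] (c : Color) (h : H) {l : ℕ} (hl : (N.orb c h).card = 2 * l) :
    (N.step c)^[l] h = h := by
  classical
  set f := N.step c with hf
  have hper : h ∈ Function.periodicPts f := (N.step_injective c).mem_periodicPts h
  set m := Function.minimalPeriod f h with hm
  have hm0 : 0 < m := Function.minimalPeriod_pos_of_mem_periodicPts hper
  have hfm : f^[m] h = h := Function.iterate_minimalPeriod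
  set A : Finset H := (Finset.range m).image fun k => f^[k] h with hA
  have memA : ∀ k, f^[k] h ∈ A := fun k => by
    rw [← Function.iterate_mod_minimalPeriod_eq]
    exact Finset.mem_image.2 ⟨_, Finset.mem_range.2 (Nat.mod_lt _ hm0), rfl⟩
  have cardA : A.card = m := by
    rw [hA, Finset.card_image_of_injOn, Finset.card_range]
    intro k hk l hl h'
    exact (Function.iterate_eq_iterate_iff_of_lt_minimalPeriod
      (Finset.mem_range.1 hk) (Finset.mem_range.1 hl)).1 h'
  have cardB : (A.image (N.X c)).card = m := by
    rw [Finset.card_image_of_injective _ (fun a b h => (N.X_inj c).1 h), cardA]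
  have hdisj : Disjoint A (A.image (N.X c)) := by
    rw [Finset.disjoint_left]
    intro y h1 h2
    obtain ⟨l, -, rfl⟩ := Finset.mem_image.1 h1
    obtain ⟨z, hz, hzl⟩ := Finset.mem_image.1 h2
    obtain ⟨k, hk, rfl⟩ := Finset.mem_image.1 hz
    have hk' := Finset.mem_range.1 hk
    refine N.X_ne_step_iterate c (l + m - k) (f^[k] h) (hzl.trans ?_)
    rw [← hf, ← Function.iterate_add_apply]
    have : l + m - k + k = l + m := by omega
    rw [this, Function.iterate_add_apply, hfm]
  have horb : N.orb c h = A ∪ A.image (N.X c) := by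
    apply Finset.Subset.antisymm
    · refine N.orb_subset (Finset.mem_union_left _ (memA 0)) ?_ ?_
      · intro x hx
        rcases Finset.mem_union.1 hx with hx | hx
        · obtain ⟨k, -, rfl⟩ := Finset.mem_image.1 hx
          have : f^[k] h = f^[k + m - 1 + 1] h := by
            rw [show k + m - 1 + 1 = k + m by omega, Function.iterate_add_apply, hfm]
          simp only [this, Function.iterate_succ_apply']
          rw [hf, step, N.E_invol, ← hf]
          exact Finset.mem_union_right _ (Finset.mem_image_of_mem _ (memA _))
        · obtain ⟨z, hz, rfl⟩ := Finset.mem_image.1 hx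
          obtain ⟨k, -, rfl⟩ := Finset.mem_image.1 hz
          refine Finset.mem_union_left _ ?_
          have := memA (k + 1)
          rwa [Function.iterate_succ_apply'] at this
      · intro x hx
        rcases Finset.mem_union.1 hx with hx | hx
        · exact Finset.mem_union_right _ (Finset.mem_image_of_mem _ hx)
        · obtain ⟨z, hz, rfl⟩ := Finset.mem_image.1 hx
          rw [N.X_invol]
          exact Finset.mem_union_left _ hz
    · have key : ∀ k, f^[k] h ∈ N.orb c h := by
        intro k
        induction k with
        | zero => exact self_mem_cls _ _
        | succ k ih =>
          rw [Function.iterate_succ_apply']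
          exact N.E_mem_orb (N.X_mem_orb ih)
      intro x hx
      rcases Finset.mem_union.1 hx with hx | hx
      · obtain ⟨k, -, rfl⟩ := Finset.mem_image.1 hx
        exact key k
      · obtain ⟨z, hz, rfl⟩ := Finset.mem_image.1 hx
        obtain ⟨k, -, rfl⟩ := Finset.mem_image.1 hz
        exact N.X_mem_orb (key k)
  have : (N.orb c h).card = m + m := by
    rw [horb, Finset.card_union_of_disjoint hdisj, cardA, cardB]
  have hlm : l = m := by omega
  rw [hlm, hfm]

/-- A face with four half-edges has length two. -/
theorem E_X_eq_of_card [Fintype H] {c : Color} {h : H} (hl : (N.orb c h).card = 4) :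
    N.E (N.X c h) = N.X c (N.E h) := by
  have h1 : N.E (N.X c (N.E (N.X c h))) = h := N.step_iterate_eq c h (l := 2) hl
  have h2 : N.X c (N.E (N.X c h)) = N.E h := by rw [← N.E_invol (N.X c _), h1]
  rw [← h2, N.X_invol]

/-- A face with two half-edges has length one. -/
theorem E_eq_of_card [Fintype H] {c : Color} {h : H} (hl : (N.orb c h).card = 2) :
    N.E h = N.X c h := by
  have h1 : N.E (N.X c h) = h := N.step_iterate_eq c h (l := 1) hl
  rw [← N.E_invol (N.X c h), h1]

/-! ### Regions all of whose faces have length four -/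

/-- No half-edge at distance at most `n` from `y` lies in `Bad`. -/
def Good (Bad : Finset H) : ℕ → H → Prop
  | 0, y => y ∉ Bad
  | n + 1, y => Good Bad n y ∧ Good Bad n (N.E y) ∧ ∀ c, Good Bad n (N.X c y)

/-- The edge of color `c` as seen from the other end of the edge of color `0`. -/
def Y (c : Color) (y : H) : H := N.E (N.X c (N.E y))

variable {N} {Bad : Finset H} {n m : ℕ} {y : H}

theorem Good.pred (h : N.Good Bad (n + 1) y) : N.Good Bad n y := h.1

theorem Good.E (h : N.Good Bad (n + 1) y) : N.Good Bad n (N.E y) := h.2.1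

theorem Good.X (h : N.Good Bad (n + 1) y) (c : Color) : N.Good Bad n (N.X c y) := h.2.2 c

theorem Good.Y (h : N.Good Bad (n + 3) y) (c : Color) : N.Good Bad n (N.Y c y) := (h.E.X c).E

theorem Good.mono (h : N.Good Bad n y) (hmn : m ≤ n) : N.Good Bad m y := by
  induction hmn with
  | refl => exact h
  | step _ ih => exact ih h.pred

theorem Good.notMem (h : N.Good Bad n y) : y ∉ Bad := h.mono (Nat.zero_le n)

theorem Y_invol (c : Color) (y : H) : N.Y c (N.Y c y) = y := by
  simp only [Y, N.E_invol, N.X_invol]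

theorem Y_comm (c d : Color) (y : H) : N.Y c (N.Y d y) = N.Y d (N.Y c y) := by
  simp only [Y, N.E_invol, N.X_comm c d]

/-- The commutator of the two colors `0` and `1` seen from the two ends of an edge of color `0`. -/
def IsFlat.W (N : Net H) (y : H) : H := N.X 0 (N.Y 1 (N.X 0 (N.Y 1 y)))

theorem IsFlat.Good_W (hy : N.Good Bad (n + 8) y) : N.Good Bad n (IsFlat.W N y) :=
  (((hy.Y 1).X 0).Y 1).X 0

namespace IsFlat

/-- The orbit of `y` under `Y 0`, `Y 1` and their commutator. -/
def baseSet (N : Net H) (y : H) (z : H) : Prop :=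
  ∃ x, (x = y ∨ x = W N y) ∧ (z = x ∨ z = N.Y 0 x ∨ z = N.Y 1 x ∨ z = N.Y 0 (N.Y 1 x))

/-- The words of the orbit are short, so the orbit stays in the flat region. -/
theorem Good_baseSet (hy : N.Good Bad 80 y) {z : H} (hz : baseSet N y z) : N.Good Bad 60 z := by
  obtain ⟨x, hx, hz⟩ := hz
  have hx' : N.Good Bad 70 x := by
    rcases hx with rfl | rfl
    · exact hy.mono (by norm_num)
    · exact (Good_W (n := 72) hy).mono (by norm_num)
  rcases hz with rfl | rfl | rfl | rfl
  · exact hx'.mono (by norm_num)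
  · exact (hx'.Y 0).mono (by norm_num)
  · exact (hx'.Y 1).mono (by norm_num)
  · exact ((hx'.Y 1).Y 0).mono (by norm_num)

/-- The orbit of `y` under `X 0`, `X 1`, `Y 0`, `Y 1`. -/
def planeSet (N : Net H) (y : H) (z : H) : Prop :=
  ∃ x, baseSet N y x ∧ (z = x ∨ z = N.X 0 x ∨ z = N.X 1 x ∨ z = N.X 0 (N.X 1 x))

theorem Good_planeSet (hy : N.Good Bad 80 y) {z : H} (hz : planeSet N y z) :
    N.Good Bad 50 z := by
  obtain ⟨x, hx, hz⟩ := hz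
  have hx' := Good_baseSet hy hx
  rcases hz with rfl | rfl | rfl | rfl
  · exact hx'.mono (by norm_num)
  · exact (hx'.X 0).mono (by norm_num)
  · exact (hx'.X 1).mono (by norm_num)
  · exact ((hx'.X 1).X 0).mono (by norm_num)

end IsFlat

variable [Fintype H]

/-- Away from `Bad` all half-edges belong to tetrahedra and all faces have length four. -/
structure IsFlat (N : Net H) (Bad : Finset H) : Prop where
  kind : ∀ y, y ∉ Bad → N.kind y = some .tetra
  card : ∀ y, y ∉ Bad → ∀ c, (N.orb c y).card = 8

namespace IsFlat

/-- The relation given by the faces of color `c`: they have length four. -/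
theorem XY (hF : N.IsFlat Bad) (c : Color) (hy : N.Good Bad n y) : N.X c (N.Y c y) = N.Y c (N.X c y) := by
  have h1 : N.E (N.X c (N.E (N.X c (N.E (N.X c (N.E (N.X c y))))))) = y :=
    N.step_iterate_eq c y (l := 4) (hF.card y hy.notMem c)
  have h2 : ∀ a b, N.E a = b → a = N.E b := fun a b h => by rw [← h, N.E_invol]
  have h3 : ∀ a b, N.X c a = b → a = N.X c b := fun a b h => by rw [← h, N.X_invol]
  have h4 := h3 _ _ (h2 _ _ (h3 _ _ (h2 _ _ h1)))
  exact h4.symm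

/-- The relation given by the faces of the third color. -/
theorem XXYY (hF : N.IsFlat Bad) (hy : N.Good Bad n y) (hn : 8 ≤ n) :
    N.X 0 (N.X 1 (N.Y 0 (N.Y 1 y))) = N.Y 0 (N.Y 1 (N.X 0 (N.X 1 y))) := by
  replace hy := hy.mono hn
  have h2 : ∀ {z n}, N.Good Bad n z → N.X 0 (N.X 1 z) = N.X 2 z := fun hz =>
    N.tetra_mul (hF.kind _ hz.notMem) (by decide) (by decide) (by decide)
  have h3 : ∀ {z n}, N.Good Bad (n + 1) z → N.Y 0 (N.Y 1 z) = N.Y 2 z := fun hz => by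
    simp only [Net.Y, N.E_invol]; rw [h2 hz.E]
  rw [h2 ((hy.Y 1).Y 0), h3 (n := 7) hy, h2 hy, h3 (n := 6) (hy.X 2)]
  exact hF.XY 2 hy

theorem W_eq (hF : N.IsFlat Bad) (hy : N.Good Bad n y) (hn : 20 ≤ n) :
    W N y = N.Y 0 (N.X 1 (N.Y 0 (N.X 1 y))) := by
  replace hy := hy.mono hn
  have h1 := hF.XXYY ((hy.X 1).Y 1) (by norm_num)
  rw [Y_invol, hF.XY 1 (hy.X 1), N.X_invol] at h1
  -- `h1 : X 0 (X 1 (Y 0 (X 1 y))) = Y 0 (Y 1 (X 0 (Y 1 y)))`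
  have h2 : N.X 1 (N.Y 0 (N.X 1 y)) = N.Y 0 (W N y) := by
    rw [← N.X_invol 0 (N.X 1 _), h1, hF.XY 0 (((hy.Y 1).X 0).Y 1), W]
  rw [h2, Y_invol]

theorem W_Y0 (hF : N.IsFlat Bad) (hy : N.Good Bad n y) (hn : 20 ≤ n) :
    W N (N.Y 0 y) = N.Y 0 (W N y) := by
  replace hy := hy.mono hn
  rw [W, W, Y_comm 1 0, hF.XY 0 (hy.Y 1), Y_comm 1 0, hF.XY 0 (((hy.Y 1).X 0).Y 1)]

theorem W_Y1 (hF : N.IsFlat Bad) (hy : N.Good Bad n y) (hn : 23 ≤ n) :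
    W N (N.Y 1 y) = N.Y 1 (W N y) := by
  replace hy := hy.mono hn
  rw [hF.W_eq (hy.Y 1) (by norm_num), hF.W_eq hy (by norm_num), hF.XY 1 hy, Y_comm 0 1,
    hF.XY 1 ((hy.X 1).Y 0), Y_comm 0 1]

theorem W_X0 (hF : N.IsFlat Bad) (hy : N.Good Bad n y) (hn : 21 ≤ n) :
    W N (N.X 0 y) = N.X 0 (W N y) := by
  replace hy := hy.mono hn
  rw [hF.W_eq (hy.X 0) (by norm_num), hF.W_eq hy (by norm_num), N.X_comm 1 0,
    ← hF.XY 0 (hy.X 1), N.X_comm 1 0, ← hF.XY 0 (((hy.X 1).Y 0).X 1)]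

theorem W_W (hF : N.IsFlat Bad) (hy : N.Good Bad n y) (hn : 40 ≤ n) : W N (W N y) = y := by
  replace hy := hy.mono hn
  have h1 : W N y = N.X 0 (N.Y 1 (N.X 0 (N.Y 1 y))) := rfl
  have h2 := hF.W_X0 (((hy.Y 1).X 0).Y 1) (by norm_num)
  rw [← h1] at h2
  rw [h2, W, Y_invol, N.X_invol, N.X_invol, Y_invol]

theorem Y0_X1 (hF : N.IsFlat Bad) (hy : N.Good Bad n y) (hn : 20 ≤ n) :
    N.Y 0 (N.X 1 y) = N.X 1 (N.Y 0 (W N y)) := by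
  rw [hF.W_eq hy hn, Y_invol, N.X_invol]

theorem Y1_X0 (hF : N.IsFlat Bad) (hy : N.Good Bad n y) (hn : 40 ≤ n) :
    N.Y 1 (N.X 0 y) = N.X 0 (N.Y 1 (W N y)) := by
  replace hy := hy.mono hn
  -- three of the four factors of the first `W` in `W (W y) = y` cancel
  have h4 : N.X 0 (N.Y 1 (N.X 0 (N.Y 1 (W N y)))) = y := hF.W_W hy (by norm_num)
  have h5 : N.X 0 y = N.Y 1 (N.X 0 (N.Y 1 (W N y))) := by
    rw [← N.X_invol 0 (N.Y 1 (N.X 0 (N.Y 1 (W N y)))), h4]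
  rw [h5, Y_invol]

/-- The involutions `Y 0`, `Y 1` commute with each other and with the commutator `W`, which is an
involution. -/
theorem baseSet_closed (hF : N.IsFlat Bad) (hy : N.Good Bad 80 y) {z : H} (hz : baseSet N y z) :
    baseSet N y (N.Y 0 z) ∧ baseSet N y (N.Y 1 z) ∧ baseSet N y (W N z) := by
  obtain ⟨x, hx, hz⟩ := hz
  have hx' : N.Good Bad 70 x := by
    rcases hx with rfl | rfl
    · exact hy.mono (by norm_num)
    · exact (Good_W (n := 72) hy).mono (by norm_num)
  have hW : W N x = y ∨ W N x = W N y := by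
    rcases hx with rfl | rfl
    · exact Or.inr rfl
    · exact Or.inl (hF.W_W hy (by norm_num))
  have w0 := hF.W_Y0 hx' (by norm_num)
  have w1 := hF.W_Y1 hx' (by norm_num)
  have w01 : W N (N.Y 0 (N.Y 1 x)) = N.Y 0 (N.Y 1 (W N x)) := by
    rw [hF.W_Y0 (hx'.Y 1) (by norm_num), w1]
  have hb : ∀ u, (u = x ∨ u = N.Y 0 x ∨ u = N.Y 1 x ∨ u = N.Y 0 (N.Y 1 x)) → baseSet N y u :=
    fun u hu => ⟨x, hx, hu⟩
  have hb' : ∀ u, (u = W N x ∨ u = N.Y 0 (W N x) ∨ u = N.Y 1 (W N x) ∨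
      u = N.Y 0 (N.Y 1 (W N x))) → baseSet N y u := fun u hu => ⟨W N x, hW, hu⟩
  rcases hz with rfl | rfl | rfl | rfl
  · exact ⟨hb _ (by simp), hb _ (by simp), hb' _ (by simp)⟩
  · rw [Y_invol, Y_comm 1 0, w0]
    exact ⟨hb _ (by simp), hb _ (by simp), hb' _ (by simp)⟩
  · rw [Y_invol, w1]
    exact ⟨hb _ (by simp), hb _ (by simp), hb' _ (by simp)⟩
  · rw [Y_invol, Y_comm 0 1, Y_invol, Y_comm 1 0, w01]
    exact ⟨hb _ (by simp), hb _ (by simp), hb' _ (by simp)⟩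

/-- The involutions `X 0`, `X 1` can be moved through `Y 0`, `Y 1` up to factors `W`. -/
theorem planeSet_closed (hF : N.IsFlat Bad) (hy : N.Good Bad 80 y) {z : H}
    (hz : planeSet N y z) : planeSet N y (N.X 0 z) ∧ planeSet N y (N.X 1 z) ∧
      planeSet N y (N.Y 0 z) ∧ planeSet N y (N.Y 1 z) := by
  obtain ⟨x, hx, hz⟩ := hz
  have hx' := Good_baseSet hy hx
  obtain ⟨b0, b1, bW⟩ := hF.baseSet_closed hy hx
  obtain ⟨c0, c1, -⟩ := hF.baseSet_closed hy bW
  have key : ∀ {x}, baseSet N y x → planeSet N y x ∧ planeSet N y (N.X 0 x) ∧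
      planeSet N y (N.X 1 x) ∧ planeSet N y (N.X 0 (N.X 1 x)) := fun {x} hx =>
    ⟨⟨x, hx, by simp⟩, ⟨x, hx, by simp⟩, ⟨x, hx, by simp⟩, ⟨x, hx, by simp⟩⟩
  rcases hz with rfl | rfl | rfl | rfl
  · exact ⟨(key hx).2.1, (key hx).2.2.1, (key b0).1, (key b1).1⟩
  · rw [N.X_invol, N.X_comm 1 0, ← hF.XY 0 hx', hF.Y1_X0 hx' (by norm_num)]
    exact ⟨(key hx).1, (key hx).2.2.2, (key b0).2.1, (key c1).2.1⟩
  · rw [N.X_invol, ← hF.XY 1 hx', hF.Y0_X1 hx' (by norm_num)]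
    exact ⟨(key hx).2.2.2, (key hx).1, (key c0).2.2.1, (key b1).2.2.1⟩
  · have e0 : N.Y 0 (N.X 0 (N.X 1 x)) = N.X 0 (N.X 1 (N.Y 0 (W N x))) := by
      rw [← hF.XY 0 (hx'.X 1), hF.Y0_X1 hx' (by norm_num)]
    have e1 : N.Y 1 (N.X 0 (N.X 1 x)) = N.X 0 (N.X 1 (N.Y 1 (W N x))) := by
      rw [N.X_comm 0 1 x, ← hF.XY 1 (hx'.X 0), hF.Y1_X0 hx' (by norm_num), N.X_comm 1 0]
    rw [e0, e1, N.X_invol, N.X_comm 0 1, N.X_invol]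
    exact ⟨(key hx).2.2.1, (key hx).2.1, (key c0).2.2.2, (key c1).2.2.2⟩

/-- In a flat region the connected component closes up into a piece of bounded size: the group
generated by the involutions `E`, `X 0`, `X 1`, subject to the relations given by the faces of
length four of the three colors, is finite. -/
theorem card_conn_le (hF : N.IsFlat Bad) (hy : N.Good Bad 80 y) : (cls N.conn y).card ≤ 64 := by
  classical
  -- the orbit of `y` has at most `2 * 4 * 4` elements, and `E` exchanges `X` with `Y`
  let k0 : Finset H := {y, W N y}
  let k1 : Finset H := k0.biUnion fun x => {x, N.Y 0 x, N.Y 1 x, N.Y 0 (N.Y 1 x)}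
  let k2 : Finset H := k1.biUnion fun x => {x, N.X 0 x, N.X 1 x, N.X 0 (N.X 1 x)}
  let k3 : Finset H := k2.biUnion fun x => {x, N.E x}
  have m1 : ∀ z, z ∈ k1 ↔ baseSet N y z := fun z => by
    simp only [k1, k0, baseSet, Finset.mem_biUnion, Finset.mem_insert, Finset.mem_singleton]
  have m2 : ∀ z, z ∈ k2 ↔ planeSet N y z := fun z => by
    simp only [k2, planeSet, Finset.mem_biUnion, m1, Finset.mem_insert, Finset.mem_singleton]
  have m3 : ∀ z, z ∈ k3 ↔ planeSet N y z ∨ planeSet N y (N.E z) := fun z => by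
    simp only [k3, Finset.mem_biUnion, m2, Finset.mem_insert, Finset.mem_singleton]
    constructor
    · rintro ⟨x, hx, rfl | rfl⟩
      · exact Or.inl hx
      · exact Or.inr (by rwa [N.E_invol])
    · rintro (h | h)
      · exact ⟨z, h, Or.inl rfl⟩
      · exact ⟨_, h, Or.inr (N.E_invol z).symm⟩
  have hcard : k3.card ≤ 64 := by
    have c0 : k0.card ≤ 2 := Finset.card_le_two
    have c1 : k1.card ≤ k0.card * 4 :=
      Finset.card_biUnion_le_card_mul _ _ _ fun _ _ => Finset.card_le_four
    have c2 : k2.card ≤ k1.card * 4 :=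
      Finset.card_biUnion_le_card_mul _ _ _ fun _ _ => Finset.card_le_four
    have c3 : k3.card ≤ k2.card * 2 :=
      Finset.card_biUnion_le_card_mul _ _ _ fun _ _ => Finset.card_le_two
    omega
  have hE : ∀ z ∈ k3, N.E z ∈ k3 := fun z hz => by
    rw [m3] at hz ⊢
    rw [N.E_invol]
    exact hz.symm
  have hgood : ∀ z ∈ k3, N.Good Bad 40 z := fun z hz => by
    rw [m3] at hz
    rcases hz with hz | hz
    · exact (Good_planeSet hy hz).mono (by norm_num)
    · rw [← N.E_invol z]
      exact ((Good_planeSet hy hz).E).mono (by norm_num)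
  have hX0 : ∀ z ∈ k3, N.X 0 z ∈ k3 ∧ N.X 1 z ∈ k3 := fun z hz => by
    simp only [m3] at hz ⊢
    rcases hz with hz | hz
    · have := hF.planeSet_closed hy hz
      exact ⟨Or.inl this.1, Or.inl this.2.1⟩
    · have := hF.planeSet_closed hy hz
      simp only [Net.Y, N.E_invol] at this
      exact ⟨Or.inr this.2.2.1, Or.inr this.2.2.2⟩
  have hX : ∀ c, ∀ z ∈ k3, N.X c z ∈ k3 := by
    intro c z hz
    rcases Color.third (i := 0) (j := 1) (k := 2) (c := c) (by decide) (by decide) (by decide)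
      with rfl | rfl | rfl
    · exact (hX0 z hz).1
    · exact (hX0 z hz).2
    · rw [← N.tetra_mul (hF.kind z (hgood z hz).notMem) (i := 0) (j := 1) (by decide) (by decide)
        (by decide)]
      exact (hX0 _ (hX0 z hz).2).1
  refine (Finset.card_le_card (cls_subset ?_ ?_)).trans hcard
  · rw [m3]
    exact Or.inl ⟨y, ⟨y, Or.inl rfl, Or.inl rfl⟩, Or.inl rfl⟩
  · rintro x z (rfl | ⟨c, rfl⟩)
    · exact ⟨hE x, fun h => by simpa [N.E_invol] using hE _ h⟩
    · exact ⟨hX c x, fun h => by simpa [N.X_invol] using hX c _ h⟩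

open scoped Classical in
/-- There are boundedly many half-edges near `Bad`. -/
theorem card_not_good_le (N : Net H) (Bad : Finset H) (n : ℕ) :
    (Finset.univ.filter fun y => ¬ N.Good Bad n y).card ≤ 5 ^ n * Bad.card := by
  induction n with
  | zero => simp [Good]
  | succ n ih =>
    set B := Finset.univ.filter fun y => ¬ N.Good Bad n y with hB
    have hsub : (Finset.univ.filter fun y => ¬ N.Good Bad (n + 1) y) ⊆
        B ∪ (B.image N.E ∪ (B.image (N.X 0) ∪ (B.image (N.X 1) ∪ B.image (N.X 2)))) := by
      intro y hy
      simp only [Finset.mem_filter, Finset.mem_univ, true_and] at hy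
      by_contra hcon
      simp only [Finset.mem_union, not_or] at hcon
      obtain ⟨h1, h2, h3, h4, h5⟩ := hcon
      have hX : ∀ c, y ∉ B.image (N.X c) → N.Good Bad n (N.X c y) := fun c hc => by
        by_contra h
        exact hc (Finset.mem_image.2 ⟨N.X c y, by simpa [hB] using h, N.X_invol c y⟩)
      refine hy ⟨by simpa [hB] using h1, ?_, fun c => ?_⟩
      · by_contra h
        exact h2 (Finset.mem_image.2 ⟨N.E y, by simpa [hB] using h, N.E_invol y⟩)
      · rcases Color.third (i := 0) (j := 1) (k := 2) (c := c) (by decide) (by decide) (by decide)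
          with rfl | rfl | rfl
        · exact hX _ h3
        · exact hX _ h4
        · exact hX _ h5
    have hi : ∀ f : H → H, (B.image f).card ≤ B.card := fun f => Finset.card_image_le
    have := Finset.card_le_card hsub
    have u1 := Finset.card_union_le B (B.image N.E ∪ (B.image (N.X 0) ∪ (B.image (N.X 1) ∪ B.image (N.X 2))))
    have u2 := Finset.card_union_le (B.image N.E) (B.image (N.X 0) ∪ (B.image (N.X 1) ∪ B.image (N.X 2)))
    have u3 := Finset.card_union_le (B.image (N.X 0)) (B.image (N.X 1) ∪ B.image (N.X 2))
    have u4 := Finset.card_union_le (B.image (N.X 1)) (B.image (N.X 2))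
    have i0 := hi N.E
    have i1 := hi (N.X 0)
    have i2 := hi (N.X 1)
    have i3 := hi (N.X 2)
    have : (Finset.univ.filter fun y => ¬ N.Good Bad (n + 1) y).card ≤ 5 * B.card := by omega
    calc _ ≤ 5 * B.card := this
      _ ≤ 5 * (5 ^ n * Bad.card) := Nat.mul_le_mul_left _ ih
      _ = 5 ^ (n + 1) * Bad.card := by ring

/-- A half-edge is either near `Bad`, or in a connected component with at most `64` half-edges. -/
theorem card_le (hF : N.IsFlat Bad) :
    (Fintype.card H : ℚ) ≤ 5 ^ 80 * Bad.card + 64 * N.comps := by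
  classical
  -- distance `80` suffices to explore a flat component
  have h1 := Finset.card_filter_add_card_filter_not (s := (Finset.univ : Finset H))
    (fun y => ¬ N.Good Bad 80 y)
  simp only [not_not, Finset.card_univ] at h1
  have h2 := card_not_good_le N Bad 80
  have h3 : ((Finset.univ.filter fun y => N.Good Bad 80 y).card : ℚ) ≤ 64 * N.comps := by
    rw [comps, card_quot_eq_sum, Finset.mul_sum, Finset.card_eq_sum_ones]
    push_cast
    refine (Finset.sum_le_sum fun y hy => ?_).trans (Finset.sum_le_sum_of_subset_of_nonneg
      (Finset.subset_univ (Finset.univ.filter fun y => N.Good Bad 80 y)) fun y _ _ => ?_)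
    · have h4 := hF.card_conn_le (Finset.mem_filter.1 hy).2
      have h5 : (0 : ℚ) < (cls N.conn y).card := by exact_mod_cast card_cls_pos _ _
      have h6 : ((cls N.conn y).card : ℚ) ≤ 64 := by exact_mod_cast h4
      rw [mul_one_div, le_div_iff₀ h5]
      linarith
    · positivity
  have h2' : ((Finset.univ.filter fun y => ¬ N.Good Bad 80 y).card : ℚ) ≤ 5 ^ 80 * Bad.card := by
    exact_mod_cast h2
  have h1' : ((Finset.univ.filter fun y => ¬ N.Good Bad 80 y).card : ℚ) +
      (Finset.univ.filter fun y => N.Good Bad 80 y).card = Fintype.card H := by exact_mod_cast h1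
  linarith

end IsFlat

/-! ### Bounding the size of a net -/

variable (N)

/-- The curvature identity: the faces of length four contribute nothing to this sum. -/
theorem sum_curvature : ∑ c, ∑ h, (4 / ((N.orb c h).card : ℚ) - 1 / 2) =
    12 * N.comps - 4 * N.deg + ∑ h, (4 * halfEdgeWeight (N.kind h) - 3 / 2) := by
  have h1 : ∀ c, ∑ h, (4 / ((N.orb c h).card : ℚ) - 1 / 2) =
      4 * (Nat.card (Quot (N.face c)) : ℚ) - Fintype.card H / 2 := by
    intro c
    rw [card_quot_eq_sum, Finset.sum_sub_distrib, Finset.mul_sum]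
    simp only [Finset.sum_const, Finset.card_univ, nsmul_eq_mul, mul_one_div]
  simp only [h1]
  rw [deg, Finset.sum_sub_distrib, Finset.sum_sub_distrib, ← Finset.mul_sum, ← Finset.mul_sum]
  simp only [Finset.sum_const, Finset.card_univ, nsmul_eq_mul, Fintype.card_fin]
  push_cast
  ring

/-- The bound of `Net.card_le`. -/
noncomputable def sizeBound (z d k : ℚ) : ℚ :=
  5 ^ 80 * (100000 * z + 1000000000 * d) + 64 * k

theorem sizeBound_mono {z z' d d' k k' : ℚ} (hz : z ≤ z') (hd : d ≤ d') (hk : k ≤ k') :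
    sizeBound z d k ≤ sizeBound z' d' k' := by
  unfold sizeBound
  gcongr

/-- The size of a net is bounded in terms of its degree, its number of components, and the size of
a set `Z` that contains all half-edges outside of the tetrahedra and meets all faces of length two,
except those lying on overlapping dipoles. -/
theorem card_le (Z : Finset H) (hZ : ∀ h, N.kind h ≠ some .tetra → h ∈ Z)
    (h2 : ∀ c h, (N.orb c h).card = 4 → ∃ y ∈ N.orb c h,
      y ∈ Z ∨ N.IsTadpole y ∨ ∃ c', N.IsCenter c c' y) :
    (Fintype.card H : ℚ) ≤ sizeBound Z.card N.deg N.comps := by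
  classical
  have hd := N.deg_nonneg
  -- the possible causes of short faces, which the degree bounds
  let Odd' (c : Color) : Finset H :=
    Finset.univ.filter fun h => N.IsOddFace c h ∧ (N.orb c h).card ≤ 6
  let Cen (c c' : Color) : Finset H := Finset.univ.filter fun h => N.IsCenter c c' h
  let OddU : Finset H := Finset.univ.biUnion Odd'
  let CenU : Finset H := Finset.univ.biUnion fun c => Finset.univ.biUnion fun c' => Cen c c'
  have hOdd : (OddU.card : ℚ) ≤ 864 * N.deg := by
    have h1 : (OddU.card : ℚ) ≤ ∑ c, ((Odd' c).card : ℚ) := by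
      exact_mod_cast Finset.card_biUnion_le
    refine h1.trans ((Finset.sum_le_sum fun c _ => N.card_odd_le (c := c) (Odd' c)
      (fun h hh => (Finset.mem_filter.1 hh).2.1) fun h hh => (Finset.mem_filter.1 hh).2.2).trans ?_)
    simp only [Finset.sum_const, Finset.card_univ, Fintype.card_fin, nsmul_eq_mul]
    push_cast
    linarith
  have hCen : (CenU.card : ℚ) ≤ 4608 * N.deg := by
    have h1 : (CenU.card : ℚ) ≤ ∑ c, ∑ c', ((Cen c c').card : ℚ) := by
      have : CenU.card ≤ ∑ c, ∑ c', (Cen c c').card :=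
        Finset.card_biUnion_le.trans (Finset.sum_le_sum fun c _ => Finset.card_biUnion_le)
      exact_mod_cast this
    refine h1.trans ((Finset.sum_le_sum fun c _ => Finset.sum_le_sum fun c' _ =>
      N.card_center_le (c := c) (c' := c') (Cen c c')
        (fun h hh => (Finset.mem_filter.1 hh).2)).trans ?_)
    simp only [Finset.sum_const, Finset.card_univ, Fintype.card_fin, nsmul_eq_mul]
    push_cast
    linarith
  have htad : ∀ y, N.IsTadpole y → y ∈ OddU := by
    rintro y ⟨hk, d, hE⟩
    exact Finset.mem_biUnion.2 ⟨d, Finset.mem_univ _,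
      Finset.mem_filter.2 ⟨Finset.mem_univ _, N.isOddFace_of_tadpole hk hE⟩⟩
  let D : Finset H := Z ∪ (OddU ∪ CenU)
  have hD : (D.card : ℚ) ≤ Z.card + 5472 * N.deg := by
    have h1 : D.card ≤ Z.card + (OddU.card + CenU.card) :=
      (Finset.card_union_le _ _).trans (Nat.add_le_add_left (Finset.card_union_le _ _) _)
    have h2 : (D.card : ℚ) ≤ Z.card + (OddU.card + CenU.card) := by exact_mod_cast h1
    linarith
  -- every short face meets `D`
  have hshort : ∀ c h, (N.orb c h).card < 8 → ∃ y ∈ N.orb c h, y ∈ D := by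
    intro c h hlt
    by_contra! hcon
    have hnZ : ∀ y ∈ N.orb c h, y ∉ Z := fun y hy h' =>
      hcon y hy (Finset.mem_union_left _ h')
    have hnO : ∀ y ∈ N.orb c h, y ∉ OddU := fun y hy h' =>
      hcon y hy (Finset.mem_union_right _ (Finset.mem_union_left _ h'))
    have hnC : ∀ y ∈ N.orb c h, y ∉ CenU := fun y hy h' =>
      hcon y hy (Finset.mem_union_right _ (Finset.mem_union_right _ h'))
    have hk : ∀ y ∈ N.orb c h, N.kind y = some .tetra := fun y hy => by
      by_contra h'
      exact hnZ y hy (hZ y h')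
    have hself := self_mem_cls (N.face c) h
    obtain ⟨m, hm⟩ := N.even_card_orb c h
    have h2le := N.two_le_card_orb c h
    have hm' : (N.orb c h).card = m + m := hm
    obtain hm1 | hm1 | hm1 : m = 1 ∨ m = 2 ∨ m = 3 := by omega
    · exact hnO h hself (htad h ⟨hk h hself, c, N.E_eq_of_card (by omega)⟩)
    · obtain ⟨y, hy, h' | h' | ⟨c', h'⟩⟩ := h2 c h (by omega)
      · exact hnZ y hy h'
      · exact hnO y hy (htad y h')
      · exact hnC y hy (Finset.mem_biUnion.2 ⟨c, Finset.mem_univ _, Finset.mem_biUnion.2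
          ⟨c', Finset.mem_univ _, Finset.mem_filter.2 ⟨Finset.mem_univ _, h'⟩⟩⟩)
    · refine hnO h hself (Finset.mem_biUnion.2 ⟨c, Finset.mem_univ _,
        Finset.mem_filter.2 ⟨Finset.mem_univ _, ?_, by omega⟩⟩)
      exact N.isOddFace_of_card hk (by omega) fun y hy h' => hnO y hy (htad y h')
  -- short and long faces, a flat face having eight half-edges
  let Sh (c : Color) : Finset H := Finset.univ.filter fun h => (N.orb c h).card < 8
  let Lo (c : Color) : Finset H := Finset.univ.filter fun h => 8 < (N.orb c h).card
  have hSh : ∀ c, ((Sh c).card : ℚ) ≤ 8 * D.card := by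
    intro c
    have := N.card_filter_le_of_orb_le c 8 D (Sh c)
      (fun h hh => (Finset.mem_filter.1 hh).2.le) fun h hh => hshort c h (Finset.mem_filter.1 hh).2
    have : ((Sh c).card : ℚ) ≤ D.card * 8 := by exact_mod_cast this
    linarith
  have hcurv := N.sum_curvature
  -- the curvature of a long face is at most `4 / 9 - 1 / 2 = - 1 / 18` at each of its half-edges
  have hterm : ∀ c h, (4 / ((N.orb c h).card : ℚ) - 1 / 2) ≤
      (if h ∈ Sh c then 2 else 0) - (if h ∈ Lo c then 1 / 18 else 0) := by
    intro c h
    have h2le : (2 : ℚ) ≤ (N.orb c h).card := by exact_mod_cast N.two_le_card_orb c h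
    have hpos : (0 : ℚ) < (N.orb c h).card := by linarith
    simp only [Sh, Lo, Finset.mem_filter, Finset.mem_univ, true_and]
    rcases lt_trichotomy (N.orb c h).card 8 with h' | h' | h'
    · rw [if_pos h', if_neg (by omega), sub_zero, sub_le_iff_le_add, div_le_iff₀ hpos]
      linarith
    · rw [if_neg (by omega), if_neg (by omega), h']
      norm_num
    · rw [if_neg (by omega), if_pos h', sub_le_iff_le_add, div_le_iff₀ hpos]
      have : (9 : ℚ) ≤ (N.orb c h).card := by exact_mod_cast h'
      linarith
  have hsum := Finset.sum_le_sum (s := (Finset.univ : Finset Color)) fun c _ =>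
    Finset.sum_le_sum (s := (Finset.univ : Finset H)) fun h _ => hterm c h
  rw [hcurv] at hsum
  have hterm2 : ∑ h, (4 * halfEdgeWeight (N.kind h) - 3 / 2) ≥ - (3 / 2 * (Z.card : ℚ)) := by
    have : ∀ h, (if h ∈ Z then (- (3 / 2) : ℚ) else 0) ≤
        4 * halfEdgeWeight (N.kind h) - 3 / 2 := by
      intro h
      rcases hk : N.kind h with _ | (_ | i)
      · rw [if_pos (hZ h (by simp [hk]))]; simp [halfEdgeWeight]
      · split_ifs <;> simp [halfEdgeWeight]
        all_goals norm_num
      · rw [if_pos (hZ h (by simp [hk]))]; norm_num [halfEdgeWeight]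
    have h3 := Finset.sum_le_sum (s := (Finset.univ : Finset H)) fun h _ => this h
    rw [Finset.sum_ite_mem, Finset.univ_inter, Finset.sum_const, nsmul_eq_mul] at h3
    linarith
  -- short faces bound the positive curvature, hence the number of half-edges on long faces
  have hLo : ∑ c, ((Lo c).card : ℚ) ≤ 18 * (4 * N.deg + 3 / 2 * Z.card + 48 * D.card) := by
    have e : ∑ c, ∑ h, ((if h ∈ Sh c then (2 : ℚ) else 0) - (if h ∈ Lo c then 1 / 18 else 0)) =
        ∑ c, (((Sh c).card : ℚ) * 2 - (Lo c).card * (1 / 18)) := by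
      refine Finset.sum_congr rfl fun c _ => ?_
      rw [Finset.sum_sub_distrib, Finset.sum_ite_mem, Finset.sum_ite_mem, Finset.univ_inter,
        Finset.univ_inter, Finset.sum_const, Finset.sum_const, nsmul_eq_mul, nsmul_eq_mul]
    have e2 : ∑ c, (((Sh c).card : ℚ) * 2 - (Lo c).card * (1 / 18)) =
        (∑ c, ((Sh c).card : ℚ)) * 2 - (∑ c, ((Lo c).card : ℚ)) * (1 / 18) := by
      rw [Finset.sum_sub_distrib, ← Finset.sum_mul, ← Finset.sum_mul]
    rw [e, e2] at hsum
    have h3 : ∑ c, ((Sh c).card : ℚ) ≤ 24 * D.card := by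
      refine (Finset.sum_le_sum fun c _ => hSh c).trans ?_
      simp only [Finset.sum_const, Finset.card_univ, Fintype.card_fin, nsmul_eq_mul]
      push_cast
      linarith
    have h4 : (0 : ℚ) ≤ N.comps := by positivity
    linarith
  let Bad : Finset H := Z ∪ Finset.univ.biUnion fun c => Sh c ∪ Lo c
  have hBad : (Bad.card : ℚ) ≤ 100000 * Z.card + 1000000000 * N.deg := by
    have h1 : Bad.card ≤ Z.card + ∑ c, ((Sh c).card + (Lo c).card) :=
      (Finset.card_union_le _ _).trans (Nat.add_le_add_left (Finset.card_biUnion_le.trans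
        (Finset.sum_le_sum fun c _ => Finset.card_union_le _ _)) _)
    have h2 : (Bad.card : ℚ) ≤ Z.card + ∑ c, (((Sh c).card : ℚ) + (Lo c).card) := by
      exact_mod_cast h1
    rw [Finset.sum_add_distrib] at h2
    have h3 : ∑ c, ((Sh c).card : ℚ) ≤ 24 * D.card := by
      refine (Finset.sum_le_sum fun c _ => hSh c).trans ?_
      simp only [Finset.sum_const, Finset.card_univ, Fintype.card_fin, nsmul_eq_mul]
      push_cast
      linarith
    have h4 : (0 : ℚ) ≤ Z.card := by positivity
    linarith
  have hF : N.IsFlat Bad := by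
    refine ⟨fun y hy => ?_, fun y hy c => ?_⟩
    · by_contra h
      exact hy (Finset.mem_union_left _ (hZ y h))
    · by_contra h
      refine hy (Finset.mem_union_right _ (Finset.mem_biUnion.2 ⟨c, Finset.mem_univ _, ?_⟩))
      simp only [Sh, Lo, Finset.mem_union, Finset.mem_filter, Finset.mem_univ, true_and]
      omega
  have := hF.card_le
  unfold sizeBound
  linarith

end Net

/-! ### Connected components of a net -/

/-- Connections inside a union of classes. -/
theorem quot_mk_subtype {H : Type*} {p : H → Prop} {r : H → H → Prop}
    {r' : {h // p h} → {h // p h} → Prop} (hp : ∀ x y, r x y → (p x ↔ p y))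
    (hr : ∀ x y (hx : p x) (hy : p y), r x y → r' ⟨x, hx⟩ ⟨y, hy⟩) {x y : H}
    (h : Quot.mk r x = Quot.mk r y) (hx : p x) (hy : p y) :
    Quot.mk r' ⟨x, hx⟩ = Quot.mk r' ⟨y, hy⟩ := by
  have h' := Quot.eqvGen_exact h
  clear h
  have hpp : ∀ x y, Relation.EqvGen r x y → (p x ↔ p y) := by
    intro x y h
    induction h with
    | rel x y h => exact hp x y h
    | refl x => rfl
    | symm x y _ ih => exact ih.symm
    | trans x y z _ _ ih1 ih2 => exact ih1.trans ih2
  induction h' with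
  | rel x y h => exact Quot.sound (hr x y hx hy h)
  | refl x => rfl
  | symm x y _ ih => exact (ih hy hx).symm
  | trans x y z h1 _ ih1 ih2 =>
    have hy' := (hpp _ _ h1).1 hx
    exact (ih1 hx hy').trans (ih2 hy' hy)

namespace Net

variable {H : Type} (N : Net H)

theorem conn_E (h : H) : Quot.mk N.conn (N.E h) = Quot.mk N.conn h :=
  (Quot.sound (r := N.conn) (Or.inl rfl)).symm

theorem conn_X (c : Color) (h : H) : Quot.mk N.conn (N.X c h) = Quot.mk N.conn h :=
  (Quot.sound (r := N.conn) (Or.inr ⟨c, rfl⟩)).symm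

/-- The half-edges of a connected component. -/
abbrev Comp (q : Quot N.conn) : Type := {h : H // Quot.mk N.conn h = q}

/-- A connected component of a net. -/
def comp (q : Quot N.conn) : Net (N.Comp q) where
  E h := ⟨N.E h.1, (N.conn_E h.1).trans h.2⟩
  X c h := ⟨N.X c h.1, (N.conn_X c h.1).trans h.2⟩
  kind h := N.kind h.1
  E_invol _ := Subtype.ext (N.E_invol _)
  E_ne _ e := N.E_ne _ (congrArg Subtype.val e)
  X_invol c _ := Subtype.ext (N.X_invol c _)
  X_ne c _ e := N.X_ne c _ (congrArg Subtype.val e)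
  kind_X c _ := N.kind_X c _
  tetra_mul h1 h2 h3 h4 := Subtype.ext (N.tetra_mul h1 h2 h3 h4)
  pillow_eq h1 h2 h3 := Subtype.ext (N.pillow_eq h1 h2 h3)
  pillow_comm h1 h2 := Subtype.ext (N.pillow_comm h1 h2)
  pillow_ne h1 h2 e := N.pillow_ne h1 h2 (congrArg Subtype.val e)
  pair_eq h1 := Subtype.ext (N.pair_eq h1)

theorem comp_conn_eq {q : Quot N.conn} (x y : N.Comp q) :
    Quot.mk (N.comp q).conn x = Quot.mk (N.comp q).conn y := by
  refine quot_mk_subtype (r := N.conn) ?_ ?_ (x.2.trans y.2.symm) x.2 y.2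
  · intro x y h
    rw [show Quot.mk N.conn x = Quot.mk N.conn y from Quot.sound h]
  · rintro x y hx hy (h | ⟨c, h⟩)
    · exact Or.inl (Subtype.ext h)
    · exact Or.inr ⟨c, Subtype.ext h⟩

theorem comp_comps (q : Quot N.conn) : (N.comp q).comps = 1 := by
  rw [comps, Nat.card_eq_one_iff_unique]
  refine ⟨⟨fun a b => ?_⟩, ?_⟩
  · induction a using Quot.ind with
    | mk x => induction b using Quot.ind with
      | mk y => exact N.comp_conn_eq x y
  · obtain ⟨x, hx⟩ := Quot.exists_rep q
    exact ⟨Quot.mk _ ⟨x, hx⟩⟩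

variable [Fintype H]

noncomputable instance (q : Quot N.conn) : Fintype (N.Comp q) := by
  classical exact inferInstance

theorem comp_card_orb {q : Quot N.conn} (c : Color) (h : N.Comp q) :
    ((N.comp q).orb c h).card = (N.orb c h.1).card := by
  classical
  refine Finset.card_bij (fun y _ => y.1) ?_ (fun _ _ _ _ h => Subtype.ext h) ?_
  · intro y hy
    have := mem_cls.1 hy
    refine mem_cls.2 ?_
    have hl : ∀ a b : N.Comp q, (N.comp q).face c a b →
        Quot.mk (N.face c) a.1 = Quot.mk (N.face c) b.1 := by
      rintro a b (rfl | rfl)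
      · exact Quot.sound (Or.inl rfl)
      · exact Quot.sound (Or.inr rfl)
    exact congrArg (Quot.lift (fun a : N.Comp q => Quot.mk (N.face c) a.1) hl) this
  · intro y hy
    have hp : ∀ x y, N.face c x y → (Quot.mk N.conn x = q ↔ Quot.mk N.conn y = q) := by
      rintro x y (rfl | rfl)
      · rw [N.conn_E]
      · rw [N.conn_X]
    have hyq : Quot.mk N.conn y = q := by
      rw [← h.2]
      have hl : ∀ a b : H, N.face c a b → Quot.mk N.conn a = Quot.mk N.conn b := by
        rintro a b (rfl | rfl)
        · rw [N.conn_E]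
        · rw [N.conn_X]
      exact (congrArg (Quot.lift (fun a => Quot.mk N.conn a) hl) (mem_cls.1 hy)).symm
    refine ⟨⟨y, hyq⟩, mem_cls.2 ?_, rfl⟩
    refine quot_mk_subtype (r := N.face c) hp ?_ (mem_cls.1 hy) h.2 hyq
    rintro x y hx hy (h | h)
    · exact Or.inl (Subtype.ext h)
    · exact Or.inr (Subtype.ext h)

/-- The degree as a sum of local contributions. -/
theorem deg_eq_sum : N.deg = 3 * N.comps +
    ∑ h, (halfEdgeWeight (N.kind h) - ∑ c, 1 / ((N.orb c h).card : ℚ)) := by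
  rw [deg, Finset.sum_sub_distrib, Finset.sum_comm]
  simp only [card_quot_eq_sum]
  ring

/-- The degree is additive over the connected components. -/
theorem deg_eq_sum_comp [Fintype (Quot N.conn)] : N.deg = ∑ q, (N.comp q).deg := by
  classical
  let F : H → ℚ := fun h => halfEdgeWeight (N.kind h) - ∑ c, 1 / ((N.orb c h).card : ℚ)
  have h1 : ∀ q, (N.comp q).deg = 3 + ∑ h ∈ Finset.univ.filter (fun h => Quot.mk N.conn h = q),
      F h := by
    intro q
    rw [deg_eq_sum, comp_comps]
    simp only [comp_card_orb]
    have h3 : ∑ x : N.Comp q, F x.1 =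
        ∑ h ∈ Finset.univ.filter (fun h => Quot.mk N.conn h = q), F h := by
      refine Finset.sum_bij (fun x _ => x.1) (fun x _ => ?_) (fun _ _ _ _ h => Subtype.ext h)
        (fun y hy => ⟨⟨y, ?_⟩, Finset.mem_univ _, rfl⟩) (fun _ _ => rfl)
      · simpa using x.2
      · simpa using hy
    rw [← h3, Nat.cast_one, mul_one]
    rfl
  have h2 : ∑ q, (3 + ∑ h ∈ Finset.univ.filter (fun h => Quot.mk N.conn h = q), F h) =
      3 * N.comps + ∑ h, F h := by
    rw [Finset.sum_add_distrib, comps, Nat.card_eq_fintype_card]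
    have h3 := Finset.sum_fiberwise Finset.univ (Quot.mk N.conn) F
    simp only [Finset.sum_const, Finset.card_univ, nsmul_eq_mul, mul_comm]
    congr 1
  rw [deg_eq_sum, Finset.sum_congr rfl fun q _ => h1 q, h2]

/-! ### Nets of degree zero -/

/-- Degrees are half-integers. -/
theorem deg_mem_half (hw : ∃ m : ℕ, ∑ h, halfEdgeWeight (N.kind h) = m / 2) :
    ∃ m : ℤ, N.deg = m / 2 := by
  obtain ⟨m, hm⟩ := hw
  refine ⟨6 * N.comps + m - 2 * ∑ c, (Nat.card (Quot (N.face c)) : ℤ), ?_⟩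
  rw [deg, hm]
  push_cast
  ring

variable {N}

theorem not_isOddFace (hd : N.deg = 0) (c : Color) (h : H) : ¬ N.IsOddFace c h := by
  intro hodd
  have := N.card_le_of_odd_of_far (c := c) {h} (by simpa using hodd) (by simp)
  rw [hd] at this
  norm_num at this

theorem not_isCenter (hd : N.deg = 0) (c c' : Color) (h : H) : ¬ N.IsCenter c c' h := by
  intro hcen
  have := N.card_le_of_center_of_far (c := c) (c' := c') {h} (by simpa using hcen) (by simp)
  rw [hd] at this
  norm_num at this

theorem not_isTadpole (hd : N.deg = 0) (h : H) : ¬ N.IsTadpole h := by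
  rintro ⟨hk, d, hE⟩
  exact not_isOddFace hd d h (N.isOddFace_of_tadpole hk hE).1

/-- In a connected net, a nonempty set stable under all edges contains everything. -/
theorem eq_univ_of_closed (hc : N.comps = 1) {A : Finset H} (hne : A.Nonempty)
    (hE : ∀ h ∈ A, N.E h ∈ A) (hX : ∀ c, ∀ h ∈ A, N.X c h ∈ A) (y : H) : y ∈ A := by
  obtain ⟨x, hx⟩ := hne
  rw [comps, Nat.card_eq_one_iff_unique] at hc
  obtain ⟨hs, -⟩ := hc
  refine cls_subset (r := N.conn) hx ?_ (mem_cls.2 (Subsingleton.elim _ (Quot.mk _ y)))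
  rintro x y (rfl | ⟨c, rfl⟩)
  · exact ⟨hE x, fun h => by simpa [N.E_invol] using hE _ h⟩
  · exact ⟨hX c x, fun h => by simpa [N.X_invol] using hX c _ h⟩

open scoped Classical in
/-- The half-edges of pairs. -/
noncomputable def pairs (N : Net H) : Finset H := Finset.univ.filter fun h => N.kind h = none

theorem mem_pairs {h : H} : h ∈ N.pairs ↔ N.kind h = none := by simp [pairs]

open scoped Classical in
theorem even_card_orb_pairs (c : Color) (h : H) : Even (N.orb c h ∩ N.pairs).card := by
  refine even_card_of_invol (N.X_invol c) (N.X_ne c) fun y hy => ?_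
  rw [Finset.mem_inter, mem_pairs] at hy ⊢
  exact ⟨N.X_mem_orb hy.1, (N.kind_X _ _).trans hy.2⟩

theorem even_card_tetraOrb (c : Color) (h : H) : Even (N.tetraOrb c h).card := by
  classical
  refine even_card_of_invol (N.X_invol c) (N.X_ne c) fun y hy => ?_
  rw [tetraOrb, Finset.mem_filter] at hy ⊢
  exact ⟨N.X_mem_orb hy.1, (N.kind_X _ _).trans hy.2⟩

open scoped Classical in
/-- In degree zero and without faces of length two through tetrahedra, the curvature of a face is
compensated by the pairs that it crosses: a face crossing one, two or three tetrahedra either is odd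
or crosses pairs. -/
theorem eight_le_card_orb (hc : N.comps = 1) (hd : N.deg = 0)
    (hk : ∀ h, N.kind h = some .tetra ∨ N.kind h = none) {t : H} (ht : N.kind t = some .tetra)
    (hno : ∀ c h, ¬ ((N.orb c h).card = 4 ∧ ∀ y ∈ N.orb c h, N.kind y = some .tetra))
    (c : Color) (h : H) : 8 ≤ (N.orb c h).card + (N.orb c h ∩ N.pairs).card := by
  have hsplit : (N.orb c h).card = (N.tetraOrb c h).card + (N.orb c h ∩ N.pairs).card := by
    rw [← Finset.card_filter_add_card_filter_not (s := N.orb c h)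
      (fun y => N.kind y = some .tetra)]
    congr 2
    ext y
    rw [Finset.mem_filter, Finset.mem_inter, mem_pairs]
    rcases hk y with h' | h' <;> simp [h']
  obtain ⟨a, ha⟩ := even_card_orb_pairs (N := N) c h
  obtain ⟨b, hb⟩ := even_card_tetraOrb (N := N) c h
  by_contra hlt
  push Not at hlt
  have hall : (N.orb c h ∩ N.pairs).card = 0 → ∀ y ∈ N.orb c h, N.kind y = some .tetra := by
    intro h0 y hy
    rcases hk y with h' | h'
    · exact h'
    · have : y ∈ N.orb c h ∩ N.pairs := Finset.mem_inter.2 ⟨hy, mem_pairs.2 h'⟩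
      rw [Finset.card_eq_zero] at h0
      rw [h0] at this
      simp at this
  obtain hb' | hb' | hb' | hb' : b = 0 ∨ b = 1 ∨ b = 2 ∨ b = 3 := by omega
  · -- the face only crosses pairs, and is the whole net
    have hnone : ∀ y ∈ N.orb c h, N.kind y = none := by
      intro y hy
      rcases hk y with h' | h'
      · have : y ∈ N.tetraOrb c h := Finset.mem_filter.2 ⟨hy, h'⟩
        rw [Finset.card_eq_zero.1 (by omega : (N.tetraOrb c h).card = 0)] at this
        simp at this
      · exact h'
    have := eq_univ_of_closed hc ⟨h, self_mem_cls _ _⟩ (fun y hy => N.E_mem_orb (h := h) hy)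
      (fun d y hy => by
        rw [N.pair_eq (i := d) (j := c) (hnone y hy)]; exact N.X_mem_orb hy) t
    rw [hnone t this] at ht
    exact absurd ht (by simp)
  · -- the face crosses a single tetrahedron, so it is odd
    refine not_isOddFace hd c h ⟨fun y _ => hk y, ?_, by omega⟩
    intro y hy d hdc hdy
    have hky := (Finset.mem_filter.1 hy).2
    have hsub : ({y, N.X c y, N.X d y} : Finset H) ⊆ N.tetraOrb c h := by
      intro z hz
      simp only [Finset.mem_insert, Finset.mem_singleton] at hz
      rcases hz with rfl | rfl | rfl
      · exact hy
      · exact Finset.mem_filter.2 ⟨N.X_mem_orb (Finset.mem_filter.1 hy).1, (N.kind_X _ _).trans hky⟩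
      · exact Finset.mem_filter.2 ⟨hdy, (N.kind_X _ _).trans hky⟩
    have h3 := Finset.card_le_card hsub
    rw [Finset.card_insert_of_notMem, Finset.card_pair (N.tetra_ne hky hdc.symm)] at h3
    · omega
    · simpa using ⟨(N.X_ne c y).symm, (N.X_ne d y).symm⟩
  · have h0 : (N.orb c h ∩ N.pairs).card = 0 := by omega
    exact hno c h ⟨by omega, hall h0⟩
  · have h0 : (N.orb c h ∩ N.pairs).card = 0 := by omega
    exact not_isOddFace hd c h (N.isOddFace_of_card (hall h0) (by omega)
      fun y _ => not_isTadpole hd y)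

open scoped Classical in
/-- A connected net of degree zero with at least one tetrahedron, no pillow and at most two pairs
has a face of length two that crosses no pair. -/
theorem exists_card_orb_eq_four (hc : N.comps = 1) (hd : N.deg = 0)
    (hk : ∀ h, N.kind h = some .tetra ∨ N.kind h = none) {t : H} (ht : N.kind t = some .tetra)
    (hP : N.pairs.card ≤ 4) :
    ∃ c h, (N.orb c h).card = 4 ∧ ∀ y ∈ N.orb c h, N.kind y = some .tetra := by
  by_contra hcon
  push Not at hcon
  have hno : ∀ c h, ¬ ((N.orb c h).card = 4 ∧ ∀ y ∈ N.orb c h, N.kind y = some .tetra) := by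
    rintro c h ⟨h1, h2⟩
    obtain ⟨y, hy, hy'⟩ := hcon c h h1
    exact hy' (h2 y hy)
  have h8 := eight_le_card_orb hc hd hk ht hno
  have hpos : ∀ c h, (0 : ℚ) < (N.orb c h).card := fun c h => by
    exact_mod_cast card_cls_pos _ _
  -- curvature of a face, with half of the contribution of the pairs that it crosses
  let g (c : Color) (h : H) : ℚ :=
    (4 / ((N.orb c h).card : ℚ) - 1 / 2) - ((N.orb c h ∩ N.pairs).card : ℚ) / (N.orb c h).card / 2
  have hg : ∀ c h, g c h =
      (8 - (((N.orb c h).card + (N.orb c h ∩ N.pairs).card : ℕ) : ℚ)) / (2 * (N.orb c h).card) := by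
    intro c h
    have := hpos c h
    simp only [g]
    push_cast
    field_simp
    ring
  have hg0 : ∀ c h, g c h ≤ 0 := by
    intro c h
    rw [hg]
    refine div_nonpos_of_nonpos_of_nonneg ?_ (by have := hpos c h; linarith)
    have : (8 : ℚ) ≤ (((N.orb c h).card + (N.orb c h ∩ N.pairs).card : ℕ) : ℚ) := by
      exact_mod_cast h8 c h
    linarith
  have hpc : ∀ c, ∑ h, ((N.orb c h ∩ N.pairs).card : ℚ) / (N.orb c h).card = N.pairs.card := by
    intro c
    have := sum_card_quot (N.face c) fun h => if h ∈ N.pairs then (1 : ℚ) else 0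
    simp only [Finset.sum_ite_mem, Finset.univ_inter, Finset.sum_const, nsmul_eq_mul, mul_one] at this
    exact this
  have hw : ∑ h, (4 * halfEdgeWeight (N.kind h) - 3 / 2) = - (3 / 2 * (N.pairs.card : ℚ)) := by
    have : ∀ h, 4 * halfEdgeWeight (N.kind h) - 3 / 2 =
        if h ∈ N.pairs then (-(3 / 2) : ℚ) else 0 := by
      intro h
      rcases hk h with h' | h'
      · rw [if_neg (by simp [mem_pairs, h']), h']; norm_num [halfEdgeWeight]
      · rw [if_pos (mem_pairs.2 h'), h']; norm_num [halfEdgeWeight]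
    simp only [this, Finset.sum_ite_mem, Finset.univ_inter, Finset.sum_const, nsmul_eq_mul]
    ring
  have hsum : ∑ c, ∑ h, g c h = 12 - 3 * N.pairs.card := by
    have h1 := N.sum_curvature
    rw [hw, hc, hd] at h1
    simp only [g, Finset.sum_sub_distrib, ← Finset.sum_div, hpc] at h1 ⊢
    rw [h1]
    simp only [Finset.sum_const, Finset.card_univ, Fintype.card_fin, nsmul_eq_mul]
    push_cast
    ring
  have hP' : (N.pairs.card : ℚ) ≤ 4 := by exact_mod_cast hP
  have hle : ∑ c, ∑ h, g c h ≤ 0 :=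
    Finset.sum_nonpos fun c _ => Finset.sum_nonpos fun h _ => hg0 c h
  have hP4 : N.pairs.card = 4 := by
    have : (4 : ℚ) ≤ N.pairs.card := by linarith
    have : 4 ≤ N.pairs.card := by exact_mod_cast this
    omega
  -- the total curvature is `12 - 3 * 4 = 0`, so equality holds everywhere
  have hzero : ∀ c h, (N.orb c h).card + (N.orb c h ∩ N.pairs).card = 8 := by
    have h0 : ∑ c, ∑ h, g c h = 0 := by rw [hsum, hP4]; norm_num
    intro c h
    have h1 := (Finset.sum_eq_zero_iff_of_nonpos
      fun c _ => Finset.sum_nonpos fun h _ => hg0 c h).1 h0 c (Finset.mem_univ _)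
    have h2 := (Finset.sum_eq_zero_iff_of_nonpos fun h _ => hg0 c h).1 h1 h (Finset.mem_univ _)
    rw [hg, div_eq_zero_iff] at h2
    rcases h2 with h2 | h2
    · have : (((N.orb c h).card + (N.orb c h ∩ N.pairs).card : ℕ) : ℚ) = 8 := by linarith
      exact_mod_cast this
    · have := hpos c h
      linarith
  obtain ⟨p, hp⟩ : N.pairs.Nonempty := Finset.card_pos.1 (by omega)
  have hpk := mem_pairs.1 hp
  have hXp : ∀ c, N.X c p = N.X 0 p := fun c => N.pair_eq hpk
  have hmem : ∀ c, p ∈ N.orb c p := fun c => self_mem_cls _ _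
  have hself : ∀ c, ({p, N.X c p} : Finset H) ⊆ N.orb c p ∩ N.pairs := by
    intro c y hy
    simp only [Finset.mem_insert, Finset.mem_singleton] at hy
    rw [Finset.mem_inter, mem_pairs]
    rcases hy with rfl | rfl
    · exact ⟨hmem c, hpk⟩
    · exact ⟨N.X_mem_orb (hmem c), (N.kind_X _ _).trans hpk⟩
  -- the face through `p` crosses one pair and two tetrahedra
  have h62 : ∀ c, (N.orb c p).card = 6 ∧ N.orb c p ∩ N.pairs = {p, N.X c p} := by
    intro c
    have h1 := Finset.card_le_card (hself c)
    rw [Finset.card_pair (N.X_ne c p).symm] at h1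
    have h2 := Finset.card_le_card (Finset.inter_subset_left (s₁ := N.orb c p) (s₂ := N.pairs))
    obtain ⟨a, ha⟩ := even_card_orb_pairs (N := N) c p
    have h3 := hzero c p
    obtain h4 | h4 : a = 1 ∨ a = 2 := by omega
    · exact ⟨by omega, (Finset.eq_of_subset_of_card_le (hself c)
        (by rw [Finset.card_pair (N.X_ne c p).symm]; omega)).symm⟩
    · exfalso
      have h5 : N.orb c p ∩ N.pairs = N.orb c p :=
        Finset.eq_of_subset_of_card_le Finset.inter_subset_left (by omega)
      have hnone : ∀ y ∈ N.orb c p, N.kind y = none := fun y hy => by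
        rw [← h5] at hy
        exact mem_pairs.1 (Finset.mem_inter.1 hy).2
      have := eq_univ_of_closed hc ⟨p, hmem c⟩ (fun y hy => N.E_mem_orb (h := p) hy)
        (fun d y hy => by
          rw [N.pair_eq (i := d) (j := c) (hnone y hy)]; exact N.X_mem_orb hy) t
      rw [hnone t this] at ht
      exact absurd ht (by simp)
  set x := N.X 0 p with hx
  have hEp : N.E p ≠ x := by
    intro e
    have h1 : N.orb 0 p ⊆ {p, x} := by
      refine N.orb_subset (by simp) ?_ ?_
      · intro z hz
        simp only [Finset.mem_insert, Finset.mem_singleton] at hz ⊢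
        rcases hz with rfl | rfl
        · exact Or.inr e
        · rw [← e, N.E_invol]; simp
      · intro z hz
        simp only [Finset.mem_insert, Finset.mem_singleton] at hz ⊢
        rcases hz with rfl | rfl
        · exact Or.inr rfl
        · rw [hx, N.X_invol]; simp
    have h2 := Finset.card_le_card h1
    have h3 := Finset.card_le_two (a := p) (b := x)
    rw [(h62 0).1] at h2
    omega
  have hEx : N.E x ≠ p := fun e => hEp (by rw [← e, N.E_invol])
  have htet : ∀ y ∈ N.orb 0 p, y ≠ p → y ≠ x → N.kind y = some .tetra := by
    intro y hy h1 h2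
    rcases hk y with h' | h'
    · exact h'
    · have : y ∈ N.orb 0 p ∩ N.pairs := Finset.mem_inter.2 ⟨hy, mem_pairs.2 h'⟩
      rw [(h62 0).2] at this
      simp only [Finset.mem_insert, Finset.mem_singleton] at this
      rcases this with h | h
      · exact absurd h h1
      · exact absurd h h2
  have ku : N.kind (N.E p) = some .tetra := htet _ (N.E_mem_orb (hmem 0)) (N.E_ne p) hEp
  have kv : N.kind (N.E x) = some .tetra :=
    htet _ (N.E_mem_orb (N.X_mem_orb (hmem 0))) hEx (N.E_ne x)
  -- hence the two ends of `p` are at two tetrahedra joined by three further edges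
  have hall : ∀ c, N.E (N.X c (N.E p)) = N.X c (N.E x) := by
    intro c
    have h1 : (N.orb c x).card = 6 := by
      rw [← (h62 c).1]
      have : x ∈ N.orb c p := by rw [← hXp c]; exact N.X_mem_orb (hmem c)
      exact congrArg Finset.card (cls_eq_of_mem this)
    have h2 : N.E (N.X c (N.E (N.X c (N.E (N.X c x))))) = x := N.step_iterate_eq c x (l := 3) h1
    have h3 : N.X c x = p := by rw [← hXp c, N.X_invol]
    rw [h3] at h2
    rw [← N.X_invol c (N.E (N.X c (N.E p))), ← N.E_invol (N.X c (N.E (N.X c (N.E p)))), h2]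
  have hall' : ∀ c, N.E (N.X c (N.E x)) = N.X c (N.E p) := fun c => by
    rw [← hall c, N.E_invol]
  -- this closes the component up, with a single pair
  let A : Finset H := {p, x} ∪ (N.nbhd (N.E p) ∪ N.nbhd (N.E x))
  have memA : ∀ z, z ∈ A ↔ (z = p ∨ z = x) ∨ (N.Adj (N.E p) z ∨ N.Adj (N.E x) z) := by
    intro z
    simp only [A, Finset.mem_union, mem_nbhd, Finset.mem_insert, Finset.mem_singleton]
  have hA := eq_univ_of_closed hc (A := A) ⟨p, by simp [memA]⟩
    (by
      intro z hz
      rw [memA] at hz ⊢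
      rcases hz with (rfl | rfl) | ((rfl | ⟨d, rfl⟩) | (rfl | ⟨d, rfl⟩))
      · exact Or.inr (Or.inl (Or.inl rfl))
      · exact Or.inr (Or.inr (Or.inl rfl))
      · rw [N.E_invol]; simp
      · rw [hall]; exact Or.inr (Or.inr (N.adj_X _ _))
      · rw [N.E_invol]; simp
      · rw [hall']; exact Or.inr (Or.inl (N.adj_X _ _)))
    (by
      intro c z hz
      rw [memA] at hz ⊢
      rcases hz with (rfl | rfl) | (h | h)
      · exact Or.inl (Or.inr (hXp c))
      · exact Or.inl (Or.inl (by rw [← hXp c, N.X_invol]))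
      · exact Or.inr (Or.inl (h.X ku c))
      · exact Or.inr (Or.inr (h.X kv c)))
  have hsub : N.pairs ⊆ {p, x} := by
    intro z hz
    have hzk := mem_pairs.1 hz
    have := hA z
    rw [memA] at this
    rcases this with h | h | h
    · simpa using h
    · rw [h.kind_eq, ku] at hzk; simp at hzk
    · rw [h.kind_eq, kv] at hzk; simp at hzk
  have := Finset.card_le_card hsub
  have := Finset.card_le_two (a := p) (b := x)
  omega

end Net

/-! ### The net of a graph -/

/-- The translation that joins two half-edges of a node by an edge of color `c`. A node of kind
`none` is a union of two pairs, one for each side. -/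
def nodeShift : Option Bubble → Color → Pos
  | none, _ => (0, 1)
  | some b, c => b.shift c

theorem Pos.add_self (x : Pos) : x + x = 0 := by revert x; decide

theorem Pos.add_add_self (x y : Pos) : x + y + y = x := by rw [add_assoc, Pos.add_self, add_zero]

theorem colorVec_ne_zero (c : Color) : colorVec c ≠ 0 := by revert c; decide

theorem colorVec_inj {c d : Color} : colorVec c = colorVec d ↔ c = d := by revert c d; decide

theorem colorVec_add {i j k : Color} (hij : i ≠ j) (hjk : j ≠ k) (hik : i ≠ k) :
    colorVec i + colorVec j = colorVec k := by revert i j k; decide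

theorem exists_colorVec {x : Pos} (h : x ≠ 0) : ∃ c, x = colorVec c := by revert x; decide

theorem nodeShift_ne_zero (b : Option Bubble) (c : Color) : nodeShift b c ≠ 0 := by
  rcases b with _ | (_ | i)
  · simp only [nodeShift]; decide
  · exact colorVec_ne_zero c
  · simp only [nodeShift, Bubble.shift]; split_ifs <;> decide

/-- The half-edges of a bubble are connected by its edges. -/
theorem exists_shift (b : Bubble) (x y : Pos) : ∃ c d, y = x ∨ y = x + b.shift c ∨
    y = x + b.shift c + b.shift d := by
  rcases b with _ | i
  · revert x y; simp only [Bubble.shift]; decide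
  · revert i x y; simp only [Bubble.shift]; decide

/-- The weight of a bubble in the degree. -/
def bubbleWeight : Bubble → ℚ
  | .tetra => 3 / 2
  | .pillow _ => 2

namespace Graph

variable {K : Type} {n : ℕ}

noncomputable instance (G : Graph K n) : Fintype G.V :=
  have := G.finite
  Fintype.ofFinite _

/-- A property of half-edges that propagates along the edges and the nodes holds everywhere. -/
theorem forall_of_connected {K : Type} {n : ℕ} (G : Graph K n) {Φ : G.H → Prop}
    (hE : ∀ h, Φ h → Φ (G.E h)) (hV : ∀ v x y, Φ (G.at' v x) → Φ (G.at' v y))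
    (hL : ∀ l l', Φ (Sum.inr l) → Φ (Sum.inr l')) {h : G.H} (hh : Φ h) (h' : G.H) : Φ h' := by
  have key : ∀ x y, Relation.EqvGen
      (fun x y => G.E x = y ∨
        Sum.elim (fun p => some p.1) (fun _ => none) x =
          (Sum.elim (fun p => some p.1) (fun _ => none) y : Option G.V)) x y → (Φ x ↔ Φ y) := by
    intro x y hxy
    induction hxy with
    | rel x y hxy =>
      rcases hxy with rfl | hxy
      · exact ⟨hE x, fun h => by simpa [G.E_invol] using hE _ h⟩
      · obtain (⟨v, x⟩ | l) := x <;> obtain (⟨w, y⟩ | l') := y <;> simp at hxy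
        · subst hxy
          exact ⟨hV _ _ _, hV _ _ _⟩
        · exact ⟨hL _ _, hL _ _⟩
    | refl x => rfl
    | symm x y _ ih => exact ih.symm
    | trans x y z _ _ ih1 ih2 => exact ih1.trans ih2
  exact (key _ _ (G.connected h h')).1 hh

/-- The net of a graph, where nodes are seen as bubbles or as unions of two pairs. The
hypothesis on `n` holds for vacuum graphs and 2-point graphs. -/
def toNet (G : Graph K n) (β : K → Option Bubble) (hn : ∀ l l' : Fin n, l' = l.rev ↔ l' ≠ l) :
    Net G.H where
  E := G.E
  X c := Sum.elim (fun p => Sum.inl (p.1, p.2 + nodeShift (β (G.kind p.1)) c)) fun l => Sum.inr l.rev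
  kind := Sum.elim (fun p => β (G.kind p.1)) fun _ => none
  E_invol := G.E_invol
  E_ne := G.E_ne
  X_invol c := by
    rintro (⟨v, x⟩ | l)
    · simp only [Sum.elim_inl, Pos.add_add_self]
    · simp
  X_ne c := by
    rintro (⟨v, x⟩ | l) h
    · simp [nodeShift_ne_zero] at h
    · simp only [Sum.elim_inr, Sum.inr.injEq] at h
      exact (hn l l).1 h.symm rfl
  kind_X c := by rintro (⟨v, x⟩ | l) <;> rfl
  tetra_mul {h i j k} hk hij hjk hik := by
    obtain (⟨v, x⟩ | l) := h
    · simp only [Sum.elim_inl] at hk ⊢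
      rw [hk, add_assoc]
      simp only [nodeShift, Bubble.shift]
      rw [colorVec_add (Ne.symm hij) hik hjk]
    · simp at hk
  pillow_eq {h i j k} hk hj hk' := by
    obtain (⟨v, x⟩ | l) := h
    · simp only [Sum.elim_inl] at hk ⊢
      rw [hk]
      simp [nodeShift, Bubble.shift, hj, hk']
    · simp at hk
  pillow_comm {h i j} hk hj := by
    obtain (⟨v, x⟩ | l) := h
    · simp only [Sum.elim_inl, add_assoc]
      rw [add_comm (nodeShift _ i)]
    · simp at hk
  pillow_ne {h i j} hk hj := by
    obtain (⟨v, x⟩ | l) := h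
    · simp only [Sum.elim_inl] at hk ⊢
      rw [hk]
      simp [nodeShift, Bubble.shift, hj]
    · simp at hk
  pair_eq {h i j} hk := by
    obtain (⟨v, x⟩ | l) := h
    · simp only [Sum.elim_inl] at hk ⊢
      rw [hk]
      rfl
    · rfl

variable (G : Graph K n) (β : K → Option Bubble) (hn : ∀ l l' : Fin n, l' = l.rev ↔ l' ≠ l)

/-- A node has four half-edges. -/
theorem sum_halfEdgeWeight :
    ∑ h, halfEdgeWeight ((G.toNet β hn).kind h) = ∑ v, 4 * halfEdgeWeight (β (G.kind v)) := by
  rw [Fintype.sum_sum_type, Fintype.sum_prod_type]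
  have : ∑ l : Fin n, halfEdgeWeight ((G.toNet β hn).kind (Sum.inr l)) = 0 :=
    Finset.sum_eq_zero fun _ _ => rfl
  rw [this, add_zero]
  refine Finset.sum_congr rfl fun v _ => ?_
  change ∑ _x : Pos, halfEdgeWeight (β (G.kind v)) = _
  rw [Finset.sum_const, Finset.card_univ, nsmul_eq_mul]
  rfl

variable {G β hn} in
theorem toNet_conn_node {v : G.V} {b : Bubble} (hb : β (G.kind v) = some b) (x y : Pos) :
    Quot.mk (G.toNet β hn).conn (Sum.inl (v, x)) = Quot.mk (G.toNet β hn).conn (Sum.inl (v, y)) := by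
  have key : ∀ x c, Quot.mk (G.toNet β hn).conn (Sum.inl (v, x)) =
      Quot.mk (G.toNet β hn).conn (Sum.inl (v, x + b.shift c)) := by
    intro x c
    refine Quot.sound (Or.inr ⟨c, ?_⟩)
    change (Sum.inl (v, x + nodeShift (β (G.kind v)) c) : G.H) = _
    rw [hb]; rfl
  obtain ⟨c, d, rfl | rfl | rfl⟩ := exists_shift b x y
  · rfl
  · exact key _ _
  · exact (key _ _).trans (key _ _)

theorem toNet_conn_leg (l l' : Fin n) :
    Quot.mk (G.toNet β hn).conn (Sum.inr l) = Quot.mk (G.toNet β hn).conn (Sum.inr l') := by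
  by_cases h : l' = l
  · rw [h]
  · exact Quot.sound (Or.inr ⟨0, by rw [(hn l l').2 h]; rfl⟩)

end Graph

namespace Graph

variable {n : ℕ} (G : Graph Bubble n) (hn : ∀ l l' : Fin n, l' = l.rev ↔ l' ≠ l)

/-- Graphs are connected. -/
theorem toNet_comps : (G.toNet some hn).comps = 1 := by
  rw [Net.comps, Nat.card_eq_one_iff_unique]
  obtain ⟨h₀⟩ := G.nonempty
  refine ⟨⟨fun a b => ?_⟩, ⟨Quot.mk _ h₀⟩⟩
  induction a using Quot.ind with | mk x =>
  induction b using Quot.ind with | mk y =>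
  exact forall_of_connected G (Φ := fun y => Quot.mk (G.toNet some hn).conn x = Quot.mk _ y)
    (fun h hh => hh.trans (Net.conn_E _ h).symm)
    (fun v a b hh => hh.trans (toNet_conn_node rfl a b))
    (fun l l' hh => hh.trans (toNet_conn_leg _ _ _ l l')) rfl y

/-- The degree in terms of the weights of the bubbles. -/
theorem degree_eq : G.degree = 3 + ∑ v, bubbleWeight (G.kind v) -
    ∑ c, (Nat.card (G.Face c) : ℚ) := by
  classical
  have h1 : ∀ v, bubbleWeight (G.kind v) = 3 / 2 * (if G.kind v = .tetra then 1 else 0) +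
      2 * (if ∃ i, G.kind v = .pillow i then 1 else 0) := by
    intro v
    rcases G.kind v with _ | i <;> simp [bubbleWeight]
  simp only [h1, Finset.sum_add_distrib, ← Finset.mul_sum, Finset.sum_boole]
  rw [degree, numTetra, numPillow, numFaces, Nat.card_eq_fintype_card, Nat.card_eq_fintype_card,
    Fintype.card_subtype, Fintype.card_subtype]
  push_cast
  ring

/-- The degree of a graph is the degree of its net. -/
theorem degree_eq_deg : G.degree = (G.toNet some hn).deg := by
  rw [degree_eq, Net.deg, toNet_comps, sum_halfEdgeWeight]
  have : ∀ v, bubbleWeight (G.kind v) = 4 * halfEdgeWeight (some (G.kind v)) := by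
    intro v
    rcases G.kind v with _ | i <;> norm_num [bubbleWeight, halfEdgeWeight]
  simp only [this, Nat.cast_one, mul_one]
  rfl

end Graph

theorem vacuum_legs : ∀ l l' : Fin 0, l' = l.rev ↔ l' ≠ l := by decide

theorem twoPoint_legs : ∀ l l' : Fin 2, l' = l.rev ↔ l' ≠ l := by decide

namespace Graph

variable {n : ℕ} {G : Graph Bubble n}

/-! ### Isolated dipoles -/

theorem IsDipole.tetra_or_pillow {i : Color} {A : Set G.V} {p : Pos → G.H}
    (h : IsDipole G i A p) :
    (∃ v, G.kind v = .pillow i ∧ A = {v}) ∨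
      ∃ u v a b, G.kind u = .tetra ∧ G.kind v = .tetra ∧ u ≠ v ∧ A = {u, v} ∧
        G.E (G.at' u a) = G.at' v b ∧
        G.E (G.at' u (a + colorVec i)) = G.at' v (b + colorVec i) := by
  cases h with
  | typeI hu hv huv hij h₁ h₂ => exact Or.inr ⟨_, _, _, _, hu, hv, huv, rfl, h₁, h₂⟩
  | typeII t hv => exact Or.inl ⟨_, hv, rfl⟩

/-- A pillow shares no bubble with another dipole, as the other dipoles through it would consist
of tetrahedra. -/
theorem isIsolated_pillow {v : G.V} {i : Color} (hv : G.kind v = .pillow i) :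
    G.IsIsolated {v} := by
  intro j B p hB
  rcases hB.tetra_or_pillow with ⟨w, -, rfl⟩ | ⟨u, w, a, b, hu, hw, -, rfl, -, -⟩
  · by_cases h : w = v
    · exact Or.inl (by rw [h])
    · exact Or.inr (by simpa using Ne.symm h)
  · refine Or.inr ?_
    rw [Set.disjoint_singleton_left]
    rintro (rfl | rfl)
    · rw [hu] at hv; simp at hv
    · rw [hw] at hv; simp at hv

theorem Pos.third_dipole_aux : ∀ (y : Pos) (c i : Color), y ≠ 0 → y ≠ colorVec c →
    y + colorVec i ≠ 0 → y + colorVec i ≠ colorVec c →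
    i = c ∧ ∃ j, j ≠ c ∧ y = colorVec j := by
  decide

/-- If two half-edges joined by an edge of color `i` of a tetrahedron avoid an edge of color `c`,
then `i = c`, and they form the opposite edge. -/
theorem Pos.third_dipole {b x : Pos} {c i : Color} (h1 : x ≠ b) (h2 : x ≠ b + colorVec c)
    (h3 : x + colorVec i ≠ b) (h4 : x + colorVec i ≠ b + colorVec c) :
    i = c ∧ ∃ j, j ≠ c ∧ x = b + colorVec j := by
  obtain ⟨y, rfl⟩ : ∃ y, x = b + y := ⟨x - b, by simp⟩
  rw [add_assoc] at h3 h4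
  obtain ⟨hi, j, hj, hy⟩ := Pos.third_dipole_aux y c i (by simpa using h1) (by simpa using h2)
    (by simpa using h3) (by simpa using h4)
  exact ⟨hi, j, hj, by rw [hy]⟩

/-- A dipole of two tetrahedra that is not isolated shares one tetrahedron with another dipole of
the same color. -/
theorem exists_third_tetra {u v : G.V} {a b : Pos} {c : Color} (hu : G.kind u = .tetra)
    (hv : G.kind v = .tetra) (h₁ : G.E (G.at' u a) = G.at' v b)
    (h₂ : G.E (G.at' u (a + colorVec c)) = G.at' v (b + colorVec c))
    (hiso : ¬ G.IsIsolated {u, v}) :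
    ∃ z e, (z = u ∧ e = a ∨ z = v ∧ e = b) ∧ ∃ w d j, w ≠ u ∧ w ≠ v ∧ G.kind w = .tetra ∧ j ≠ c ∧
      G.E (G.at' z (e + colorVec j)) = G.at' w d ∧
      G.E (G.at' z (e + colorVec j + colorVec c)) = G.at' w (d + colorVec c) := by
  have h₁' : G.E (G.at' v b) = G.at' u a := by rw [← h₁, G.E_invol]
  have h₂' : G.E (G.at' v (b + colorVec c)) = G.at' u (a + colorVec c) := by
    rw [← h₂, G.E_invol]
  have at_inj : ∀ {v w : G.V} {x y : Pos}, G.at' v x = G.at' w y → v = w := by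
    intro v w x y h
    simp only [at', Sum.inl.injEq, Prod.mk.injEq] at h
    exact h.1
  -- it suffices to find two parallel edges leading out of the dipole
  have key : ∀ z w x y i, z ∈ ({u, v} : Set G.V) → w ∉ ({u, v} : Set G.V) → G.kind w = .tetra →
      G.E (G.at' z x) = G.at' w y → G.E (G.at' z (x + colorVec i)) = G.at' w (y + colorVec i) →
      ∃ z e, (z = u ∧ e = a ∨ z = v ∧ e = b) ∧ ∃ w d j, w ≠ u ∧ w ≠ v ∧ G.kind w = .tetra ∧ j ≠ c ∧
        G.E (G.at' z (e + colorVec j)) = G.at' w d ∧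
        G.E (G.at' z (e + colorVec j + colorVec c)) = G.at' w (d + colorVec c) := by
    intro z w x y i hz hw hkw e₁ e₂
    simp only [Set.mem_insert_iff, Set.mem_singleton_iff, not_or] at hz hw
    obtain ⟨e, he, f₁, f₂⟩ : ∃ e, (z = u ∧ e = a ∨ z = v ∧ e = b) ∧
        (∀ y, G.E (G.at' z e) ≠ G.at' w y) ∧
        ∀ y, G.E (G.at' z (e + colorVec c)) ≠ G.at' w y := by
      rcases hz with rfl | rfl
      · refine ⟨a, Or.inl ⟨rfl, rfl⟩, fun y h => ?_, fun y h => ?_⟩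
        · rw [h₁] at h; exact hw.2 (at_inj h).symm
        · rw [h₂] at h; exact hw.2 (at_inj h).symm
      · refine ⟨b, Or.inr ⟨rfl, rfl⟩, fun y h => ?_, fun y h => ?_⟩
        · rw [h₁'] at h; exact hw.1 (at_inj h).symm
        · rw [h₂'] at h; exact hw.1 (at_inj h).symm
    obtain ⟨rfl, j, hj, rfl⟩ := Pos.third_dipole (b := e) (x := x) (c := c) (i := i)
      (fun h => f₁ _ (h ▸ e₁)) (fun h => f₂ _ (h ▸ e₁)) (fun h => f₁ _ (h ▸ e₂))
      (fun h => f₂ _ (h ▸ e₂))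
    exact ⟨z, e, he, w, y, j, hw.1, hw.2, hkw, hj, e₁, e₂⟩
  simp only [IsIsolated, not_forall, not_or] at hiso
  obtain ⟨i, B, p, hB, hne, hdis⟩ := hiso
  obtain ⟨z, hz, hzB⟩ := Set.not_disjoint_iff.1 hdis
  rcases hB.tetra_or_pillow with ⟨w, hw, rfl⟩ | ⟨u', v', a', b', hu', hv', huv', rfl, e₁, e₂⟩
  · simp only [Set.mem_singleton_iff] at hzB
    subst hzB
    rcases hz with rfl | rfl
    · rw [hu] at hw; simp at hw
    · rw [hv] at hw; simp at hw
  · have e₁' : G.E (G.at' v' b') = G.at' u' a' := by rw [← e₁, G.E_invol]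
    have e₂' : G.E (G.at' v' (b' + colorVec i)) = G.at' u' (a' + colorVec i) := by
      rw [← e₂, G.E_invol]
    have huv : u ≠ v ∨ u = v := (em (u = v)).symm
    by_cases hu1 : u' ∈ ({u, v} : Set G.V)
    · by_cases hv1 : v' ∈ ({u, v} : Set G.V)
      · exfalso
        refine hne (Set.Subset.antisymm ?_ ?_)
        · rintro x (rfl | rfl)
          · exact hu1
          · exact hv1
        · simp only [Set.mem_insert_iff, Set.mem_singleton_iff] at hu1 hv1
          rintro x (rfl | rfl)
          · rcases hu1 with rfl | rfl
            · exact Or.inl rfl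
            · rcases hv1 with rfl | rfl
              · exact Or.inr rfl
              · exact absurd rfl huv'
          · rcases hv1 with rfl | rfl
            · rcases hu1 with rfl | rfl
              · exact absurd rfl huv'
              · exact Or.inl rfl
            · exact Or.inr rfl
      · exact key u' v' a' b' i hu1 hv1 hv' e₁ e₂
    · by_cases hv1 : v' ∈ ({u, v} : Set G.V)
      · exact key v' u' b' a' i hv1 hu1 hu' e₁' e₂'
      · exfalso
        simp only [Set.mem_insert_iff, Set.mem_singleton_iff] at hzB
        rcases hzB with rfl | rfl
        · exact hu1 hz
        · exact hv1 hz

end Graph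

namespace Graph

variable {K : Type} {n : ℕ} {G : Graph K n} {β : K → Option Bubble}
  {hn : ∀ l l' : Fin n, l' = l.rev ↔ l' ≠ l}

theorem at'_inj {v w : G.V} {x y : Pos} : G.at' v x = G.at' w y ↔ v = w ∧ x = y := by
  simp [at']

theorem toNet_X_of_tetra {v : G.V} (hv : β (G.kind v) = some .tetra) (x : Pos) (c : Color) :
    (G.toNet β hn).X c (G.at' v x) = G.at' v (x + colorVec c) := by
  change (Sum.inl (v, x + nodeShift (β (G.kind v)) c) : G.H) = _
  rw [hv]; rfl

theorem eq_of_adj {v w : G.V} {x y : Pos} (h : (G.toNet β hn).Adj (G.at' v x) (G.at' w y)) :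
    v = w := by
  rcases h with h | ⟨d, h⟩
  · exact (at'_inj.1 h).1.symm
  · exact (at'_inj.1 (show G.at' w y = G.at' v (x + nodeShift (β (G.kind v)) d) from h)).1.symm

/-- Two dipoles sharing the tetrahedron `z`. -/
theorem isCenter_of_dipoles {z u w : G.V} {e a d : Pos} {c j : Color}
    (hz : β (G.kind z) = some .tetra) (hu : β (G.kind u) = some .tetra)
    (hw : β (G.kind w) = some .tetra) (hzu : z ≠ u) (hzw : z ≠ w) (huw : u ≠ w) (hj : j ≠ c)
    (e₁ : G.E (G.at' z e) = G.at' u a)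
    (e₂ : G.E (G.at' z (e + colorVec c)) = G.at' u (a + colorVec c))
    (e₃ : G.E (G.at' z (e + colorVec j)) = G.at' w d)
    (e₄ : G.E (G.at' z (e + colorVec j + colorVec c)) = G.at' w (d + colorVec c)) :
    (G.toNet β hn).IsCenter c j (G.at' z e) := by
  have hE : ∀ h, (G.toNet β hn).E h = G.E h := fun _ => rfl
  refine ⟨hj, hz, ?_, ?_, ?_, ?_, ?_, ?_, ?_⟩
  · rw [hE, e₁]; exact hu
  · rw [toNet_X_of_tetra hz, hE, e₃]; exact hw
  · rw [toNet_X_of_tetra hz, hE, hE, e₁, e₂, toNet_X_of_tetra hu]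
  · rw [toNet_X_of_tetra hz, toNet_X_of_tetra hz, hE, hE, e₃, e₄, toNet_X_of_tetra hw]
  · rw [hE, e₁]; exact fun h => hzu (eq_of_adj h)
  · rw [toNet_X_of_tetra hz, hE, e₃]; exact fun h => hzw (eq_of_adj h)
  · rw [toNet_X_of_tetra hz, hE, hE, e₁, e₃]; exact fun h => huw (eq_of_adj h)

theorem isTadpole_of_E {v : G.V} {x y : Pos} (hv : β (G.kind v) = some .tetra)
    (h : G.E (G.at' v x) = G.at' v y) : (G.toNet β hn).IsTadpole (G.at' v x) := by
  have hne : y - x ≠ 0 := by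
    intro h0
    rw [sub_eq_zero] at h0
    rw [h0] at h
    exact G.E_ne _ h
  obtain ⟨d, hd⟩ := exists_colorVec hne
  refine ⟨hv, d, ?_⟩
  rw [toNet_X_of_tetra hv, ← hd, add_sub_cancel]
  exact h

end Graph

namespace Graph

variable {n : ℕ} {G : Graph Bubble n} {hn : ∀ l l' : Fin n, l' = l.rev ↔ l' ≠ l}

theorem IsDipole.exists_at' {i : Color} {A : Set G.V} {p : Pos → G.H} (h : IsDipole G i A p)
    {v : G.V} (hv : v ∈ A) : ∃ x y, p x = G.at' v y := by
  cases h with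
  | typeI hu hv' huv hij h₁ h₂ =>
    rcases hv with rfl | rfl
    · exact ⟨(0, 0), _, if_pos rfl⟩
    · exact ⟨(0, 1), _, if_neg (by decide)⟩
  | typeII t hv' =>
    obtain rfl : v = _ := hv
    exact ⟨0, _, rfl⟩

open scoped Classical in
/-- The number of bubbles is bounded in terms of the degree and of the number of isolated
dipoles. -/
theorem card_half_edges_le_of_isolated (G : VacuumGraph) :
    (Fintype.card G.H : ℚ) ≤ Net.sizeBound (16 * G.numIsolatedDipoles) G.degree 1 := by
  set N := G.toNet some vacuum_legs with hN
  set 𝒳 : Set (Set G.H) := {X | ∃ i A p, IsDipole G i A p ∧ G.IsIsolated A ∧ X = Set.range p}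
    with h𝒳
  have hfin : 𝒳.Finite := Set.toFinite _
  have hcard : hfin.toFinset.card = G.numIsolatedDipoles := by
    rw [numIsolatedDipoles, ← Set.ncard_eq_toFinset_card 𝒳 hfin]
  -- the half-edges of the bubbles of the isolated dipoles
  obtain ⟨P, hP⟩ : ∃ P : Set G.H → G.H → Prop, ∀ X h, P X h ↔
      ∃ v x y, G.at' v x ∈ X ∧ h = G.at' v y := ⟨_, fun _ _ => Iff.rfl⟩
  let Z : Finset G.H := hfin.toFinset.biUnion fun X => Finset.univ.filter (P X)
  have hZ : Z.card ≤ hfin.toFinset.card * 16 := by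
    refine Finset.card_biUnion_le_card_mul _ _ _ fun X hX => ?_
    obtain ⟨i, A, p, -, -, rfl⟩ := hfin.mem_toFinset.1 hX
    have hsub : Finset.univ.filter (P (Set.range p)) ⊆
        (Finset.univ : Finset (Pos × Pos)).image fun q =>
          Sum.map (fun w => (w.1, q.2)) id (p q.1) := by
      intro h hh
      obtain ⟨v, x, y, ⟨z, hz⟩, rfl⟩ := (hP _ _).1 (Finset.mem_filter.1 hh).2
      refine Finset.mem_image.2 ⟨(z, y), Finset.mem_univ _, ?_⟩
      simp only [hz, at', Sum.map_inl]
    refine (Finset.card_le_card hsub).trans (Finset.card_image_le.trans (le_of_eq ?_))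
    rw [Finset.card_univ, Fintype.card_prod]
    rfl
  have hmemZ : ∀ {i A p}, IsDipole G i A p → G.IsIsolated A → ∀ v ∈ A, ∀ y, G.at' v y ∈ Z := by
    intro i A p hd hi v hv y
    obtain ⟨x, z, hz⟩ := hd.exists_at' hv
    refine Finset.mem_biUnion.2 ⟨Set.range p, hfin.mem_toFinset.2 ⟨i, A, p, hd, hi, rfl⟩,
      Finset.mem_filter.2 ⟨Finset.mem_univ _, (hP _ _).2 ⟨v, z, y, ⟨x, hz⟩, rfl⟩⟩⟩
  have hpillow : ∀ v y, G.kind v ≠ .tetra → G.at' v y ∈ Z := by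
    intro v y hv
    obtain ⟨i, hi⟩ : ∃ i, G.kind v = .pillow i := by
      rcases h : G.kind v with _ | i
      · exact absurd h hv
      · exact ⟨i, rfl⟩
    exact hmemZ (.typeII 0 hi) (isIsolated_pillow hi) v rfl y
  have hmain := N.card_le Z ?_ ?_
  · refine hmain.trans (Net.sizeBound_mono ?_ ?_ ?_)
    · rw [hcard] at hZ
      have : (Z.card : ℚ) ≤ ((G.numIsolatedDipoles * 16 : ℕ) : ℚ) := by exact_mod_cast hZ
      push_cast at this
      linarith
    · rw [degree_eq_deg G vacuum_legs]
    · rw [toNet_comps]; norm_num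
  · rintro (⟨v, y⟩ | l) h
    · exact hpillow v y fun e => h (congrArg some e)
    · exact l.elim0
  · rintro c (⟨u, a⟩ | l) h
    swap
    · exact l.elim0
    change (N.orb c (G.at' u a)).card = 4 at h
    change ∃ y ∈ N.orb c (G.at' u a), _
    have hself : G.at' u a ∈ N.orb c (G.at' u a) := self_mem_cls _ _
    by_cases hu : G.kind u = .tetra
    swap
    · exact ⟨_, hself, Or.inl (hpillow u a hu)⟩
    have hE := N.E_X_eq_of_card h
    obtain ⟨⟨v, b⟩ | l, hv⟩ : ∃ h', N.E (G.at' u a) = h' := ⟨_, rfl⟩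
    swap
    · exact l.elim0
    have hvmem : G.at' v b ∈ N.orb c (G.at' u a) := by
      have := N.E_mem_orb hself
      rwa [hv] at this
    by_cases hkv : G.kind v = .tetra
    swap
    · exact ⟨_, hvmem, Or.inl (hpillow v b hkv)⟩
    have hu' : some (G.kind u) = some .tetra := congrArg some hu
    have hv' : some (G.kind v) = some .tetra := congrArg some hkv
    by_cases huv : u = v
    · subst huv
      exact ⟨_, hself, Or.inr (Or.inl (isTadpole_of_E hu' hv))⟩
    have h₁ : G.E (G.at' u a) = G.at' v b := hv
    have h₂ : G.E (G.at' u (a + colorVec c)) = G.at' v (b + colorVec c) := by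
      rw [hv] at hE
      have h3 : N.X c (G.at' u a) = _ := toNet_X_of_tetra hu' a c
      have h4 : N.X c (G.at' v b) = _ := toNet_X_of_tetra hv' b c
      rw [h3] at hE
      exact hE.trans h4
    obtain ⟨j, hj, -⟩ := Color.exists_third c c
    -- a face of length two between distinct tetrahedra is a dipole, which is isolated or overlaps
    -- with another one
    by_cases hiso : G.IsIsolated {u, v}
    · exact ⟨_, hself, Or.inl (hmemZ (.typeI hu hkv huv hj h₁ h₂) hiso u (Or.inl rfl) a)⟩
    obtain ⟨z, e, hz, w, d, j, hwu, hwv, hkw, hj, e₃, e₄⟩ :=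
      exists_third_tetra hu hkv h₁ h₂ hiso
    have hw' : some (G.kind w) = some .tetra := congrArg some hkw
    rcases hz with ⟨rfl, rfl⟩ | ⟨rfl, rfl⟩
    · exact ⟨_, hself, Or.inr (Or.inr ⟨j, isCenter_of_dipoles hu' hv' hw' huv hwu.symm hwv.symm
        hj h₁ h₂ e₃ e₄⟩)⟩
    · exact ⟨_, hvmem, Or.inr (Or.inr ⟨j, isCenter_of_dipoles hv' hu' hw' (Ne.symm huv) hwv.symm
        hwu.symm hj (by rw [← h₁, G.E_invol]) (by rw [← h₂, G.E_invol]) e₃ e₄⟩)⟩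

theorem exists_card_le_of_isolated (ω : ℚ) (k : ℕ) : ∃ N : ℕ, ∀ G : VacuumGraph,
    G.degree = ω → G.numIsolatedDipoles = k → Nat.card G.V ≤ N := by
  refine ⟨⌈Net.sizeBound (16 * k) ω 1⌉₊, fun G hω hk => ?_⟩
  have h := card_half_edges_le_of_isolated G
  rw [hω, hk] at h
  have h1 : Fintype.card G.H = Fintype.card G.V * 4 := by
    rw [Fintype.card_sum, Fintype.card_prod]; rfl
  have h2 := Nat.le_ceil (Net.sizeBound (16 * k) ω 1)
  have h3 : (Fintype.card G.H : ℚ) ≤ ⌈Net.sizeBound (16 * k) ω 1⌉₊ := h.trans h2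
  have h4 : Fintype.card G.H ≤ ⌈Net.sizeBound (16 * k) ω 1⌉₊ := by exact_mod_cast h3
  rw [Nat.card_eq_fintype_card]
  omega

/-! ### Removal of melonic subgraphs -/

/-- Otherwise the legs would be disconnected from the bubbles. -/
theorem E_leg_ne_leg {M : TwoPointGraph} (hM : Nonempty M.V) (l l' : Fin 2) :
    M.E (Sum.inr l) ≠ Sum.inr l' := by
  intro h
  obtain ⟨v⟩ := hM
  have hE : ∀ k : Fin 2, ∃ k', M.E (Sum.inr k) = Sum.inr k' := by
    intro k
    by_cases hk : k = l
    · exact ⟨l', by rw [hk, h]⟩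
    · have hl' : l' ≠ l := fun e => M.E_ne _ (e ▸ h)
      have : k = l' := by omega
      exact ⟨l, by rw [this, ← h, M.E_invol]⟩
  have := forall_of_connected M (Φ := fun h => h.isRight) (h := Sum.inr 0)
    (by
      rintro (x | k) hx
      · simp at hx
      · obtain ⟨k', hk'⟩ := hE k
        rw [hk']; rfl)
    (fun _ _ _ h => h) (fun _ _ h => h) rfl (Sum.inl (v, 0))
  simp at this

/-- The two external half-edges of a 2-point graph are joined by a path of each color. -/
theorem exists_path_legs (M : TwoPointGraph) (c : Color) :
    Quot.mk (fun x y : M.H => M.E x = y ∨ (x.isLeft ∧ M.colorStep c x = y)) (Sum.inr 0) =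
      Quot.mk _ (Sum.inr 1) := by
  let N := M.toNet some twoPoint_legs
  obtain ⟨b, hb, hne, h⟩ := exists_path_end N.E_invol N.E_ne (N.X_invol c) (N.X_ne c)
    {h : M.H | h.isRight} (by rintro (x | l) h <;> simp_all [N, toNet]) (a := Sum.inr 0) rfl
  obtain ⟨l, rfl⟩ : ∃ l, b = Sum.inr l := Sum.isRight_iff.1 hb
  obtain rfl : l = 1 := by
    have : l ≠ 0 := fun h => hne (by rw [h])
    omega
  have hr : (fun x y : M.H => M.E x = y ∨ (x.isLeft ∧ M.colorStep c x = y)) =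
      fun x y => N.E x = y ∨ (x ∉ {h : M.H | h.isRight} ∧ N.X c x = y) := by
    funext x y
    change _ = (M.E x = y ∨ (¬ x.isRight ∧ M.colorStep c x = y))
    simp
  rw [hr]
  exact h

/-- Inserting `M` merges one face of `M` of each color with one face of `G'`. -/
theorem card_face_add_one_le_of_isInsertion {G G' M : TwoPointGraph} {x : G'.H}
    (hM : Nonempty M.V) (h : IsInsertion G G' M x) (c : Color) :
    Nat.card (G.Face c) + 1 ≤ Nat.card (G'.Face c) + Nat.card (M.Face c) := by
  obtain ⟨f, hk', hk, hE', hp, h0, h1⟩ := h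
  dsimp only at hE' hp h0 h1
  set e : G'.H → G.H := Sum.map (fun p => (f (Sum.inl p.1), p.2)) id with he
  set m : M.V × Pos → G.H := fun p => Sum.inl (f (Sum.inr p.1), p.2) with hm
  set r : G.H → G.H → Prop := fun x y : G.H => G.E x = y ∨ G.colorStep c x = y with hr
  have hstep' : ∀ y, G.colorStep c (e y) = e (G'.colorStep c y) := by
    rintro (⟨v, y⟩ | l)
    · simp [he, colorStep, hk']
    · simp [he, colorStep]
  have hstep : ∀ v y, G.colorStep c (m (v, y)) = m (v, y + (M.kind v).shift c) := by
    intro v y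
    simp [hm, colorStep, hk]
  -- the path of `M` joining its legs joins the ends of the edge where `M` is inserted
  have hx : Quot.mk r (e x) = Quot.mk r (e (G'.E x)) := by
    have hl : ∀ y z : M.H, (M.E y = z ∨ (y.isLeft ∧ M.colorStep c y = z)) →
        Quot.mk r (Sum.elim m (fun l => if l = 0 then e x else e (G'.E x)) y) =
        Quot.mk r (Sum.elim m (fun l => if l = 0 then e x else e (G'.E x)) z) := by
      have hleg : ∀ q l, M.E (Sum.inl q) = Sum.inr l →
          G.E (m q) = if l = 0 then e x else e (G'.E x) := by
        intro q l hq
        by_cases hl : l = 0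
        · subst hl; exact h0 q hq
        · obtain rfl : l = 1 := by omega
          exact h1 q hq
      rintro (q | l) z (rfl | ⟨hy, rfl⟩)
      · rcases hq : M.E (Sum.inl q) with q' | l
        · exact Quot.sound (Or.inl (hp _ _ hq))
        · exact Quot.sound (Or.inl (hleg _ _ hq))
      · exact Quot.sound (Or.inr (hstep _ _))
      · rcases hq : M.E (Sum.inr l) with q' | l'
        · have hq' : M.E (Sum.inl q') = Sum.inr l := by rw [← hq, M.E_invol]
          exact (Quot.sound (r := r) (Or.inl (hleg _ _ hq'))).symm
        · exact absurd hq (E_leg_ne_leg hM _ _)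
      · simp at hy
    exact congrArg (Quot.lift _ hl) (exists_path_legs M c)
  have l1 : ∀ y z : G'.H, (G'.E y = z ∨ G'.colorStep c y = z) →
      Quot.mk r (e y) = Quot.mk r (e z) := by
    rintro y z (rfl | rfl)
    · by_cases hy : y = x
      · rw [hy, hx]
      · by_cases hy' : y = G'.E x
        · rw [hy', G'.E_invol, hx]
        · exact Quot.sound (Or.inl (hE' y hy hy'))
    · exact Quot.sound (Or.inr (hstep' y))
  have l2 : ∀ y z : M.H, (M.E y = z ∨ M.colorStep c y = z) →
      Quot.mk r (Sum.elim m (fun _ => e x) y) = Quot.mk r (Sum.elim m (fun _ => e x) z) := by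
    have hleg : ∀ q l, M.E (Sum.inl q) = Sum.inr l →
        Quot.mk r (m q) = Quot.mk r (e x) := by
      intro q l hq
      by_cases hl : l = 0
      · subst hl; exact Quot.sound (Or.inl (h0 q hq))
      · obtain rfl : l = 1 := by omega
        exact (Quot.sound (r := r) (Or.inl (h1 q hq))).trans hx.symm
    rintro (q | l) z (rfl | rfl)
    · rcases hq : M.E (Sum.inl q) with q' | l
      · exact Quot.sound (Or.inl (hp _ _ hq))
      · exact hleg _ _ hq
    · exact Quot.sound (Or.inr (hstep _ _))
    · rcases hq : M.E (Sum.inr l) with q' | l'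
      · exact (hleg q' l (by rw [← hq, M.E_invol])).symm
      · rfl
    · rfl
  -- the faces of `G'` and `M` cover the faces of `G`, and the two faces through the legs and
  -- through `x` become one
  let φ : G'.Face c ⊕ M.Face c → G.Face c := Sum.elim (Quot.lift _ l1) (Quot.lift _ l2)
  have hφ : Function.Surjective φ := by
    intro q
    induction q using Quot.ind with
    | mk y =>
      obtain (⟨v, y⟩ | l) := y
      · obtain ⟨w | w, rfl⟩ := f.surjective v
        · exact ⟨Sum.inl (Quot.mk _ (Sum.inl (w, y))), rfl⟩
        · exact ⟨Sum.inr (Quot.mk _ (Sum.inl (w, y))), rfl⟩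
      · exact ⟨Sum.inl (Quot.mk _ (Sum.inr l)), rfl⟩
  have hφ' : ¬ Function.Injective φ := fun hinj => by
    have : φ (Sum.inl (Quot.mk _ x)) = φ (Sum.inr (Quot.mk _ (Sum.inr 0))) := rfl
    simpa using hinj this
  have : Finite (G'.Face c) := inferInstanceAs (Finite (Quot _))
  have : Finite (M.Face c) := inferInstanceAs (Finite (Quot _))
  have : Finite (G.Face c) := inferInstanceAs (Finite (Quot _))
  have := Fintype.ofFinite (G'.Face c)
  have := Fintype.ofFinite (M.Face c)
  have := Fintype.ofFinite (G.Face c)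
  have := Fintype.card_lt_of_surjective_not_injective φ hφ hφ'
  rw [Fintype.card_sum] at this
  simp only [Nat.card_eq_fintype_card]
  omega

/-- The weights of the bubbles add up, and three faces at least are merged; a melon has degree
zero. -/
theorem degree_le_of_melonRemoval {G G' : TwoPointGraph} (h : MelonRemoval G G') :
    G'.degree ≤ G.degree := by
  obtain ⟨M, x, hM, hd, hI⟩ := h
  have h1 := Finset.sum_le_sum fun (c : Color) (_ : c ∈ Finset.univ) =>
    card_face_add_one_le_of_isInsertion hM hI c
  obtain ⟨f, hk', hk, -⟩ := hI
  have h2 : ∑ v, bubbleWeight (G.kind v) =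
      ∑ v, bubbleWeight (G'.kind v) + ∑ v, bubbleWeight (M.kind v) := by
    rw [← f.sum_comp, Fintype.sum_sum_type]
    simp only [hk, hk']
  have h3 : ((∑ c : Color, (Nat.card (G.Face c) + 1) : ℕ) : ℚ) ≤
      ((∑ c : Color, (Nat.card (G'.Face c) + Nat.card (M.Face c)) : ℕ) : ℚ) := by exact_mod_cast h1
  push_cast at h3
  simp only [Finset.sum_add_distrib, Finset.sum_const, Finset.card_univ, Fintype.card_fin,
    nsmul_eq_mul] at h3
  rw [degree_eq] at hd ⊢
  rw [degree_eq, h2]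
  push_cast at h3
  linarith

theorem degree_le_of_isMelonFreeCore {G G₀ : TwoPointGraph} (h : IsMelonFreeCore G G₀) :
    G₀.degree ≤ G.degree := by
  obtain ⟨h, -⟩ := h
  induction h with
  | refl => exact le_rfl
  | tail _ h ih => exact (degree_le_of_melonRemoval h).trans ih

end Graph

namespace Graph

variable {n : ℕ} {G : Graph Bubble n}

/-! ### Sequences of dipoles -/

theorem zmod_two_cases (x : ZMod 2) : x = 0 ∨ x = 1 := by revert x; decide

/-- Exchange of the two sides of a dipole. -/
theorem IsDipole.swap_sides {i : Color} {A : Set G.V} {p : Pos → G.H} (h : IsDipole G i A p) :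
    IsDipole G i A (fun x => p (x + (1, 0))) := by
  cases h with
  | @typeI j u v a b hu hv huv hij h₁ h₂ =>
    have h₂' : G.E (G.at' u (a + colorVec i + colorVec i)) =
        G.at' v (b + colorVec i + colorVec i) := by
      rw [Pos.add_add_self, Pos.add_add_self, h₁]
    have := IsDipole.typeI hu hv huv hij h₂ h₂'
    convert this using 2 with x
    have key : ∀ a : Pos, a + colorVec j + (x.1 + 1) • colorVec i =
        a + colorVec i + colorVec j + x.1 • colorVec i := by
      intro a
      rw [add_smul, one_smul]; abel
    simp only [Prod.snd_add, Prod.fst_add, add_zero, key]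
  | @typeII v t hv =>
    have := IsDipole.typeII (t + (1, 0)) hv
    convert this using 3 with x
    abel

/-- Exchange of the two rails of a dipole. -/
theorem IsDipole.swap_rails {i : Color} {A : Set G.V} {p : Pos → G.H} (h : IsDipole G i A p) :
    IsDipole G i A (fun x => p (x + (0, 1))) := by
  cases h with
  | @typeI j u v a b hu hv huv hij h₁ h₂ =>
    have := IsDipole.typeI (G := G) (i := i) (j := j) (a := b) (b := a) hv hu huv.symm hij
      (by rw [← h₁, G.E_invol]) (by rw [← h₂, G.E_invol])
    rw [Set.pair_comm]
    convert this using 2 with x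
    simp only [Prod.snd_add, Prod.fst_add, add_zero]
    rcases zmod_two_cases x.2 with hx | hx
    · rw [hx, if_neg (by decide), if_pos rfl]
    · rw [hx, if_pos (by decide), if_neg (by decide)]
  | @typeII v t hv =>
    have := IsDipole.typeII (t + (0, 1)) hv
    convert this using 3 with x
    abel

/-- Two sequences of dipoles joined by two edges form a longer one. -/
theorem IsDipoleSeq.append {l l' : List Color} {A B : Set G.V} {p q : Pos → G.H}
    (h : IsDipoleSeq G l A p) (h' : IsDipoleSeq G l' B q) (hAB : Disjoint A B)
    (hE : ∀ r : ZMod 2, G.E (p (1, r)) = q (0, r)) :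
    IsDipoleSeq G (l ++ l') (A ∪ B) (fun x => if x.1 = 0 then p x else q x) := by
  induction h with
  | single h => exact .cons h h' hAB hE
  | @cons i A₁ B₁ l p₁ q₁ h hs hd hE' ih =>
    rw [Set.disjoint_union_left] at hAB
    have := IsDipoleSeq.cons h (ih hAB.2 fun r => by simpa using hE r)
      (Set.disjoint_union_right.2 ⟨hd, hAB.1⟩) (fun r => by simpa using hE' r)
    rw [List.cons_append, Set.union_assoc]
    convert this using 2 with x
    by_cases hx : x.1 = 0 <;> simp [hx]

theorem IsDipoleSeq.swap_sides {l : List Color} {A : Set G.V} {p : Pos → G.H}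
    (h : IsDipoleSeq G l A p) : IsDipoleSeq G l.reverse A (fun x => p (x + (1, 0))) := by
  induction h with
  | single h => exact .single h.swap_sides
  | @cons i A B l p q h hs hd hE ih =>
    have := ih.append (.single h.swap_sides) hd.symm (fun r => by
      have h1 : ((1, r) : Pos) + (1, 0) = (0, r) := by revert r; decide
      have h2 : ((0, r) : Pos) + (1, 0) = (1, r) := by revert r; decide
      simp only [h1, h2, ← hE, G.E_invol])
    rw [List.reverse_cons, Set.union_comm]
    convert this using 2 with x
    rcases zmod_two_cases x.1 with hx | hx
    · simp [hx]
    · have : (1 : ZMod 2) + 1 = 0 := by decide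
      simp [hx, this]

theorem IsDipoleSeq.swap_rails {l : List Color} {A : Set G.V} {p : Pos → G.H}
    (h : IsDipoleSeq G l A p) : IsDipoleSeq G l A (fun x => p (x + (0, 1))) := by
  induction h with
  | single h => exact .single h.swap_rails
  | @cons i A B l p q h hs hd hE ih =>
    have := IsDipoleSeq.cons h.swap_rails ih hd (fun r => by
      simp only [Prod.mk_add_mk, add_zero, hE])
    convert this using 2 with x
    simp

theorem IsDipoleSeq.exists_first {l : List Color} {A : Set G.V} {p : Pos → G.H}
    (h : IsDipoleSeq G l A p) :
    ∃ i A' p', IsDipole G i A' p' ∧ ∀ r : ZMod 2, p' (0, r) = p (0, r) := by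
  cases h with
  | single h => exact ⟨_, _, _, h, fun _ => rfl⟩
  | cons h hs hd hE => exact ⟨_, _, _, h, fun _ => by simp⟩

theorem IsDipoleSeq.ne_nil {l : List Color} {A : Set G.V} {p : Pos → G.H}
    (h : IsDipoleSeq G l A p) : l ≠ [] := by
  cases h <;> simp

theorem IsDipole.exists_eq_at' {i : Color} {A : Set G.V} {p : Pos → G.H} (h : IsDipole G i A p)
    (x : Pos) : ∃ v ∈ A, ∃ y, p x = G.at' v y := by
  cases h with
  | typeI hu hv' huv hij h₁ h₂ =>
    by_cases hx : x.2 = 0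
    · exact ⟨_, Or.inl rfl, _, if_pos hx⟩
    · exact ⟨_, Or.inr rfl, _, if_neg hx⟩
  | typeII t hv' => exact ⟨_, rfl, _, rfl⟩

theorem IsDipole.injective {i : Color} {A : Set G.V} {p : Pos → G.H} (h : IsDipole G i A p) :
    Function.Injective p := by
  cases h with
  | @typeI j u v a b hu hv' huv hij h₁ h₂ =>
    have key : ∀ (a : Pos) (x y : ZMod 2), a + colorVec j + x • colorVec i =
        a + colorVec j + y • colorVec i → x = y := by
      intro a x y h
      rw [add_right_inj] at h
      clear * - h
      revert i x y; decide
    intro x y h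
    dsimp only at h
    split_ifs at h with hx hy hy
    · exact Prod.ext (key _ _ _ (at'_inj.1 h).2) (hx.trans hy.symm)
    · exact absurd (at'_inj.1 h).1 huv
    · exact absurd (at'_inj.1 h).1.symm huv
    · refine Prod.ext (key _ _ _ (at'_inj.1 h).2) ?_
      rw [(zmod_two_cases x.2).resolve_left hx, (zmod_two_cases y.2).resolve_left hy]
  | typeII t hv' =>
    intro x y h
    simpa using (at'_inj.1 h).2

theorem IsDipoleSeq.exists_eq_at' {l : List Color} {A : Set G.V} {p : Pos → G.H}
    (h : IsDipoleSeq G l A p) (x : Pos) : ∃ v ∈ A, ∃ y, p x = G.at' v y := by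
  induction h with
  | single h => exact h.exists_eq_at' x
  | cons h hs hd hE ih =>
    by_cases hx : x.1 = 0
    · obtain ⟨v, hv, y, hy⟩ := h.exists_eq_at' x
      exact ⟨v, Or.inl hv, y, (if_pos hx).trans hy⟩
    · obtain ⟨v, hv, y, hy⟩ := ih
      exact ⟨v, Or.inr hv, y, (if_neg hx).trans hy⟩

theorem IsDipoleSeq.injective {l : List Color} {A : Set G.V} {p : Pos → G.H}
    (h : IsDipoleSeq G l A p) : Function.Injective p := by
  induction h with
  | single h => exact h.injective
  | @cons i A B l p q h hs hd hE ih =>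
    have key : ∀ x y, p x ≠ q y := fun x y e => by
      obtain ⟨v, hv, a, ha⟩ := h.exists_eq_at' x
      obtain ⟨w, hw, b, hb⟩ := hs.exists_eq_at' y
      rw [ha, hb, at'_inj] at e
      exact Set.disjoint_left.1 hd hv (e.1 ▸ hw)
    intro x y e
    dsimp only at e
    split_ifs at e
    · exact h.injective e
    · exact absurd e (key _ _)
    · exact absurd e.symm (key _ _)
    · exact ih e

/-- The two half-edges of a same side belong to the same bubble only when it is a pillow. -/
theorem IsDipole.kind_ne_tetra {i : Color} {A : Set G.V} {p : Pos → G.H} (h : IsDipole G i A p)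
    {σ : ZMod 2} {v : G.V} {x y : Pos} (hx : p (σ, 0) = G.at' v x) (hy : p (σ, 1) = G.at' v y) :
    G.kind v ≠ .tetra := by
  cases h with
  | typeI hu hv' huv hij h₁ h₂ =>
    simp only [if_true, one_ne_zero, if_false, at'_inj] at hx hy
    exact absurd (hx.1.trans hy.1.symm) huv
  | typeII t hv' =>
    rw [← (at'_inj.1 hx).1, hv']
    simp

/-- The two half-edges of a side of a sequence belong to the same bubble only when it is a pillow.
-/
theorem IsDipoleSeq.kind_ne_tetra {l : List Color} {A : Set G.V} {p : Pos → G.H}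
    (h : IsDipoleSeq G l A p) {σ : ZMod 2} {v : G.V} {x y : Pos} (hx : p (σ, 0) = G.at' v x)
    (hy : p (σ, 1) = G.at' v y) : G.kind v ≠ .tetra := by
  induction h with
  | single h => exact h.kind_ne_tetra hx hy
  | cons h hs hd hE ih =>
    rcases zmod_two_cases σ with rfl | rfl
    · exact h.kind_ne_tetra (σ := 0) (by simpa using hx) (by simpa using hy)
    · exact ih (by simpa using hx) (by simpa using hy)

/-! ### Faces along a sequence of dipoles -/

/-- The face of color `c` through a half-edge. -/
def face (G : Graph Bubble n) (c : Color) (h : G.H) : G.Face c := Quot.mk _ h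

theorem face_E (c : Color) (h : G.H) : G.face c (G.E h) = G.face c h :=
  (Quot.sound (r := fun x y : G.H => G.E x = y ∨ G.colorStep c x = y) (Or.inl rfl)).symm

theorem face_shift (c : Color) (v : G.V) (x : Pos) :
    G.face c (G.at' v (x + (G.kind v).shift c)) = G.face c (G.at' v x) :=
  (Quot.sound (r := fun x y : G.H => G.E x = y ∨ G.colorStep c x = y) (a := G.at' v x)
    (Or.inr rfl)).symm

/-- In a dipole of color `i`, the faces of color `i` go from one side to the other. -/
theorem IsDipole.face_side {i : Color} {A : Set G.V} {p : Pos → G.H} (h : IsDipole G i A p)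
    (r : ZMod 2) : G.face i (p (0, r)) = G.face i (p (1, r)) := by
  cases h with
  | @typeI j u v a b hu hv huv hij h₁ h₂ =>
    have hu' := face_shift (G := G) i u (a + colorVec j)
    have hv' := face_shift (G := G) i v (b + colorVec j)
    rw [hu] at hu'
    rw [hv] at hv'
    dsimp only
    split_ifs
    · simpa [Bubble.shift] using hu'.symm
    · simpa [Bubble.shift] using hv'.symm
  | @typeII v t hv =>
    have := face_shift (G := G) i v ((0, r) + t)
    rw [hv] at this
    simp only [Bubble.shift, if_true] at this
    rw [← this]
    congr 2
    rw [add_right_comm]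
    congr 1
    clear * -; revert r; decide

/-- In a dipole of color `i`, the faces of the other colors join the two rails of each side. -/
theorem IsDipole.face_rail {i c : Color} {A : Set G.V} {p : Pos → G.H} (h : IsDipole G i A p)
    (hc : c ≠ i) (σ : ZMod 2) : G.face c (p (σ, 0)) = G.face c (p (σ, 1)) := by
  cases h with
  | @typeI j u v a b hu hv huv hij h₁ h₂ =>
    -- both half-edges are reached by an edge of color `c` from a same edge of the internal face
    have key : ∀ (σ : ZMod 2), ∃ τ : ZMod 2, ∀ a : Pos,
        a + colorVec j + σ • colorVec i = a + τ • colorVec i + colorVec c := by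
      intro σ
      have : ∀ i j c : Color, j ≠ i → c ≠ i → ∀ σ : ZMod 2, ∃ τ : ZMod 2,
          colorVec j + σ • colorVec i = τ • colorVec i + colorVec c := by decide
      obtain ⟨τ, hτ⟩ := this i j c hij hc σ
      exact ⟨τ, fun a => by rw [add_assoc, hτ, add_assoc]⟩
    obtain ⟨τ, hτ⟩ := key σ
    have hu' := face_shift (G := G) c u (a + τ • colorVec i)
    have hv' := face_shift (G := G) c v (b + τ • colorVec i)
    rw [hu] at hu'
    rw [hv] at hv'
    simp only [Bubble.shift] at hu' hv'
    simp only [if_true, one_ne_zero, if_false, hτ, hu', hv']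
    have hE : G.E (G.at' u (a + τ • colorVec i)) = G.at' v (b + τ • colorVec i) := by
      rcases zmod_two_cases τ with rfl | rfl
      · simpa using h₁
      · simpa using h₂
    rw [← hE, face_E]
  | @typeII v t hv =>
    have := face_shift (G := G) c v ((σ, 0) + t)
    rw [hv] at this
    simp only [Bubble.shift, if_neg hc] at this
    rw [← this]
    congr 2
    rw [add_right_comm]
    congr 1
    clear * -; revert σ; decide

/-- In a sequence of dipoles of color `c`, the faces of color `c` go from one end to the other. -/
theorem IsDipoleSeq.face_side {c : Color} {l : List Color} {A : Set G.V} {p : Pos → G.H}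
    (h : IsDipoleSeq G l A p) (hl : ∀ e ∈ l, e = c) (r : ZMod 2) :
    G.face c (p (0, r)) = G.face c (p (1, r)) := by
  induction h with
  | @single i A p h =>
    obtain rfl : i = c := hl i (by simp)
    exact h.face_side r
  | @cons i A B l p q h hs hd hE ih =>
    obtain rfl : i = c := hl i (by simp)
    simp only [if_true, one_ne_zero, if_false]
    rw [h.face_side, ← ih fun e he => hl e (by simp [he]), ← hE, face_E]

/-- In a sequence with a dipole of color other than `c`, the faces of color `c` come back to the
side from which they enter. -/
theorem IsDipoleSeq.face_rail {c : Color} {l : List Color} {A : Set G.V} {p : Pos → G.H}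
    (h : IsDipoleSeq G l A p) (hl : ∃ e ∈ l, e ≠ c) (σ : ZMod 2) :
    G.face c (p (σ, 0)) = G.face c (p (σ, 1)) := by
  induction h generalizing σ with
  | @single i A p h =>
    obtain ⟨e, he, hec⟩ := hl
    obtain rfl : e = i := by simpa using he
    exact h.face_rail hec.symm σ
  | @cons i A B l p q h hs hd hE ih =>
    have hq : ∀ r, G.face c (p (1, r)) = G.face c (q (0, r)) := fun r => by rw [← hE, face_E]
    by_cases hl' : ∃ e ∈ l, e ≠ c
    · have ih := fun σ => ih hl' σ
      rcases zmod_two_cases σ with rfl | rfl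
      · simp only [if_true]
        by_cases hi : i = c
        · subst hi
          rw [h.face_side, h.face_side, hq, hq, ih 0]
        · exact h.face_rail (Ne.symm hi) 0
      · simpa using ih 1
    · push Not at hl'
      have hi : i ≠ c := by
        rintro rfl
        obtain ⟨e, he, hec⟩ := hl
        rcases List.mem_cons.1 he with h | h
        · exact hec h
        · exact hec (hl' e h)
      rcases zmod_two_cases σ with rfl | rfl
      · simpa using h.face_rail (Ne.symm hi) 0
      · simp only [one_ne_zero, if_false]
        rw [← hs.face_side hl', ← hs.face_side hl', ← hq, ← hq, h.face_rail (Ne.symm hi) 1]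

open scoped Classical in
/-- The contribution to the degree of a chain-vertex: two for a chain of a given color, three for
a broken chain. -/
noncomputable def chainWeight (l : List Color) : ℚ := if ∃ i, ∀ c ∈ l, c = i then 2 else 3

open scoped Classical in
/-- The total weight of the bubbles of `A`. -/
noncomputable def setWeight (A : Set G.V) : ℚ := ∑ v, if v ∈ A then bubbleWeight (G.kind v) else 0

theorem setWeight_union {A B : Set G.V} (h : Disjoint A B) :
    setWeight (A ∪ B) = setWeight A + setWeight B := by
  rw [setWeight, setWeight, setWeight, ← Finset.sum_add_distrib]
  refine Finset.sum_congr rfl fun v _ => ?_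
  by_cases hA : v ∈ A
  · have hB : v ∉ B := Set.disjoint_left.1 h hA
    simp [hA, hB]
  · by_cases hB : v ∈ B <;> simp [hA, hB]

theorem setWeight_singleton (v : G.V) : setWeight {v} = bubbleWeight (G.kind v) := by
  rw [setWeight, Finset.sum_eq_single v] <;> simp +contextual

/-- Representatives `I c` of the internal faces of color `c`: they and the external half-edges meet
all the faces visiting `A`. -/
def CoversFaces (A : Set G.V) (p : Pos → G.H) (I : Color → Finset G.H) : Prop :=
  ∀ v ∈ A, ∀ x c, (∃ y, G.face c (G.at' v x) = G.face c (p y)) ∨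
    ∃ y ∈ I c, G.face c (G.at' v x) = G.face c y

/-- A dipole of two tetrahedra has weight `3` and one internal face; a pillow has weight `2` and
none. -/
theorem IsDipole.exists_internal_faces {i : Color} {A : Set G.V} {p : Pos → G.H}
    (h : IsDipole G i A p) :
    ∃ I : Color → Finset G.H, CoversFaces A p I ∧ ∑ c, ((I c).card : ℚ) + 2 ≤ setWeight A := by
  cases h with
  | @typeI j u v a b hu hv huv hij h₁ h₂ =>
    refine ⟨fun c => if c = i then {G.at' u a} else ∅, ?_, ?_⟩
    · -- each half-edge of the two tetrahedra is on the internal face or is external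
      have hpos : ∀ x : Pos, (∃ τ : ZMod 2, x = τ • colorVec i) ∨
          ∃ τ : ZMod 2, x = colorVec j + τ • colorVec i := by
        have : ∀ i j : Color, j ≠ i → ∀ x : Pos, (∃ τ : ZMod 2, x = τ • colorVec i) ∨
          ∃ τ : ZMod 2, x = colorVec j + τ • colorVec i := by decide
        exact this i j hij
      have hpos' : ∀ c, c ≠ i → ∀ τ : ZMod 2, ∃ τ' : ZMod 2,
          τ • colorVec i + colorVec c = colorVec j + τ' • colorVec i := by
        have : ∀ i j : Color, j ≠ i → ∀ c, c ≠ i → ∀ τ : ZMod 2, ∃ τ' : ZMod 2,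
          τ • colorVec i + colorVec c = colorVec j + τ' • colorVec i := by decide
        exact this i j hij
      have hself : ∀ w y, G.kind w = .tetra → ∀ τ : ZMod 2,
          G.face i (G.at' w (y + τ • colorVec i)) = G.face i (G.at' w y) := by
        intro w y hw τ
        rcases zmod_two_cases τ with rfl | rfl
        · simp
        · have := face_shift (G := G) i w y
          rw [hw] at this
          simpa [Bubble.shift] using this
      have key : ∀ w y (s : ZMod 2), G.kind w = .tetra →
          (∀ τ : ZMod 2, (fun x : Pos => if x.2 = 0 then G.at' u (a + colorVec j + x.1 • colorVec i)
            else G.at' v (b + colorVec j + x.1 • colorVec i)) (τ, s) =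
              G.at' w (y + colorVec j + τ • colorVec i)) →
          G.face i (G.at' w y) = G.face i (G.at' u a) → ∀ x c,
          (∃ z, G.face c (G.at' w (y + x)) = G.face c
            ((fun x : Pos => if x.2 = 0 then G.at' u (a + colorVec j + x.1 • colorVec i)
            else G.at' v (b + colorVec j + x.1 • colorVec i)) z)) ∨
          ∃ z ∈ (if c = i then {G.at' u a} else ∅ : Finset G.H),
            G.face c (G.at' w (y + x)) = G.face c z := by
        intro w y s hw hp hf x c
        rcases hpos x with ⟨τ, rfl⟩ | ⟨τ, rfl⟩
        · by_cases hc : c = i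
          · subst hc
            refine Or.inr ⟨G.at' u a, by simp, ?_⟩
            rw [hself w y hw, hf]
          · obtain ⟨τ', hτ'⟩ := hpos' c hc τ
            refine Or.inl ⟨(τ', s), ?_⟩
            rw [hp, add_assoc, ← hτ', ← add_assoc]
            have := face_shift (G := G) c w (y + τ • colorVec i)
            rw [hw] at this
            exact this.symm
        · exact Or.inl ⟨(τ, s), by rw [hp, add_assoc]⟩
      rintro w (rfl | rfl) x c
      · have := key w a 0 hu (fun τ => by simp) rfl (x - a) c
        rwa [add_sub_cancel] at this
      · have := key w b 1 hv (fun τ => by simp) (by rw [← h₁, face_E]) (x - b) c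
        rwa [add_sub_cancel] at this
    · have h1 : setWeight ({u, v} : Set G.V) = 3 := by
        rw [Set.insert_eq, setWeight_union (by simpa using huv), setWeight_singleton,
          setWeight_singleton, hu, hv]
        norm_num [bubbleWeight]
      have h2 : ∀ c, (((if c = i then {G.at' u a} else ∅ : Finset G.H).card : ℕ) : ℚ) =
          if c = i then 1 else 0 := by
        intro c; split_ifs <;> simp
      simp only [h1, h2, Finset.sum_ite_eq', Finset.mem_univ, if_true]
      norm_num
  | @typeII v t hv =>
    refine ⟨fun _ => ∅, ?_, ?_⟩
    · rintro w rfl x c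
      exact Or.inl ⟨x - t, by simp only [sub_add_cancel]⟩
    · rw [setWeight_singleton, hv]
      simp [bubbleWeight]

open scoped Classical in
/-- In a sequence of dipoles, the internal faces and the chain-vertex account for the weight of the
bubbles. -/
theorem IsDipoleSeq.exists_internal_faces {l : List Color} {A : Set G.V} {p : Pos → G.H}
    (h : IsDipoleSeq G l A p) :
    ∃ I : Color → Finset G.H, CoversFaces A p I ∧
      ∑ c, ((I c).card : ℚ) + chainWeight l ≤ setWeight A := by
  induction h with
  | @single i A p h =>
    obtain ⟨I, hI, hw⟩ := h.exists_internal_faces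
    refine ⟨I, hI, ?_⟩
    rwa [chainWeight, if_pos ⟨i, by simp⟩]
  | @cons i A B l p q h hs hd hE ih =>
    obtain ⟨I, hI, hw⟩ := h.exists_internal_faces
    obtain ⟨J, hJ, hw'⟩ := ih
    have hq : ∀ c r, G.face c (p (1, r)) = G.face c (q (0, r)) := fun c r => by rw [← hE, face_E]
    -- the new internal faces go through the side `0` of the second part
    let new (c : Color) : Finset G.H := if c ≠ i ∧ ∃ e ∈ l, e ≠ c then {q (0, 0)} else ∅
    refine ⟨fun c => I c ∪ J c ∪ new c, ?_, ?_⟩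
    · have h0 : ∀ c r, (∃ y, G.face c (q (0, r)) =
          G.face c ((fun x => if x.1 = 0 then p x else q x) y)) ∨
          ∃ y ∈ new c, G.face c (q (0, r)) = G.face c y := by
        intro c r
        by_cases hi : c = i
        · subst hi
          refine Or.inl ⟨(0, r), ?_⟩
          simp only [if_true]
          rw [h.face_side, hq]
        · by_cases hl : ∃ e ∈ l, e ≠ c
          · refine Or.inr ⟨q (0, 0), ?_, ?_⟩
            · simp only [new]
              rw [if_pos ⟨hi, hl⟩]
              exact Finset.mem_singleton_self _
            · rcases zmod_two_cases r with rfl | rfl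
              · rfl
              · exact (hs.face_rail hl 0).symm
          · push Not at hl
            refine Or.inl ⟨(1, r), ?_⟩
            simp only [one_ne_zero, if_false]
            exact hs.face_side hl r
      rintro v (hv | hv) x c
      · rcases hI v hv x c with ⟨⟨σ, r⟩, hy⟩ | ⟨y, hy, hy'⟩
        · rcases zmod_two_cases σ with rfl | rfl
          · exact Or.inl ⟨(0, r), by simpa using hy⟩
          · rw [hy, hq]
            rcases h0 c r with h1 | ⟨y, hy, hy'⟩
            · exact Or.inl h1
            · exact Or.inr ⟨y, Finset.mem_union_right _ hy, hy'⟩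
        · exact Or.inr ⟨y, Finset.mem_union_left _ (Finset.mem_union_left _ hy), hy'⟩
      · rcases hJ v hv x c with ⟨⟨σ, r⟩, hy⟩ | ⟨y, hy, hy'⟩
        · rcases zmod_two_cases σ with rfl | rfl
          · rw [hy]
            rcases h0 c r with h1 | ⟨y, hy, hy'⟩
            · exact Or.inl h1
            · exact Or.inr ⟨y, Finset.mem_union_right _ hy, hy'⟩
          · exact Or.inl ⟨(1, r), by simpa using hy⟩
        · exact Or.inr ⟨y, Finset.mem_union_left _ (Finset.mem_union_right _ hy), hy'⟩
    · rw [setWeight_union hd]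
      have h1 : ∀ c, ((I c ∪ J c ∪ new c).card : ℚ) ≤ (I c).card + (J c).card + (new c).card := by
        intro c
        have := (Finset.card_union_le (I c ∪ J c) (new c)).trans
          (Nat.add_le_add_right (Finset.card_union_le (I c) (J c)) _)
        exact_mod_cast this
      -- two colors give a new internal face, and only one of them does when a sequence of a given
      -- color becomes broken
      have h2 : ∑ c, ((new c).card : ℚ) + chainWeight (i :: l) ≤ 2 + chainWeight l := by
        have hn : ∀ c, ((new c).card : ℚ) = if c ≠ i ∧ ∃ e ∈ l, e ≠ c then 1 else 0 := by
          intro c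
          simp only [new]
          split_ifs <;> simp
        simp only [hn, Finset.sum_boole]
        by_cases hm : ∃ k, ∀ c ∈ l, c = k
        · obtain ⟨k, hk⟩ := hm
          have hne := hs.ne_nil
          obtain ⟨e, he⟩ := List.exists_mem_of_ne_nil l hne
          have hek := hk e he
          subst hek
          have hiff : ∀ c, (c ≠ i ∧ ∃ e' ∈ l, e' ≠ c) ↔ (c ≠ i ∧ c ≠ e) := by
            intro c
            refine and_congr_right fun _ => ⟨?_, fun h => ⟨e, he, h.symm⟩⟩
            rintro ⟨e', he', h⟩ rfl
            exact h (hk e' he')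
          simp only [hiff]
          rw [chainWeight, chainWeight, if_pos (show ∃ k, ∀ c ∈ l, c = k from ⟨e, hk⟩)]
          by_cases hie : i = e
          · subst hie
            rw [if_pos ⟨i, by simpa using hk⟩]
            have : (Finset.univ.filter fun c : Color => c ≠ i ∧ c ≠ i).card ≤ 2 := by
              clear * -; revert i; decide
            have : ((Finset.univ.filter fun c : Color => c ≠ i ∧ c ≠ i).card : ℚ) ≤ 2 := by
              exact_mod_cast this
            linarith
          · have : (Finset.univ.filter fun c : Color => c ≠ i ∧ c ≠ e).card ≤ 1 := by
              clear * - hie; revert i e; decide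
            have : ((Finset.univ.filter fun c : Color => c ≠ i ∧ c ≠ e).card : ℚ) ≤ 1 := by
              exact_mod_cast this
            split_ifs <;> linarith
        · have : (Finset.univ.filter fun c : Color => c ≠ i ∧ ∃ e ∈ l, e ≠ c).card ≤ 2 := by
            refine (Finset.card_le_card (t := Finset.univ.erase i) fun c hc => ?_).trans ?_
            · exact Finset.mem_erase.2 ⟨(Finset.mem_filter.1 hc).2.1, Finset.mem_univ _⟩
            · rw [Finset.card_erase_of_mem (Finset.mem_univ _)]; simp
          have : ((Finset.univ.filter fun c : Color => c ≠ i ∧ ∃ e ∈ l, e ≠ c).card : ℚ) ≤ 2 := by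
            exact_mod_cast this
          rw [chainWeight, chainWeight, if_neg hm]
          split_ifs <;> linarith
      have h3 := Finset.sum_le_sum fun (c : Color) (_ : c ∈ Finset.univ) => h1 c
      rw [Finset.sum_add_distrib, Finset.sum_add_distrib] at h3
      linarith

end Graph

/-! ### Cutting the chain-vertices -/

/-- The bubble whose edges give the faces of a bubble or of a chain-vertex. A chain-vertex of
color `i` is seen as a pillow of color `i`; in a broken chain, all the faces come back to the side
from which they enter. -/
def SchemeNode.shift : SchemeNode → Color → Pos
  | .bubble b, c => b.shift c
  | .chain i, c => (Bubble.pillow i).shift c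
  | .broken, _ => (0, 1)

/-- The smallest weight of the bubbles represented by a node, minus the number of internal faces. -/
def SchemeNode.weight : SchemeNode → ℚ
  | .bubble b => bubbleWeight b
  | .chain _ => 2
  | .broken => 3

/-- The bubble of a node, and `none` for chain-vertices. -/
def SchemeNode.toBubble? : SchemeNode → Option Bubble
  | .bubble b => some b
  | .chain _ => none
  | .broken => none

theorem SchemeNode.shift_ne_zero (k : SchemeNode) (c : Color) : k.shift c ≠ 0 := by
  rcases k with b | i | _
  · exact nodeShift_ne_zero (some b) c
  · exact nodeShift_ne_zero (some (.pillow i)) c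
  · exact nodeShift_ne_zero none c

namespace Graph

/-- A scheme in which the chain-vertices are cut between their two sides, which become pairs. -/
abbrev cutNet (S : SchemeGraph) : Net S.H := S.toNet SchemeNode.toBubble? twoPoint_legs

section Cut

variable (S : SchemeGraph)

open scoped Classical in
/-- The edges of color `c` of a scheme where the nodes of `D` are cut. -/
noncomputable def cutStep (D : Finset S.V) (c : Color) : S.H → S.H :=
  Sum.elim (fun q => Sum.inl (q.1, q.2 + if q.1 ∈ D then (0, 1) else (S.kind q.1).shift c))
    fun l => Sum.inr l.rev

/-- The faces of color `c` of a scheme where the nodes of `D` are cut. -/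
def cutFace (D : Finset S.V) (c : Color) (x y : S.H) : Prop := S.E x = y ∨ S.cutStep D c x = y

/-- The connected components of a scheme where the nodes of `D` are cut. -/
def cutConn (D : Finset S.V) (x y : S.H) : Prop :=
  S.E x = y ∨ (∃ c, S.cutStep D c x = y) ∨ ∃ s ∉ D, ∃ a b, x = S.at' s a ∧ y = S.at' s b

variable {S}

theorem cutStep_of_mem {D : Finset S.V} {s : S.V} (hs : s ∈ D) (c : Color) (x : Pos) :
    S.cutStep D c (S.at' s x) = S.at' s (x + (0, 1)) := by
  simp [cutStep, at', hs]

theorem cutStep_of_notMem {D : Finset S.V} {s : S.V} (hs : s ∉ D) (c : Color) (x : Pos) :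
    S.cutStep D c (S.at' s x) = S.at' s (x + (S.kind s).shift c) := by
  simp [cutStep, at', hs]

theorem cutStep_cutStep (D : Finset S.V) (c : Color) (x : S.H) :
    S.cutStep D c (S.cutStep D c x) = x := by
  obtain (⟨s, x⟩ | l) := x
  · simp [cutStep, Pos.add_add_self]
  · simp [cutStep]

theorem cutStep_ne (D : Finset S.V) (c : Color) (x : S.H) : S.cutStep D c x ≠ x := by
  obtain (⟨s, x⟩ | l) := x
  · have h1 := SchemeNode.shift_ne_zero (S.kind s) c
    have h2 : ((0, 1) : Pos) ≠ 0 := by decide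
    simp only [cutStep, Sum.elim_inl, ne_eq, Sum.inl.injEq, Prod.mk.injEq, true_and, add_eq_left]
    split_ifs
    · exact h2
    · exact h1
  · intro h
    simp only [cutStep, Sum.elim_inr, Sum.inr.injEq] at h
    exact (twoPoint_legs l l).1 h.symm rfl

/-- Cutting `s` only changes the edges of `s`. -/
theorem eq_at'_or_cutStep_insert [DecidableEq S.V] (D : Finset S.V) (s : S.V) (x : S.H) :
    (∃ z, x = S.at' s z) ∨ ∀ c, S.cutStep (insert s D) c x = S.cutStep D c x := by
  obtain (⟨t, x⟩ | l) := x
  · by_cases h : t = s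
    · subst h
      exact Or.inl ⟨x, rfl⟩
    · exact Or.inr fun c => by simp [cutStep, h]
  · exact Or.inr fun c => rfl

/-- The half-edges of a node are related by the edges of its two sides together with a link
between the sides. -/
theorem eq_of_sides {α : Type*} {f : Pos → α} (h : ∀ x, f (x + (0, 1)) = f x)
    (h' : f (0, 0) = f (1, 0)) (x y : Pos) : f x = f y := by
  have key : ∀ x, f x = f (0, 0) := by
    rintro ⟨σ, r⟩
    have h1 : ∀ σ r, f (σ, r) = f (σ, 0) := by
      intro σ r
      rcases zmod_two_cases r with rfl | rfl
      · rfl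
      · simpa using h (σ, 0)
    rw [h1]
    rcases zmod_two_cases σ with rfl | rfl
    · rfl
    · exact h'.symm
  rw [key, key y]

/-- Linking the two sides of `s` again undoes the cut at `s`. -/
theorem quot_mk_of_cutConn [DecidableEq S.V] {D : Finset S.V} {s : S.V} {r : S.H → S.H → Prop}
    (h : ∀ x y, S.cutConn (insert s D) x y → Quot.mk r x = Quot.mk r y)
    (h' : Quot.mk r (S.at' s (0, 0)) = Quot.mk r (S.at' s (1, 0))) {x y : S.H}
    (hxy : S.cutConn D x y) : Quot.mk r x = Quot.mk r y := by
  have hs : ∀ x y, Quot.mk r (S.at' s x) = Quot.mk r (S.at' s y) :=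
    eq_of_sides (f := fun x => Quot.mk r (S.at' s x)) (fun x => (h _ _ (Or.inr (Or.inl ⟨0,
      cutStep_of_mem (Finset.mem_insert_self s D) 0 x⟩))).symm) h'
  rcases hxy with rfl | ⟨c, rfl⟩ | ⟨t, ht, a, b, rfl, rfl⟩
  · exact h _ _ (Or.inl rfl)
  · rcases eq_at'_or_cutStep_insert D s x with ⟨z, rfl⟩ | hx
    · obtain ⟨w, hw⟩ : ∃ w, S.cutStep D c (S.at' s z) = S.at' s w := ⟨_, rfl⟩
      rw [hw]; exact hs _ _
    · exact h _ _ (Or.inr (Or.inl ⟨c, hx c⟩))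
  · by_cases hts : t = s
    · subst hts; exact hs _ _
    · exact h _ _ (Or.inr (Or.inr ⟨t, by simp [hts, ht], a, b, rfl, rfl⟩))

/-- A cut creates at most one component. -/
theorem card_cutConn_insert_le [DecidableEq S.V] (D : Finset S.V) (s : S.V) :
    Nat.card (Quot (S.cutConn (insert s D))) ≤ Nat.card (Quot (S.cutConn D)) + 1 := by
  refine (card_quot_le_add_one _ (S.at' s (0, 0)) (S.at' s (1, 0))).trans
    (Nat.add_le_add_right (card_quot_le_of_imp fun x y h => ?_) 1)
  exact quot_mk_of_cutConn (fun x y h => Quot.sound (Or.inl h)) (Quot.sound (Or.inr ⟨rfl, rfl⟩)) h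

theorem card_cutConn_insert_le_of_eq [DecidableEq S.V] {D : Finset S.V} {s : S.V}
    (h : Quot.mk (S.cutConn (insert s D)) (S.at' s (0, 0)) = Quot.mk _ (S.at' s (1, 0))) :
    Nat.card (Quot (S.cutConn (insert s D))) ≤ Nat.card (Quot (S.cutConn D)) :=
  card_quot_le_of_imp fun _ _ h' => quot_mk_of_cutConn (fun _ _ h => Quot.sound h) h h'

theorem cutConn_of_cutFace {D : Finset S.V} {c : Color} {x y : S.H} (h : S.cutFace D c x y) :
    S.cutConn D x y := by
  rcases h with h | h
  · exact Or.inl h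
  · exact Or.inr (Or.inl ⟨c, h⟩)

theorem quot_mk_cutConn_of_cutFace {D : Finset S.V} {c : Color} {x y : S.H}
    (h : Quot.mk (S.cutFace D c) x = Quot.mk _ y) :
    Quot.mk (S.cutConn D) x = Quot.mk (S.cutConn D) y :=
  congrArg (Quot.lift (Quot.mk (S.cutConn D)) fun _ _ h => Quot.sound (cutConn_of_cutFace h)) h

section Chain

variable {D : Finset S.V} {s : S.V} {i : Color}

theorem cutFace_side (hs : s ∉ D) (hk : S.kind s = .chain i) (r : ZMod 2) :
    Quot.mk (S.cutFace D i) (S.at' s (0, r)) = Quot.mk _ (S.at' s (1, r)) := by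
  refine Quot.sound (Or.inr ?_)
  rw [cutStep_of_notMem hs, hk]
  simp only [SchemeNode.shift, Bubble.shift, if_true]
  congr 1
  clear * -; revert r; decide

variable [DecidableEq S.V]

theorem cutFace_rail (c : Color) (x : Pos) :
    Quot.mk (S.cutFace (insert s D) c) (S.at' s (x + (0, 1))) = Quot.mk _ (S.at' s x) :=
  (Quot.sound (r := S.cutFace (insert s D) c) (Or.inr (cutStep_of_mem (Finset.mem_insert_self s D)
    c x))).symm

theorem card_cutFace_le_add_one (hs : s ∉ D) (hk : S.kind s = .chain i) :
    Nat.card (Quot (S.cutFace D i)) ≤ Nat.card (Quot (S.cutFace (insert s D) i)) + 1 := by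
  refine (card_quot_le_add_one _ (S.at' s (0, 0)) (S.at' s (0, 1))).trans
    (Nat.add_le_add_right (card_quot_le_of_imp fun x y h => ?_) 1)
  set r : S.H → S.H → Prop :=
    fun x y => S.cutFace D i x y ∨ (x = S.at' s (0, 0) ∧ y = S.at' s (0, 1)) with hr
  have hside : ∀ t, Quot.mk r (S.at' s (0, t)) = Quot.mk r (S.at' s (1, t)) := fun t =>
    congrArg (Quot.lift (Quot.mk r) fun _ _ h => Quot.sound (Or.inl h)) (cutFace_side hs hk t)
  have h0 : Quot.mk r (S.at' s (0, 0)) = Quot.mk r (S.at' s (0, 1)) :=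
    Quot.sound (Or.inr ⟨rfl, rfl⟩)
  have hall : ∀ x, Quot.mk r (S.at' s x) = Quot.mk r (S.at' s (0, 0)) := by
    rintro ⟨σ, t⟩
    rcases zmod_two_cases σ with rfl | rfl <;> rcases zmod_two_cases t with rfl | rfl
    · rfl
    · exact h0.symm
    · exact (hside 0).symm
    · exact (hside 1).symm.trans h0.symm
  rcases h with rfl | rfl
  · exact Quot.sound (Or.inl (Or.inl rfl))
  · rcases eq_at'_or_cutStep_insert D s x with ⟨z, rfl⟩ | hx
    · obtain ⟨w, hw⟩ : ∃ w, S.cutStep (insert s D) i (S.at' s z) = S.at' s w := ⟨_, rfl⟩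
      rw [hw, hall, hall w]
    · exact Quot.sound (Or.inl (Or.inr (hx i).symm))

/-- If cutting a chain-vertex separates its two sides, then it splits a face in two. -/
theorem card_cutFace_add_one_le (hs : s ∉ D) (hk : S.kind s = .chain i)
    (h : Quot.mk (S.cutConn (insert s D)) (S.at' s (0, 0)) ≠ Quot.mk _ (S.at' s (1, 0))) :
    Nat.card (Quot (S.cutFace D i)) + 1 ≤ Nat.card (Quot (S.cutFace (insert s D) i)) := by
  have := S.finite
  have h1 := card_quot_add_one_le (S.cutFace (insert s D) i) (S.at' s (0, 0)) (S.at' s (1, 0))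
    fun e => h (quot_mk_cutConn_of_cutFace e)
  refine (Nat.add_le_add_right (card_quot_le_of_imp fun x y hxy => ?_) 1).trans h1
  -- the path leaving `s` at the first side has to come back on the same side
  have hpath : Quot.mk (S.cutFace D i) (S.at' s (0, 0)) =
      Quot.mk (S.cutFace D i) (S.at' s (0, 1)) := by
    obtain ⟨b, ⟨z, rfl⟩, hne, hb⟩ := exists_path_end S.E_invol S.E_ne
      (cutStep_cutStep (insert s D) i) (cutStep_ne (insert s D) i) (Set.range (S.at' s))
      (by rintro _ ⟨z, rfl⟩; exact ⟨_, rfl⟩) (a := S.at' s (0, 0)) ⟨_, rfl⟩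
    have hb1 : Quot.mk (S.cutFace (insert s D) i) (S.at' s (0, 0)) = Quot.mk _ (S.at' s z) :=
      congrArg (Quot.lift (Quot.mk (S.cutFace (insert s D) i)) fun _ _ h => by
        rcases h with h | ⟨-, h⟩
        · exact Quot.sound (Or.inl h)
        · exact Quot.sound (Or.inr h)) hb
    have hb2 : Quot.mk (S.cutFace D i) (S.at' s (0, 0)) = Quot.mk _ (S.at' s z) :=
      congrArg (Quot.lift (Quot.mk (S.cutFace D i)) fun x _ h => by
        rcases h with h | ⟨hx, h⟩
        · exact Quot.sound (Or.inl h)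
        · rcases eq_at'_or_cutStep_insert D s x with ⟨z, rfl⟩ | hx'
          · exact absurd ⟨z, rfl⟩ hx
          · exact Quot.sound (Or.inr ((hx' i).symm.trans h))) hb
    obtain ⟨σ, t⟩ := z
    rcases zmod_two_cases σ with rfl | rfl
    · rcases zmod_two_cases t with rfl | rfl
      · exact absurd rfl hne
      · exact hb2
    · refine absurd (quot_mk_cutConn_of_cutFace (hb1.trans ?_)) h
      rcases zmod_two_cases t with rfl | rfl
      · rfl
      · simpa using cutFace_rail (S := S) (s := s) (D := D) i (1, 0)
  have hall : ∀ x, Quot.mk (S.cutFace D i) (S.at' s x) =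
      Quot.mk (S.cutFace D i) (S.at' s (0, 0)) := by
    rintro ⟨σ, t⟩
    rcases zmod_two_cases σ with rfl | rfl <;> rcases zmod_two_cases t with rfl | rfl
    · rfl
    · exact hpath.symm
    · exact (cutFace_side hs hk 0).symm
    · exact (cutFace_side hs hk 1).symm.trans hpath.symm
  rcases hxy with (rfl | rfl) | ⟨rfl, rfl⟩
  · exact Quot.sound (Or.inl rfl)
  · rcases eq_at'_or_cutStep_insert D s x with ⟨z, rfl⟩ | hx
    · obtain ⟨w, hw⟩ : ∃ w, S.cutStep (insert s D) i (S.at' s z) = S.at' s w := ⟨_, rfl⟩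
      rw [hw, hall, hall w]
    · exact Quot.sound (Or.inr (hx i).symm)
  · exact (hall _).symm

end Chain

variable (S) in
/-- The number of faces of a scheme where the nodes of `D` are cut. -/
noncomputable def numCutFaces (D : Finset S.V) : ℚ := ∑ c, (Nat.card (Quot (S.cutFace D c)) : ℚ)

/-- Cutting does not change the faces that come back to the side from which they enter. -/
theorem cutFace_insert_eq [DecidableEq S.V] {D : Finset S.V} {s : S.V} (hs : s ∉ D) {c : Color}
    (hk : (S.kind s).shift c = (0, 1)) : S.cutFace (insert s D) c = S.cutFace D c := by
  funext x y
  rw [cutFace, cutFace]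
  rcases eq_at'_or_cutStep_insert D s x with ⟨z, rfl⟩ | hx
  · rw [cutStep_of_mem (Finset.mem_insert_self s D), cutStep_of_notMem hs, hk]
  · rw [hx]

/-- The effect of one more cut. A cut that does not separate the graph loses at most one face; a
cut that separates it gains one face for a chain of a given color, and a cut broken chain changes
no face. -/
theorem card_cutConn_sub_numCutFaces_insert_le [DecidableEq S.V] {D : Finset S.V} {s : S.V}
    (hs : s ∉ D) (hk : (∃ i, S.kind s = .chain i) ∨ S.kind s = .broken) :
    2 * (Nat.card (Quot (S.cutConn (insert s D))) : ℚ) - S.numCutFaces (insert s D) + 1 ≤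
      2 * (Nat.card (Quot (S.cutConn D)) : ℚ) - S.numCutFaces D + (S.kind s).weight := by
  have hC : (Nat.card (Quot (S.cutConn (insert s D))) : ℚ) ≤ Nat.card (Quot (S.cutConn D)) + 1 := by
    exact_mod_cast card_cutConn_insert_le D s
  rcases hk with ⟨i, hi⟩ | hb
  · have hne : ∀ c ∈ Finset.univ.erase i, (Nat.card (Quot (S.cutFace (insert s D) c)) : ℚ) =
        Nat.card (Quot (S.cutFace D c)) := by
      intro c hc
      rw [cutFace_insert_eq hs]
      rw [hi]
      simp [SchemeNode.shift, Bubble.shift, (Finset.mem_erase.1 hc).1]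
    rw [numCutFaces, numCutFaces, ← Finset.add_sum_erase _ _ (Finset.mem_univ i),
      ← Finset.add_sum_erase _ _ (Finset.mem_univ i), Finset.sum_congr rfl hne, hi]
    simp only [SchemeNode.weight]
    by_cases h : Quot.mk (S.cutConn (insert s D)) (S.at' s (0, 0)) = Quot.mk _ (S.at' s (1, 0))
    · have h1 : (Nat.card (Quot (S.cutConn (insert s D))) : ℚ) ≤ Nat.card (Quot (S.cutConn D)) := by
        exact_mod_cast card_cutConn_insert_le_of_eq h
      have h2 : (Nat.card (Quot (S.cutFace D i)) : ℚ) ≤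
          Nat.card (Quot (S.cutFace (insert s D) i)) + 1 := by
        exact_mod_cast card_cutFace_le_add_one hs hi
      linarith
    · have h2 : (Nat.card (Quot (S.cutFace D i)) : ℚ) + 1 ≤
          Nat.card (Quot (S.cutFace (insert s D) i)) := by
        exact_mod_cast card_cutFace_add_one_le hs hi h
      linarith
  · have : S.numCutFaces (insert s D) = S.numCutFaces D := by
      refine Finset.sum_congr rfl fun c _ => ?_
      rw [cutFace_insert_eq hs]
      rw [hb]; rfl
    rw [this, hb]
    simp only [SchemeNode.weight]
    linarith

/-- The effect of cutting the nodes of `D` one after the other. -/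
theorem card_cutConn_le (D : Finset S.V)
    (hD : ∀ s ∈ D, (∃ i, S.kind s = .chain i) ∨ S.kind s = .broken) :
    (Nat.card (Quot (S.cutConn D)) : ℚ) ≤ Nat.card (Quot (S.cutConn ∅)) + D.card ∧
    2 * (Nat.card (Quot (S.cutConn D)) : ℚ) - S.numCutFaces D + D.card ≤
      2 * (Nat.card (Quot (S.cutConn ∅)) : ℚ) - S.numCutFaces ∅ +
        ∑ s ∈ D, (S.kind s).weight := by
  classical
  induction D using Finset.induction_on with
  | empty => simp
  | insert s D hs ih =>
    obtain ⟨h1, h2⟩ := ih fun t ht => hD t (Finset.mem_insert_of_mem ht)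
    have h3 := card_cutConn_sub_numCutFaces_insert_le hs (hD s (Finset.mem_insert_self s D))
    have h4 : (Nat.card (Quot (S.cutConn (insert s D))) : ℚ) ≤
        Nat.card (Quot (S.cutConn D)) + 1 := by
      exact_mod_cast card_cutConn_insert_le D s
    rw [Finset.card_insert_of_notMem hs, Finset.sum_insert hs]
    push_cast
    constructor <;> linarith

theorem card_cutConn_empty : Nat.card (Quot (S.cutConn ∅)) = 1 := by
  rw [Nat.card_eq_one_iff_unique]
  obtain ⟨h₀⟩ := S.nonempty
  refine ⟨⟨fun a b => ?_⟩, ⟨Quot.mk _ h₀⟩⟩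
  induction a using Quot.ind with | mk x =>
  induction b using Quot.ind with | mk y =>
  refine forall_of_connected S (Φ := fun y => Quot.mk (S.cutConn ∅) x = Quot.mk _ y)
    (fun h hh => hh.trans (Quot.sound (Or.inl rfl)))
    (fun v a b hh => hh.trans (Quot.sound (Or.inr (Or.inr ⟨v, by simp, a, b, rfl, rfl⟩))))
    (fun l l' hh => hh.trans ?_) rfl y
  by_cases hl : l' = l
  · rw [hl]
  · exact Quot.sound (Or.inr (Or.inl ⟨0, by rw [(twoPoint_legs l l').2 hl]; rfl⟩))

open scoped Classical in
variable (S) in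
/-- The chain-vertices of a scheme. -/
noncomputable def chainNodes : Finset S.V :=
  Finset.univ.filter fun s => (∃ i, S.kind s = .chain i) ∨ S.kind s = .broken

theorem mem_chainNodes {s : S.V} :
    s ∈ S.chainNodes ↔ (∃ i, S.kind s = .chain i) ∨ S.kind s = .broken := by
  simp [chainNodes]

theorem notMem_chainNodes {s : S.V} : s ∉ S.chainNodes ↔ ∃ b, S.kind s = .bubble b := by
  rw [mem_chainNodes]
  rcases S.kind s with b | i | _ <;> simp

theorem mem_chainNodes_iff_toBubble? {s : S.V} :
    s ∈ S.chainNodes ↔ (S.kind s).toBubble? = none := by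
  rw [mem_chainNodes]
  rcases S.kind s with b | i | _ <;> simp [SchemeNode.toBubble?]

theorem card_chainNodes : S.chainNodes.card = numChainVertices S := by
  classical
  rw [numChainVertices, Nat.card_eq_fintype_card, Fintype.card_subtype]
  congr 1

theorem cutNet_X_eq (c : Color) : S.cutNet.X c = S.cutStep S.chainNodes c := by
  funext x
  obtain (⟨s, x⟩ | l) := x
  · change (Sum.inl (s, x + nodeShift (S.kind s).toBubble? c) : S.H) = _
    by_cases hs : s ∈ S.chainNodes
    · have := cutStep_of_mem (S := S) hs c x
      rw [mem_chainNodes_iff_toBubble?.1 hs]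
      exact this.symm
    · have := cutStep_of_notMem (S := S) hs c x
      obtain ⟨b, hb⟩ := notMem_chainNodes.1 hs
      rw [hb] at this ⊢
      exact this.symm
  · rfl

theorem comps_cutNet_le : S.cutNet.comps ≤ Nat.card (Quot (S.cutConn S.chainNodes)) := by
  refine card_quot_le_of_imp fun x y h => ?_
  rcases h with h | ⟨c, h⟩ | ⟨s, hs, a, b, rfl, rfl⟩
  · exact Quot.sound (Or.inl h)
  · exact Quot.sound (Or.inr ⟨c, by rw [cutNet_X_eq]; exact h⟩)
  · obtain ⟨b', hb⟩ := notMem_chainNodes.1 hs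
    exact toNet_conn_node (b := b') (by rw [hb]; rfl) a b

/-- The effect on the degree of cutting all the chain-vertices. -/
theorem deg_cutNet_le :
    S.cutNet.deg ≤ 2 + ∑ s, (S.kind s).weight - S.numCutFaces ∅ - S.chainNodes.card +
      S.cutNet.comps ∧ S.cutNet.comps ≤ S.chainNodes.card + 1 := by
  classical
  obtain ⟨h1, h2⟩ := card_cutConn_le S.chainNodes fun s hs => mem_chainNodes.1 hs
  rw [card_cutConn_empty] at h1 h2
  have h3 : (S.cutNet.comps : ℚ) ≤ Nat.card (Quot (S.cutConn S.chainNodes)) := by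
    exact_mod_cast comps_cutNet_le
  have h4 : ∑ c, (Nat.card (Quot (S.cutNet.face c)) : ℚ) = S.numCutFaces S.chainNodes := by
    refine Finset.sum_congr rfl fun c _ => ?_
    have : S.cutNet.face c = S.cutFace S.chainNodes c := by
      funext x y
      rw [cutFace, ← cutNet_X_eq]
      rfl
    rw [this]
  have h5 : ∑ s, 4 * halfEdgeWeight (S.kind s).toBubble? + ∑ s ∈ S.chainNodes, (S.kind s).weight =
      ∑ s, (S.kind s).weight := by
    rw [← Finset.sum_filter_add_sum_filter_not Finset.univ (fun s => s ∈ S.chainNodes)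
      fun s => (S.kind s).weight, add_comm, Finset.filter_univ_mem]
    congr 1
    rw [Finset.sum_filter]
    refine Finset.sum_congr rfl fun s _ => ?_
    by_cases hs : s ∈ S.chainNodes
    · rw [if_neg (by simpa using hs), mem_chainNodes_iff_toBubble?.1 hs]
      simp [halfEdgeWeight]
    · obtain ⟨b, hb⟩ := notMem_chainNodes.1 hs
      rw [if_pos hs, hb]
      rcases b with _ | i <;>
        norm_num [SchemeNode.toBubble?, halfEdgeWeight, SchemeNode.weight, bubbleWeight]
  constructor
  · rw [Net.deg, h4, sum_halfEdgeWeight]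
    push_cast at h2
    linarith
  · have : (S.cutNet.comps : ℚ) ≤ (S.chainNodes.card + 1 : ℕ) := by
      push_cast at h1 ⊢
      linarith
    exact_mod_cast this

end Cut

/-! ### Schemes -/

/-- The data of a replacement of the maximal chains of `G` by chain-vertices. -/
structure Replacement (G : TwoPointGraph) (S : SchemeGraph) (A : S.V → Set G.V)
    (P : S.V → Pos → G.H) : Prop where
  exists_unique : ∀ v, ∃! s, v ∈ A s
  bubble : ∀ s b, S.kind s = .bubble b →
    ∃ (v : G.V) (t : Pos), G.kind v = b ∧ A s = {v} ∧ (∀ x, P s x = G.at' v (x + t)) ∧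
      ∀ l A' p', G.IsChain l A' p' → v ∉ A'
  chain : ∀ s i, S.kind s = .chain i → ∃ l, G.IsMaximalChain l (A s) (P s) ∧ ∀ c ∈ l, c = i
  broken : ∀ s, S.kind s = .broken →
    ∃ l, G.IsMaximalChain l (A s) (P s) ∧ ¬ ∃ i, ∀ c ∈ l, c = i
  E_eq : ∀ h : S.H, G.E (Sum.elim (fun q => P q.1 q.2) Sum.inr h) =
    Sum.elim (fun q => P q.1 q.2) Sum.inr (S.E h)

theorem exists_replacement {G : TwoPointGraph} {S : SchemeGraph} (h : IsChainReplacement G S) :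
    ∃ A P, Replacement G S A P := by
  obtain ⟨A, P, h1, h2, h3, h4, h5⟩ := h
  exact ⟨A, P, h1, h2, h3, h4, h5⟩

namespace Replacement

variable {G : TwoPointGraph} {S : SchemeGraph} {A : S.V → Set G.V} {P : S.V → Pos → G.H}

theorem exists_maximal (R : Replacement G S A P) {s : S.V} (hs : s ∈ S.chainNodes) :
    ∃ l, G.IsMaximalChain l (A s) (P s) := by
  rcases mem_chainNodes.1 hs with ⟨i, hi⟩ | hb
  · obtain ⟨l, hl, -⟩ := R.chain s i hi
    exact ⟨l, hl⟩
  · obtain ⟨l, hl, -⟩ := R.broken s hb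
    exact ⟨l, hl⟩

/-- The weight of a node accounts for the bubbles that it stands for, up to internal faces. -/
theorem exists_internal_faces (R : Replacement G S A P) (s : S.V) :
    ∃ I : Color → Finset G.H, CoversFaces (A s) (P s) I ∧
      ∑ c, ((I c).card : ℚ) + (S.kind s).weight ≤ setWeight (A s) := by
  rcases hk : S.kind s with b | i | _
  · obtain ⟨v, t, hv, hA, hP, -⟩ := R.bubble s b hk
    refine ⟨fun _ => ∅, ?_, ?_⟩
    · rw [hA]
      rintro w rfl x c
      exact Or.inl ⟨x - t, by simp only [hP, sub_add_cancel]⟩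
    · rw [hA, setWeight_singleton, hv]
      simp [SchemeNode.weight]
  · obtain ⟨l, hl, hi⟩ := R.chain s i hk
    obtain ⟨I, hI, hw⟩ := hl.1.1.exists_internal_faces
    refine ⟨I, hI, ?_⟩
    rwa [chainWeight, if_pos ⟨i, hi⟩] at hw
  · obtain ⟨l, hl, hi⟩ := R.broken s hk
    obtain ⟨I, hI, hw⟩ := hl.1.1.exists_internal_faces
    refine ⟨I, hI, ?_⟩
    rwa [chainWeight, if_neg hi] at hw

/-- The faces of `G` go through a node of the scheme as prescribed by its type. -/
theorem face_shift (R : Replacement G S A P) (c : Color) (s : S.V) (x : Pos) :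
    G.face c (P s (x + (S.kind s).shift c)) = G.face c (P s x) := by
  have hrail : ∀ l, G.IsDipoleSeq l (A s) (P s) → (∃ e ∈ l, e ≠ c) →
      G.face c (P s (x + (0, 1))) = G.face c (P s x) := by
    intro l hl he
    obtain ⟨σ, r⟩ := x
    have h2 : (1 : ZMod 2) + 1 = 0 := by decide
    rcases zmod_two_cases r with rfl | rfl
    · simpa using (hl.face_rail he σ).symm
    · simpa [h2] using hl.face_rail he σ
  rcases hk : S.kind s with b | i | _
  · obtain ⟨v, t, hv, hA, hP, -⟩ := R.bubble s b hk
    rw [hP, hP, add_right_comm, SchemeNode.shift, ← hv, Graph.face_shift]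
  · obtain ⟨l, hl, hi⟩ := R.chain s i hk
    by_cases hc : c = i
    · subst hc
      simp only [SchemeNode.shift, Bubble.shift, if_true]
      obtain ⟨σ, r⟩ := x
      have h2 : (1 : ZMod 2) + 1 = 0 := by decide
      rcases zmod_two_cases σ with rfl | rfl
      · simpa using (hl.1.1.face_side hi r).symm
      · simpa [h2] using hl.1.1.face_side hi r
    · simp only [SchemeNode.shift, Bubble.shift, if_neg hc]
      obtain ⟨e, he⟩ := List.exists_mem_of_ne_nil l hl.1.1.ne_nil
      exact hrail l hl.1.1 ⟨e, he, by rw [hi e he]; exact Ne.symm hc⟩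
  · obtain ⟨l, hl, hi⟩ := R.broken s hk
    push Not at hi
    obtain ⟨e, he, hec⟩ := hi c
    exact hrail l hl.1.1 ⟨e, he, hec⟩

/-- The degree of `G`, read on the scheme. -/
theorem le_degree (R : Replacement G S A P) :
    3 + ∑ s, (S.kind s).weight - S.numCutFaces ∅ ≤ G.degree := by
  classical
  choose I hI hw using R.exists_internal_faces
  have hF : ∀ c, Nat.card (G.Face c) ≤
      Nat.card (Quot (S.cutFace ∅ c)) + ∑ s, (I s c).card := by
    intro c
    have hl : ∀ x y, S.cutFace ∅ c x y → G.face c (Sum.elim (fun q => P q.1 q.2) Sum.inr x) =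
        G.face c (Sum.elim (fun q => P q.1 q.2) Sum.inr y) := by
      rintro x y (rfl | rfl)
      · rw [← R.E_eq, face_E]
      · obtain (⟨s, x⟩ | l) := x
        · have h1 : S.cutStep ∅ c (S.at' s x) = S.at' s (x + (S.kind s).shift c) :=
            cutStep_of_notMem (by simp) c x
          have h2 := R.face_shift c s x
          exact h2.symm.trans (congrArg (fun z : S.H => G.face c
            (Sum.elim (fun q : S.V × Pos => P q.1 q.2) Sum.inr z)) h1.symm)
        · exact Quot.sound (Or.inr rfl)
    -- each face of `G` is internal to a node or visible on the scheme
    let φ : Quot (S.cutFace ∅ c) ⊕ (Σ s, I s c) → G.Face c :=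
      Sum.elim (Quot.lift _ hl) fun y => G.face c y.2.1
    have hφ : Function.Surjective φ := by
      intro q
      induction q using Quot.ind with | mk y =>
      obtain (⟨v, x⟩ | l) := y
      · obtain ⟨s, hs, -⟩ := R.exists_unique v
        rcases hI s v hs x c with ⟨z, hz⟩ | ⟨z, hz, hz'⟩
        · exact ⟨Sum.inl (Quot.mk _ (Sum.inl (s, z))), hz.symm⟩
        · exact ⟨Sum.inr ⟨s, z, hz⟩, hz'.symm⟩
      · exact ⟨Sum.inl (Quot.mk _ (Sum.inr l)), rfl⟩
    have : Finite (Quot (S.cutFace ∅ c)) := inferInstance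
    refine (Nat.card_le_card_of_surjective φ hφ).trans (le_of_eq ?_)
    rw [Nat.card_sum, Nat.card_sigma]
    congr 1
    exact Finset.sum_congr rfl fun s _ => by rw [Nat.card_eq_fintype_card, Fintype.card_coe]
  have hW : ∑ v, bubbleWeight (G.kind v) = ∑ s, setWeight (A s) := by
    simp only [setWeight]
    rw [Finset.sum_comm]
    refine Finset.sum_congr rfl fun v _ => ?_
    obtain ⟨s, hs, hu⟩ := R.exists_unique v
    rw [Finset.sum_eq_single s, if_pos hs]
    · intro t _ ht
      exact if_neg fun h => ht (hu t h)
    · simp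
  have h1 : ∑ c, (Nat.card (G.Face c) : ℚ) ≤
      S.numCutFaces ∅ + ∑ s, ∑ c, ((I s c).card : ℚ) := by
    rw [Finset.sum_comm, numCutFaces, ← Finset.sum_add_distrib]
    refine Finset.sum_le_sum fun c _ => ?_
    exact_mod_cast hF c
  have h2 := Finset.sum_le_sum fun (s : S.V) (_ : s ∈ Finset.univ) => hw s
  rw [Finset.sum_add_distrib] at h2
  rw [degree_eq, hW]
  linarith

/-- Cutting the chain-vertices: the degree decreases by one for each chain-vertex, up to the
number of connected components. -/
theorem deg_cutNet_le (R : Replacement G S A P) :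
    S.cutNet.deg ≤ G.degree - 1 - S.chainNodes.card + S.cutNet.comps := by
  have h1 := R.le_degree
  have h2 := (Graph.deg_cutNet_le (S := S)).1
  linarith

end Replacement

end Graph

namespace Graph

/-! ### The melon closing a dipole on one side -/

/-- The graph whose half-edges are embedded by `f` in a set with a fixed-point free involution
preserving the range of `f`. -/
noncomputable def ofEmbedding {K H : Type} {n : ℕ} (V : Type) [Finite V] (kind : V → K)
    (f : (V × Pos) ⊕ Fin n → H) (hf : Function.Injective f) (E : H → H)
    (hE : ∀ h, E (E (f h)) = f h) (hne : ∀ h, E (f h) ≠ f h) (hr : ∀ h, ∃ h', f h' = E (f h))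
    (h₀ : Nonempty ((V × Pos) ⊕ Fin n))
    (hc : ∀ h h' : (V × Pos) ⊕ Fin n, Relation.EqvGen
      (fun x y => E (f x) = f y ∨ Sum.elim (fun p => some p.1) (fun _ => none) x =
          (Sum.elim (fun p => some p.1) (fun _ => none) y : Option V)) h h') : Graph K n where
  V := V
  finite := inferInstance
  kind := kind
  E h := (hr h).choose
  E_invol h := hf (by rw [(hr _).choose_spec, (hr h).choose_spec, hE])
  E_ne h e := hne h (by rw [← (hr h).choose_spec, e])
  nonempty := h₀
  connected h h' := by
    have : (fun x y : (V × Pos) ⊕ Fin n => E (f x) = f y ∨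
        Sum.elim (fun p => some p.1) (fun _ => none) x =
          (Sum.elim (fun p => some p.1) (fun _ => none) y : Option V)) =
        fun x y => (hr x).choose = y ∨ Sum.elim (fun p => some p.1) (fun _ => none) x =
          (Sum.elim (fun p => some p.1) (fun _ => none) y : Option V) := by
      funext x y
      rw [← hf.eq_iff (a := (hr x).choose), (hr x).choose_spec]
    rw [← this]
    exact hc h h'

/-- Half-edges of the nodes of `A`. -/
def InSet {G : TwoPointGraph} (A : Set G.V) : G.H → Prop :=
  Sum.elim (fun q => q.1 ∈ A) fun _ => False

section Cut

variable {G : TwoPointGraph} {A : Set G.V} {v₀ v₁ : G.V} {x₀ x₁ : Pos}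

/-- A set of bubbles attached to the rest of the graph by two edges of color `0`. -/
structure IsTwoPointSet (G : TwoPointGraph) (A : Set G.V) (v₀ v₁ : G.V) (x₀ x₁ : Pos) : Prop where
  mem_iff : ∀ v, v ∈ A ↔ v = v₀ ∨ v = v₁
  ne : G.at' v₀ x₀ ≠ G.at' v₁ x₁
  inner : ∀ h, InSet A h → h ≠ G.at' v₀ x₀ → h ≠ G.at' v₁ x₁ →
    InSet A (G.E h) ∧ G.E h ≠ G.at' v₀ x₀ ∧ G.E h ≠ G.at' v₁ x₁
  link : v₀ = v₁ ∨ ∃ x y, G.E (G.at' v₀ x) = G.at' v₁ y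

namespace IsTwoPointSet

theorem mem₀ (hA : IsTwoPointSet G A v₀ v₁ x₀ x₁) : InSet A (G.at' v₀ x₀) :=
  (hA.mem_iff _).2 (Or.inl rfl)

theorem mem₁ (hA : IsTwoPointSet G A v₀ v₁ x₀ x₁) : InSet A (G.at' v₁ x₁) :=
  (hA.mem_iff _).2 (Or.inr rfl)

/-- As the graph is connected and has legs outside `A`, the two external edges of `A` leave `A`. -/
theorem not_inSet (hA : IsTwoPointSet G A v₀ v₁ x₀ x₁) :
    ¬ InSet A (G.E (G.at' v₀ x₀)) ∧ ¬ InSet A (G.E (G.at' v₁ x₁)) := by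
  have key : G.E (G.at' v₀ x₀) ≠ G.at' v₁ x₁ := by
    intro e
    have e' : G.E (G.at' v₁ x₁) = G.at' v₀ x₀ := by rw [← e, G.E_invol]
    refine forall_of_connected G (Φ := InSet A) (fun h hh => ?_) (fun v x y h => h)
      (fun _ _ h => h) hA.mem₀ (Sum.inr 0)
    by_cases h0 : h = G.at' v₀ x₀
    · rw [h0, e]; exact hA.mem₁
    · by_cases h1 : h = G.at' v₁ x₁
      · rw [h1, e']; exact hA.mem₀
      · exact (hA.inner h hh h0 h1).1
  constructor
  · intro h
    exact (hA.inner _ h (G.E_ne _) key).2.1 (G.E_invol _)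
  · intro h
    refine (hA.inner _ h (fun e => key ?_) (G.E_ne _)).2.2 (G.E_invol _)
    rw [← e, G.E_invol]

variable (A v₀ v₁ x₀ x₁) in
/-- The half-edges of the two-point subgraph, its external legs being sent to the two half-edges
outside `A`. -/
def innerMap : (A × Pos) ⊕ Fin 2 → G.H :=
  Sum.elim (fun q => Sum.inl (q.1.1, q.2))
    fun l => if l = 0 then G.E (G.at' v₀ x₀) else G.E (G.at' v₁ x₁)

theorem innerMap_injective (hA : IsTwoPointSet G A v₀ v₁ x₀ x₁) :
    Function.Injective (innerMap A v₀ v₁ x₀ x₁) := by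
  obtain ⟨h0, h1⟩ := hA.not_inSet
  have hl : ∀ (q : A × Pos) (l : Fin 2),
      innerMap A v₀ v₁ x₀ x₁ (Sum.inl q) ≠ innerMap A v₀ v₁ x₀ x₁ (Sum.inr l) := by
    intro q l e
    have hq : InSet A (innerMap A v₀ v₁ x₀ x₁ (Sum.inl q)) := q.1.2
    rw [e] at hq
    simp only [innerMap, Sum.elim_inr] at hq
    split_ifs at hq
    · exact h0 hq
    · exact h1 hq
  rintro (⟨v, x⟩ | l) (⟨w, y⟩ | l') e
  · simp only [innerMap, Sum.elim_inl, Sum.inl.injEq, Prod.mk.injEq] at e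
    rw [Subtype.ext e.1, e.2]
  · exact absurd e (hl _ _)
  · exact absurd e.symm (hl _ _)
  · have hne : G.E (G.at' v₀ x₀) ≠ G.E (G.at' v₁ x₁) := fun e => hA.ne (by
      rw [← G.E_invol (G.at' v₀ x₀), e, G.E_invol])
    congr 1
    simp only [innerMap, Sum.elim_inr] at e
    split_ifs at e with a b b
    · rw [a, b]
    · exact absurd e hne
    · exact absurd e.symm hne
    · omega

theorem exists_innerMap (hA : IsTwoPointSet G A v₀ v₁ x₀ x₁) (h : (A × Pos) ⊕ Fin 2) :
    ∃ h', innerMap A v₀ v₁ x₀ x₁ h' = G.E (innerMap A v₀ v₁ x₀ x₁ h) := by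
  have hin : ∀ h, InSet A h → ∃ h', innerMap A v₀ v₁ x₀ x₁ h' = h := by
    rintro (⟨v, x⟩ | l) hh
    · exact ⟨Sum.inl (⟨v, hh⟩, x), rfl⟩
    · exact hh.elim
  obtain (⟨v, x⟩ | l) := h
  · by_cases h0 : G.at' v x = G.at' v₀ x₀
    · exact ⟨Sum.inr 0, (congrArg G.E h0).symm⟩
    · by_cases h1 : G.at' v x = G.at' v₁ x₁
      · exact ⟨Sum.inr 1, (congrArg G.E h1).symm⟩
      · exact hin _ (hA.inner (G.at' v x) v.2 h0 h1).1
  · simp only [innerMap, Sum.elim_inr]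
    split_ifs
    · rw [G.E_invol]; exact hin _ hA.mem₀
    · rw [G.E_invol]; exact hin _ hA.mem₁

/-- The two-point subgraph with bubbles `A`. -/
noncomputable def inner' (hA : IsTwoPointSet G A v₀ v₁ x₀ x₁) : TwoPointGraph :=
  have := G.finite
  ofEmbedding A (fun v => G.kind v.1) (innerMap A v₀ v₁ x₀ x₁) hA.innerMap_injective G.E
    (fun _ => G.E_invol _) (fun _ => G.E_ne _) hA.exists_innerMap ⟨Sum.inr 0⟩ (by
      set r : (A × Pos) ⊕ Fin 2 → (A × Pos) ⊕ Fin 2 → Prop := fun x y =>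
        G.E (innerMap A v₀ v₁ x₀ x₁ x) = innerMap A v₀ v₁ x₀ x₁ y ∨
        Sum.elim (fun p => some p.1) (fun _ => none) x =
          (Sum.elim (fun p => some p.1) (fun _ => none) y : Option A) with hr
      have hv : ∀ (v : A) x y, Relation.EqvGen r (Sum.inl (v, x)) (Sum.inl (v, y)) := fun v x y =>
        .rel _ _ (Or.inr rfl)
      have hl : ∀ l l', Relation.EqvGen r (Sum.inr l) (Sum.inr l') := fun l l' =>
        .rel _ _ (Or.inr rfl)
      have key : ∀ h, Relation.EqvGen r h (Sum.inr 0) := by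
        rintro (⟨⟨v, hv'⟩, x⟩ | l)
        · rcases (hA.mem_iff v).1 hv' with rfl | rfl
          · exact (hv _ x x₀).trans _ _ _ (.rel _ _ (Or.inl rfl))
          · exact ((hv _ x x₁).trans _ _ _ (.rel _ (Sum.inr 1) (Or.inl rfl))).trans _ _ _ (hl _ _)
        · exact hl _ _
      exact fun h h' => (key h).trans _ _ _ ((key h').symm _ _))

theorem innerMap_E (hA : IsTwoPointSet G A v₀ v₁ x₀ x₁) (h : (A × Pos) ⊕ Fin 2) :
    innerMap A v₀ v₁ x₀ x₁ (hA.inner'.E h) = G.E (innerMap A v₀ v₁ x₀ x₁ h) :=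
  (hA.exists_innerMap h).choose_spec

variable (A) in
/-- The half-edges outside `A`. -/
def outerMap : ((Aᶜ : Set G.V) × Pos) ⊕ Fin 2 → G.H := Sum.map (fun q => (q.1.1, q.2)) id

theorem outerMap_injective : Function.Injective (outerMap A) := by
  rintro (⟨v, x⟩ | l) (⟨w, y⟩ | l') e <;> simp [outerMap] at e
  · rw [Subtype.ext e.1, e.2]
  · rw [e]

theorem not_inSet_outerMap (h) : ¬ InSet A (outerMap A h) := by
  rcases h with ⟨v, x⟩ | l
  · exact v.2
  · exact id

theorem exists_outerMap {h : G.H} (hh : ¬ InSet A h) : ∃ h', outerMap A h' = h := by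
  rcases h with ⟨v, x⟩ | l
  · exact ⟨Sum.inl (⟨v, hh⟩, x), rfl⟩
  · exact ⟨Sum.inr l, rfl⟩

open scoped Classical in
variable (G v₀ v₁ x₀ x₁) in
/-- The edges of color `0` after replacement of the two-point subgraph with an edge. -/
noncomputable def outerE (h : G.H) : G.H :=
  if G.E h = G.at' v₀ x₀ then G.E (G.at' v₁ x₁) else
    if G.E h = G.at' v₁ x₁ then G.E (G.at' v₀ x₀) else G.E h

theorem outerE_cases (hA : IsTwoPointSet G A v₀ v₁ x₀ x₁) {h : G.H} (hh : ¬ InSet A h) :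
    (h = G.E (G.at' v₀ x₀) ∧ outerE G v₀ v₁ x₀ x₁ h = G.E (G.at' v₁ x₁)) ∨
    (h = G.E (G.at' v₁ x₁) ∧ outerE G v₀ v₁ x₀ x₁ h = G.E (G.at' v₀ x₀)) ∨
    (h ≠ G.E (G.at' v₀ x₀) ∧ h ≠ G.E (G.at' v₁ x₁) ∧ outerE G v₀ v₁ x₀ x₁ h = G.E h ∧
      ¬ InSet A (G.E h)) := by
  have inv : ∀ z, G.E h = z ↔ h = G.E z := fun z =>
    ⟨fun e => by rw [← e, G.E_invol], fun e => by rw [e, G.E_invol]⟩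
  by_cases h0 : G.E h = G.at' v₀ x₀
  · exact Or.inl ⟨(inv _).1 h0, if_pos h0⟩
  · by_cases h1 : G.E h = G.at' v₁ x₁
    · exact Or.inr (Or.inl ⟨(inv _).1 h1, by rw [outerE, if_neg h0, if_pos h1]⟩)
    · refine Or.inr (Or.inr ⟨fun e => h0 ((inv _).2 e), fun e => h1 ((inv _).2 e),
        by rw [outerE, if_neg h0, if_neg h1], fun hin => hh ?_⟩)
      have := (hA.inner _ hin h0 h1).1
      rwa [G.E_invol] at this

theorem not_inSet_outerE (hA : IsTwoPointSet G A v₀ v₁ x₀ x₁) {h : G.H} (hh : ¬ InSet A h) :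
    ¬ InSet A (outerE G v₀ v₁ x₀ x₁ h) := by
  obtain ⟨n0, n1⟩ := hA.not_inSet
  rcases hA.outerE_cases hh with ⟨-, e⟩ | ⟨-, e⟩ | ⟨-, -, e, hn⟩ <;> rw [e] <;> assumption

theorem outerE_outerE (hA : IsTwoPointSet G A v₀ v₁ x₀ x₁) {h : G.H} (hh : ¬ InSet A h) :
    outerE G v₀ v₁ x₀ x₁ (outerE G v₀ v₁ x₀ x₁ h) = h := by
  have hne : G.E (G.at' v₁ x₁) ≠ G.E (G.at' v₀ x₀) := fun e => hA.ne (by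
    rw [← G.E_invol (G.at' v₀ x₀), ← e, G.E_invol])
  rcases hA.outerE_cases hh with ⟨h0, e⟩ | ⟨h1, e⟩ | ⟨-, -, e, hn⟩
  · rcases hA.outerE_cases (hA.not_inSet_outerE hh) with ⟨a, -⟩ | ⟨-, e'⟩ | ⟨-, a, -⟩
    · exact absurd (e.symm.trans a) hne
    · rw [e', h0]
    · exact absurd e a
  · rcases hA.outerE_cases (hA.not_inSet_outerE hh) with ⟨-, e'⟩ | ⟨a, -⟩ | ⟨a, -⟩
    · rw [e', h1]
    · exact absurd (e.symm.trans a).symm hne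
    · exact absurd e a
  · rcases hA.outerE_cases (hA.not_inSet_outerE hh) with ⟨a, -⟩ | ⟨a, -⟩ | ⟨-, -, e', -⟩
    · rw [e] at a
      have : h = G.at' v₀ x₀ := by rw [← G.E_invol h, a, G.E_invol]
      exact absurd (this ▸ hA.mem₀) hh
    · rw [e] at a
      have : h = G.at' v₁ x₁ := by rw [← G.E_invol h, a, G.E_invol]
      exact absurd (this ▸ hA.mem₁) hh
    · rw [e', e, G.E_invol]

theorem outerE_ne (hA : IsTwoPointSet G A v₀ v₁ x₀ x₁) {h : G.H} (hh : ¬ InSet A h) :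
    outerE G v₀ v₁ x₀ x₁ h ≠ h := by
  have hne : G.E (G.at' v₁ x₁) ≠ G.E (G.at' v₀ x₀) := fun e => hA.ne (by
    rw [← G.E_invol (G.at' v₀ x₀), ← e, G.E_invol])
  rcases hA.outerE_cases hh with ⟨h0, e⟩ | ⟨h1, e⟩ | ⟨-, -, e, hn⟩
  · rw [e, h0]; exact hne
  · rw [e, h1]; exact hne.symm
  · rw [e]; exact G.E_ne h

/-- The graph where the two-point subgraph with bubbles `A` is replaced with an edge. -/
noncomputable def outer (hA : IsTwoPointSet G A v₀ v₁ x₀ x₁) : TwoPointGraph :=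
  have := G.finite
  ofEmbedding (Aᶜ : Set G.V) (fun v => G.kind v.1) (outerMap A) outerMap_injective
    (outerE G v₀ v₁ x₀ x₁) (fun h => hA.outerE_outerE (not_inSet_outerMap h))
    (fun h => hA.outerE_ne (not_inSet_outerMap h))
    (fun h => exists_outerMap (hA.not_inSet_outerE (not_inSet_outerMap h))) ⟨Sum.inr 0⟩ (by
      set r : ((Aᶜ : Set G.V) × Pos) ⊕ Fin 2 → ((Aᶜ : Set G.V) × Pos) ⊕ Fin 2 → Prop := fun x y =>
        outerE G v₀ v₁ x₀ x₁ (outerMap A x) = outerMap A y ∨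
        Sum.elim (fun p => some p.1) (fun _ => none) x =
          (Sum.elim (fun p => some p.1) (fun _ => none) y : Option (Aᶜ : Set G.V)) with hr
      obtain ⟨n0, n1⟩ := hA.not_inSet
      obtain ⟨e₀, he₀⟩ := exists_outerMap n0
      obtain ⟨e₁, he₁⟩ := exists_outerMap n1
      have he : Relation.EqvGen r e₁ e₀ := by
        refine .rel _ _ (Or.inl ?_)
        rw [he₀, he₁]
        rcases hA.outerE_cases n1 with ⟨a, -⟩ | ⟨-, e⟩ | ⟨-, a, -⟩
        · refine absurd ?_ hA.ne
          rw [← G.E_invol (G.at' v₀ x₀), ← a, G.E_invol]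
        · exact e
        · exact absurd rfl a
      intro h h'
      -- a path of `G` that enters `A` at one external edge can be followed as if it stayed at
      -- `e₀`
      have key := forall_of_connected G (h := outerMap A h) (Φ := fun z =>
        (InSet A z → Relation.EqvGen r h e₀) ∧
          ∀ y, outerMap A y = z → Relation.EqvGen r h y) ?_ ?_ ?_ ?_ (outerMap A h')
      · exact key.2 h' rfl
      · rintro z ⟨hz, hz'⟩
        by_cases hA' : InSet A z
        · refine ⟨fun _ => hz hA', fun y hy => ?_⟩
          have hy' : z = G.E (outerMap A y) := by rw [hy, G.E_invol]
          by_cases h0 : z = G.at' v₀ x₀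
          · have : y = e₀ := outerMap_injective (by rw [he₀, hy, h0])
            rw [this]; exact hz hA'
          · by_cases h1 : z = G.at' v₁ x₁
            · have : y = e₁ := outerMap_injective (by rw [he₁, hy, h1])
              rw [this]; exact (hz hA').trans _ _ _ (he.symm _ _)
            · exact absurd (hy ▸ (hA.inner z hA' h0 h1).1) (not_inSet_outerMap y)
        · obtain ⟨x, rfl⟩ := exists_outerMap hA'
          have hx := hz' x rfl
          rcases hA.outerE_cases hA' with ⟨h0, e⟩ | ⟨h1, e⟩ | ⟨-, -, e, hn⟩
          · have hxe : x = e₀ := outerMap_injective (by rw [he₀, h0])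
            refine ⟨fun _ => hxe ▸ hx, fun y hy => ?_⟩
            rw [h0, G.E_invol] at hy
            exact absurd (hy ▸ hA.mem₀) (not_inSet_outerMap y)
          · have hxe : x = e₁ := outerMap_injective (by rw [he₁, h1])
            refine ⟨fun _ => hx.trans _ _ _ (hxe ▸ he), fun y hy => ?_⟩
            rw [h1, G.E_invol] at hy
            exact absurd (hy ▸ hA.mem₁) (not_inSet_outerMap y)
          · refine ⟨fun h => absurd h hn, fun y hy => hx.trans _ _ _ (.rel _ _ (Or.inl ?_))⟩
            rw [e, hy]
      · rintro v x y ⟨hz, hz'⟩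
        refine ⟨hz, fun w hw => ?_⟩
        obtain (⟨w, t⟩ | l) := w
        · obtain ⟨rfl, rfl⟩ : w.1 = v ∧ t = y := by
            simpa [outerMap, at'] using hw
          exact (hz' (Sum.inl (w, x)) rfl).trans _ _ _ (.rel _ _ (Or.inr rfl))
        · simp [outerMap, at'] at hw
      · rintro l l' ⟨hz, hz'⟩
        refine ⟨fun h => h.elim, fun w hw => ?_⟩
        have : w = Sum.inr l' := outerMap_injective hw
        rw [this]
        exact (hz' (Sum.inr l) rfl).trans _ _ _ (.rel _ _ (Or.inr rfl))
      · refine ⟨fun h => absurd h (not_inSet_outerMap _), fun y hy => ?_⟩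
        rw [outerMap_injective hy]
        exact .refl _)

theorem outerMap_E (hA : IsTwoPointSet G A v₀ v₁ x₀ x₁) (h : hA.outer.H) :
    outerMap A (hA.outer.E h) = outerE G v₀ v₁ x₀ x₁ (outerMap A h) :=
  (exists_outerMap (hA.not_inSet_outerE (not_inSet_outerMap h))).choose_spec

/-- The graph is recovered by inserting the two-point subgraph on the new edge. -/
theorem exists_isInsertion (hA : IsTwoPointSet G A v₀ v₁ x₀ x₁) :
    ∃ x, IsInsertion G hA.outer hA.inner' x := by
  classical
  obtain ⟨n0, n1⟩ := hA.not_inSet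
  obtain ⟨e₀, he₀⟩ : ∃ e₀ : hA.outer.H, outerMap A e₀ = _ := exists_outerMap n0
  have hinl : ∀ (q q' : A × Pos), hA.inner'.E (Sum.inl q) = Sum.inl q' →
      G.E (innerMap A v₀ v₁ x₀ x₁ (Sum.inl q)) = innerMap A v₀ v₁ x₀ x₁ (Sum.inl q') := by
    intro q q' h
    have := hA.innerMap_E (Sum.inl q)
    exact this.symm.trans (congrArg _ h)
  have hinr : ∀ (q : A × Pos) l, hA.inner'.E (Sum.inl q) = Sum.inr l →
      G.E (innerMap A v₀ v₁ x₀ x₁ (Sum.inl q)) = innerMap A v₀ v₁ x₀ x₁ (Sum.inr l) := by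
    intro q l h
    have := hA.innerMap_E (Sum.inl q)
    exact this.symm.trans (congrArg _ h)
  have h₁ : outerMap A (hA.outer.E e₀) = G.E (G.at' v₁ x₁) := by
    refine (hA.outerMap_E e₀).trans ?_
    rw [he₀]
    rcases hA.outerE_cases n0 with ⟨-, e⟩ | ⟨a, -⟩ | ⟨a, -⟩
    · exact e
    · refine absurd ?_ hA.ne
      rw [← G.E_invol (G.at' v₀ x₀), a, G.E_invol]
    · exact absurd rfl a
  refine ⟨e₀, (Equiv.sumComm _ _).trans (Equiv.Set.sumCompl A), fun v => rfl, fun v => rfl, ?_⟩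
  refine ⟨fun y hy hy' => ?_, hinl, fun q hq => (hinr q 0 hq).trans he₀.symm,
    fun q hq => (hinr q 1 hq).trans h₁.symm⟩
  change G.E (outerMap A y) = outerMap A (hA.outer.E y)
  refine Eq.trans ?_ (hA.outerMap_E y).symm
  rcases hA.outerE_cases (not_inSet_outerMap y) with ⟨a, -⟩ | ⟨a, -⟩ | ⟨-, -, e, -⟩
  · exact absurd (outerMap_injective (a.trans he₀.symm)) hy
  · exact absurd (outerMap_injective (a.trans h₁.symm)) hy'
  · exact e.symm

/-- A two-point subgraph with enough faces is melonic. For each color `c` of `T`, a property of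
half-edges that is constant on the faces of color `c` shows that there are two of them; for the other
colors there is one. -/
theorem exists_melonRemoval (hA : IsTwoPointSet G A v₀ v₁ x₀ x₁) (T : Finset Color)
    (hT : setWeight A ≤ T.card)
    (hφ : ∀ c ∈ T, ∃ φ : G.H → Prop,
      (∀ h, InSet A h → h ≠ G.at' v₀ x₀ → h ≠ G.at' v₁ x₁ → (φ (G.E h) ↔ φ h)) ∧
      (∀ v ∈ A, ∀ x, φ (G.at' v (x + (G.kind v).shift c)) ↔ φ (G.at' v x)) ∧
      (φ (G.at' v₀ x₀) ↔ φ (G.at' v₁ x₁)) ∧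
      (∃ v ∈ A, ∃ x, φ (G.at' v x)) ∧ ∃ v ∈ A, ∃ x, ¬ φ (G.at' v x)) :
    ∃ G', MelonRemoval G G' := by
  classical
  obtain ⟨x, hx⟩ := hA.exists_isInsertion
  refine ⟨hA.outer, hA.inner', x, ⟨(⟨v₀, (hA.mem_iff _).2 (Or.inl rfl)⟩ : A)⟩, ?_, hx⟩
  have hnn : 0 ≤ hA.inner'.degree := by
    rw [degree_eq_deg _ twoPoint_legs]; exact Net.deg_nonneg _
  refine le_antisymm ?_ hnn
  have hcard : ∀ c, (1 : ℚ) + (if c ∈ T then 1 else 0) ≤ Nat.card (hA.inner'.Face c) := by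
    intro c
    have hfin : Finite (hA.inner'.Face c) := inferInstanceAs (Finite (Quot _))
    split_ifs with hc
    · obtain ⟨φ, hE, hs, h01, ⟨v, hv, x, hvx⟩, w, hw, y, hwy⟩ := hφ c hc
      let ψ : hA.inner'.H → Prop := Sum.elim (fun q : A × Pos => φ (G.at' q.1.1 q.2))
        fun _ => φ (G.at' v₀ x₀)
      have hψ : ∀ a b : hA.inner'.H, (hA.inner'.E a = b ∨ hA.inner'.colorStep c a = b) →
          ψ a = ψ b := by
        have hleg : ∀ (q : A × Pos) l, hA.inner'.E (Sum.inl q) = Sum.inr l →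
            (φ (G.at' q.1.1 q.2) ↔ φ (G.at' v₀ x₀)) := by
          intro q l hq
          have h1 : innerMap A v₀ v₁ x₀ x₁ (hA.inner'.E (Sum.inl q)) = G.E (G.at' q.1.1 q.2) :=
            hA.innerMap_E (Sum.inl q)
          have h2 : innerMap A v₀ v₁ x₀ x₁ (Sum.inr l) = G.E (G.at' q.1.1 q.2) :=
            (congrArg _ hq).symm.trans h1
          simp only [innerMap, Sum.elim_inr] at h2
          split_ifs at h2
          · rw [← G.E_invol (G.at' q.1.1 q.2), ← h2, G.E_invol]
          · rw [← G.E_invol (G.at' q.1.1 q.2), ← h2, G.E_invol, h01]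
        rintro (q | l) b (rfl | rfl)
        · rcases hq : hA.inner'.E (Sum.inl q) with q' | l
          · have h1 : innerMap A v₀ v₁ x₀ x₁ (hA.inner'.E (Sum.inl q)) = G.E (G.at' q.1.1 q.2) :=
              hA.innerMap_E (Sum.inl q)
            have h2 : G.at' q'.1.1 q'.2 = G.E (G.at' q.1.1 q.2) :=
              (congrArg (innerMap A v₀ v₁ x₀ x₁) hq).symm.trans h1
            have hin : InSet A (G.at' q'.1.1 q'.2) := q'.1.2
            refine propext ?_
            change φ (G.at' q.1.1 q.2) ↔ φ (G.at' q'.1.1 q'.2)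
            rw [h2, hE (G.at' q.1.1 q.2) q.1.2]
            · intro e; rw [h2, e] at hin; exact hA.not_inSet.1 hin
            · intro e; rw [h2, e] at hin; exact hA.not_inSet.2 hin
          · exact propext (hleg q l hq)
        · exact propext (hs q.1.1 q.1.2 q.2).symm
        · rcases hq : hA.inner'.E (Sum.inr l) with q' | l'
          · exact propext (hleg q' l (by rw [← hq, hA.inner'.E_invol])).symm
          · rfl
        · rfl
      have h2 : 1 < Nat.card (hA.inner'.Face c) := by
        rw [Finite.one_lt_card_iff_nontrivial]
        refine ⟨Quot.mk _ (Sum.inl (⟨v, hv⟩, x)), Quot.mk _ (Sum.inl (⟨w, hw⟩, y)), fun e => ?_⟩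
        have := congrArg (Quot.lift ψ hψ) e
        change φ (G.at' v x) = φ (G.at' w y) at this
        exact hwy (this ▸ hvx)
      have : (2 : ℚ) ≤ Nat.card (hA.inner'.Face c) := by exact_mod_cast h2
      linarith
    · have : Nonempty (hA.inner'.Face c) := ⟨Quot.mk _ (Sum.inr 0)⟩
      have h2 : 1 ≤ Nat.card (hA.inner'.Face c) := Nat.card_pos
      have : (1 : ℚ) ≤ Nat.card (hA.inner'.Face c) := by exact_mod_cast h2
      linarith
  have h1 := Finset.sum_le_sum fun (c : Color) (_ : c ∈ Finset.univ) => hcard c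
  rw [Finset.sum_add_distrib, Finset.sum_boole] at h1
  simp only [Finset.sum_const, Finset.card_univ, Fintype.card_fin, Finset.filter_univ_mem,
    nsmul_eq_mul] at h1
  have h2 : ∑ v, bubbleWeight (hA.inner'.kind v) = setWeight A := by
    rw [setWeight, ← Finset.sum_filter]
    exact Finset.sum_bij (fun (v : A) _ => v.1) (fun v _ => by simpa using v.2)
      (fun _ _ _ _ h => Subtype.ext h)
      (fun w hw => ⟨⟨w, by simpa using hw⟩, Finset.mem_univ _, rfl⟩) (fun _ _ => rfl)
  rw [degree_eq, h2]
  push_cast at h1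
  linarith

end IsTwoPointSet

end Cut

/-- A dipole one of whose sides is closed by an edge of color `0` is a melonic subgraph. -/
theorem IsDipole.exists_melonRemoval {G : TwoPointGraph} {i : Color} {A : Set G.V}
    {p : Pos → G.H} (h : IsDipole G i A p) (hE : G.E (p (0, 0)) = p (0, 1)) :
    ∃ G', MelonRemoval G G' := by
  cases h with
  | @typeI j u v a b hu hv huv hij h₁ h₂ =>
    simp only [if_true, one_ne_zero, if_false, zero_smul, add_zero] at hE
    have hpos : ∀ x : Pos, x = 0 ∨ x = colorVec i ∨ x = colorVec j ∨
        x = colorVec j + colorVec i := by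
      clear * - hij; revert i j; decide
    have hne : ∀ x : Pos, x ≠ colorVec j + colorVec i →
        G.E (G.at' u (a + x)) = G.at' v (b + x) := by
      intro x hx
      rcases hpos x with rfl | rfl | rfl | rfl
      · simpa using h₁
      · exact h₂
      · exact hE
      · exact absurd rfl hx
    have hne' : ∀ x : Pos, x ≠ colorVec j + colorVec i →
        G.E (G.at' v (b + x)) = G.at' u (a + x) := by
      intro x hx
      rw [← hne x hx, G.E_invol]
    have hA : IsTwoPointSet G {u, v} u v (a + (colorVec j + colorVec i))
        (b + (colorVec j + colorVec i)) := by
      refine ⟨fun w => Iff.rfl, fun e => huv (at'_inj.1 e).1, ?_, Or.inr ⟨_, _, h₁⟩⟩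
      rintro (⟨w, x⟩ | l) hw
      swap
      · exact hw.elim
      rcases hw with rfl | rfl
      · rintro h0 -
        obtain ⟨y, rfl⟩ : ∃ y, x = a + y := ⟨x - a, by simp⟩
        have hy : y ≠ colorVec j + colorVec i := fun e => h0 (by rw [e]; rfl)
        have := hne y hy
        rw [at'] at this
        rw [this]
        refine ⟨Or.inr rfl, fun e => huv (at'_inj.1 e).1.symm, fun e => hy ?_⟩
        simpa using (at'_inj.1 e).2
      · rintro - h0
        obtain ⟨y, rfl⟩ : ∃ y, x = b + y := ⟨x - b, by simp⟩
        have hy : y ≠ colorVec j + colorVec i := fun e => h0 (by rw [e]; rfl)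
        have := hne' y hy
        rw [at'] at this
        rw [this]
        refine ⟨Or.inl rfl, fun e => hy ?_, fun e => huv (at'_inj.1 e).1⟩
        simpa using (at'_inj.1 e).2
    refine hA.exists_melonRemoval Finset.univ ?_ ?_
    · rw [Set.insert_eq, setWeight_union (by simpa using huv), setWeight_singleton,
        setWeight_singleton, hu, hv]
      norm_num [bubbleWeight]
    intro c _
    classical
    -- the face of color `c` through the half-edges `a` and `b`: it contains the two external
    -- half-edges or none of them
    refine ⟨Sum.elim (fun q => (q.2 - if q.1 = u then a else b) = 0 ∨
      (q.2 - if q.1 = u then a else b) = colorVec c) fun _ => False, ?_, ?_, ?_,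
      ⟨u, Or.inl rfl, a, by simp [at']⟩, ?_⟩
    · rintro (⟨w, x⟩ | l) hw
      swap
      · exact hw.elim
      rcases hw with rfl | rfl
      · rintro h0 -
        obtain ⟨y, rfl⟩ : ∃ y, x = a + y := ⟨x - a, by simp⟩
        have := hne y fun e => h0 (by rw [e]; rfl)
        rw [at'] at this
        rw [this]
        simp [at', huv.symm]
      · rintro - h0
        obtain ⟨y, rfl⟩ : ∃ y, x = b + y := ⟨x - b, by simp⟩
        have := hne' y fun e => h0 (by rw [e]; rfl)
        rw [at'] at this
        rw [this]
        simp [at', huv.symm]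
    · intro w hw x
      have hk : G.kind w = .tetra := by rcases hw with rfl | rfl <;> assumption
      rw [hk]
      simp only [at', Sum.elim_inl, Bubble.shift, add_sub_right_comm]
      generalize x - (if w = u then a else b) = y
      clear * -; revert y c; decide
    · simp [at', huv.symm]
    · obtain ⟨k, hk, -⟩ := Color.exists_third c c
      refine ⟨u, Or.inl rfl, a + colorVec k, ?_⟩
      simp [at', colorVec_ne_zero, colorVec_inj, hk]
  | @typeII v t hv =>
    have h01 : ∀ r : ZMod 2, G.E (G.at' v ((0, r) + t)) = G.at' v ((0, r + 1) + t) := by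
      intro r
      rcases zmod_two_cases r with rfl | rfl
      · exact hE
      · rw [← G.E_invol (G.at' v ((0, 1 + 1) + t))]
        exact congrArg G.E hE.symm
    have hA : IsTwoPointSet G {v} v v ((1, 0) + t) ((1, 1) + t) := by
      refine ⟨fun w => by simp, fun e => ?_, ?_, Or.inl rfl⟩
      · have := (at'_inj.1 e).2
        simp at this
      · rintro (⟨w, x⟩ | l) hw
        swap
        · exact hw.elim
        obtain rfl : w = v := hw
        intro h0 h1
        obtain ⟨⟨σ, r⟩, rfl⟩ : ∃ y, x = y + t := ⟨x - t, by simp⟩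
        obtain rfl : σ = 0 := by
          rcases zmod_two_cases σ with rfl | rfl
          · rfl
          · rcases zmod_two_cases r with rfl | rfl
            · exact absurd rfl h0
            · exact absurd rfl h1
        have := h01 r
        rw [at'] at this
        rw [this]
        refine ⟨rfl, fun e => ?_, fun e => ?_⟩
        · simpa using (at'_inj.1 e).2
        · simpa using (at'_inj.1 e).2
    refine hA.exists_melonRemoval (Finset.univ.erase i) ?_ ?_
    · rw [setWeight_singleton, hv, Finset.card_erase_of_mem (Finset.mem_univ _)]
      norm_num [bubbleWeight]
    intro c hc
    have hc := (Finset.mem_erase.1 hc).1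
    -- for `c ≠ i`, the face of color `c` on the closed side is internal
    refine ⟨Sum.elim (fun q => (q.2 - t).1 = 0) fun _ => False, ?_, ?_, ?_, ?_, ?_⟩
    · rintro (⟨w, x⟩ | l) hw
      swap
      · exact hw.elim
      obtain rfl : w = v := hw
      intro h0 h1
      obtain ⟨⟨σ, r⟩, rfl⟩ : ∃ y, x = y + t := ⟨x - t, by simp⟩
      obtain rfl : σ = 0 := by
        rcases zmod_two_cases σ with rfl | rfl
        · rfl
        · rcases zmod_two_cases r with rfl | rfl
          · exact absurd rfl h0
          · exact absurd rfl h1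
      have := h01 r
      rw [at'] at this
      rw [this]
      simp [at']
    · rintro w rfl x
      rw [hv]
      simp [at', Bubble.shift, if_neg hc]
    · simp [at']
    · exact ⟨v, rfl, t, by simp [at']⟩
    · exact ⟨v, rfl, (1, 0) + t, by simp [at']⟩

end Graph

namespace Net

variable {H : Type} {N : Net H} {q : Quot N.conn}

theorem comp_isTadpole {h : N.Comp q} (ht : N.IsTadpole h.1) : (N.comp q).IsTadpole h := by
  obtain ⟨hk, d, hd⟩ := ht
  exact ⟨hk, d, Subtype.ext hd⟩

theorem comp_isCenter {c c' : Color} {h : N.Comp q} (hc : N.IsCenter c c' h.1) :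
    (N.comp q).IsCenter c c' h := by
  have hadj : ∀ x y : N.Comp q, (N.comp q).Adj x y → N.Adj x.1 y.1 := by
    rintro x y (rfl | ⟨d, rfl⟩)
    · exact Or.inl rfl
    · exact Or.inr ⟨d, rfl⟩
  exact ⟨hc.ne, hc.kind, hc.kind₁, hc.kind₂, Subtype.ext hc.face₁, Subtype.ext hc.face₂,
    fun h' => hc.not_adj₁ (hadj _ _ h'), fun h' => hc.not_adj₂ (hadj _ _ h'),
    fun h' => hc.not_adj₃ (hadj _ _ h')⟩

end Net

namespace Graph

/-- The four ways to label the half-edges of a sequence of dipoles by sides and rails, up to the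
order of the sequence. -/
theorem IsDipoleSeq.translate {n : ℕ} {G : Graph Bubble n} {l : List Color} {A : Set G.V}
    {p : Pos → G.H} (h : IsDipoleSeq G l A p) (t : Pos) :
    ∃ l', l' ≠ [] ∧ IsDipoleSeq G l' A fun x => p (x + t) := by
  obtain ⟨σ, r⟩ := t
  have key : ∀ l, IsDipoleSeq G l A p → ∃ l', l' ≠ [] ∧ IsDipoleSeq G l' A fun x => p (x + (σ, 0)) := by
    intro l h
    rcases zmod_two_cases σ with rfl | rfl
    · refine ⟨l, h.ne_nil, ?_⟩
      rwa [show (fun x : Pos => p (x + (0, 0))) = p from funext fun x => congrArg p (add_zero x)]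
    · exact ⟨_, h.swap_sides.ne_nil, h.swap_sides⟩
  obtain ⟨l', -, h'⟩ := key l h
  rcases zmod_two_cases r with rfl | rfl
  · exact ⟨l', h'.ne_nil, h'⟩
  · refine ⟨l', h'.ne_nil, ?_⟩
    have := h'.swap_rails
    simp only [add_assoc, Prod.mk_add_mk, zero_add, add_zero] at this
    exact this

/-- In a graph without melons, no side of a sequence of dipoles is closed by an edge. -/
theorem IsDipoleSeq.E_ne_of_not_melonRemoval {G : TwoPointGraph} {l : List Color} {A : Set G.V}
    {p : Pos → G.H} (h : IsDipoleSeq G l A p) (hG : ¬ ∃ G', MelonRemoval G G') (σ r : ZMod 2) :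
    G.E (p (σ, r)) ≠ p (σ, r + 1) := by
  intro e
  obtain ⟨l', -, h'⟩ := h.translate (σ, r)
  obtain ⟨i, A', p', hd, hp⟩ := h'.exists_first
  refine hG (hd.exists_melonRemoval ?_)
  rw [hp, hp]
  simpa [add_comm] using e

namespace Replacement

variable {G : TwoPointGraph} {S : SchemeGraph} {A : S.V → Set G.V} {P : S.V → Pos → G.H}

theorem exists_eq_at' (R : Replacement G S A P) (s : S.V) (x : Pos) :
    ∃ v ∈ A s, ∃ y, P s x = G.at' v y := by
  by_cases hs : s ∈ S.chainNodes
  · obtain ⟨l, hl⟩ := R.exists_maximal hs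
    exact hl.1.1.exists_eq_at' x
  · obtain ⟨b, hb⟩ := notMem_chainNodes.1 hs
    obtain ⟨v, t, -, hA, hP, -⟩ := R.bubble s b hb
    exact ⟨v, by rw [hA]; rfl, _, hP x⟩

theorem eq_of_mem (R : Replacement G S A P) {s s' : S.V} {v : G.V} (h : v ∈ A s) (h' : v ∈ A s') :
    s = s' :=
  (R.exists_unique v).unique h h'

/-- The bubbles that remain in a scheme are tetrahedra. -/
theorem eq_tetra (R : Replacement G S A P) {s : S.V} {b : Bubble} (hb : S.kind s = .bubble b) :
    b = .tetra := by
  obtain ⟨v, t, hv, -, -, hc⟩ := R.bubble s b hb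
  rcases b with _ | i
  · rfl
  · exact absurd rfl (hc [i] {v} _ ⟨.single (.typeII 0 hv), Or.inr (isIsolated_pillow hv)⟩)

/-- The cut scheme has no pillow, since pillows are chains. -/
theorem kind_cutNet (R : Replacement G S A P) (h : S.H) :
    S.cutNet.kind h = some .tetra ∨ S.cutNet.kind h = none := by
  rcases h with ⟨s, x⟩ | l
  · change (S.kind s).toBubble? = _ ∨ (S.kind s).toBubble? = _
    by_cases hs : s ∈ S.chainNodes
    · exact Or.inr (mem_chainNodes_iff_toBubble?.1 hs)
    · obtain ⟨b, hb⟩ := notMem_chainNodes.1 hs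
      rw [hb, R.eq_tetra hb]
      exact Or.inl rfl
  · exact Or.inr rfl

/-- The scheme follows the edges of `G`. -/
theorem E_eq_at' (R : Replacement G S A P) {s s' : S.V} {x : Pos} {v w : G.V} {y z : Pos}
    (hv : P s x = G.at' v y) (hE : G.E (G.at' v y) = G.at' w z) (hw : w ∈ A s') :
    ∃ x', S.E (S.at' s x) = S.at' s' x' ∧ P s' x' = G.at' w z := by
  have h := R.E_eq (S.at' s x)
  have h' : G.E (P s x) = Sum.elim (fun q : S.V × Pos => P q.1 q.2) Sum.inr (S.E (S.at' s x)) := h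
  rw [hv, hE] at h'
  obtain ⟨⟨s₁, x'⟩ | l, hx'⟩ : ∃ h, S.E (S.at' s x) = h := ⟨_, rfl⟩
  · rw [hx'] at h'
    have h1 : G.at' w z = P s₁ x' := h'
    obtain ⟨u, hu, y', hy'⟩ := R.exists_eq_at' s₁ x'
    have : w = u := (at'_inj.1 (h1.trans hy')).1
    obtain rfl := R.eq_of_mem (this ▸ hu) hw
    exact ⟨x', hx', h1.symm⟩
  · rw [hx'] at h'
    exact absurd h' (by simp [at'])

/-- Two bubbles of the scheme joined by a face of length two: the corresponding dipole is not
isolated, and shares a tetrahedron with another dipole. The third tetrahedron is either a node of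
the scheme, or it belongs to a chain. -/
theorem exists_center_or_chain (R : Replacement G S A P) {s s' : S.V} {x x' : Pos} {c : Color}
    (hs : S.kind s = .bubble .tetra) (hs' : S.kind s' = .bubble .tetra) (hne : s ≠ s')
    (e₁ : S.E (S.at' s x) = S.at' s' x')
    (e₂ : S.E (S.at' s (x + colorVec c)) = S.at' s' (x' + colorVec c)) :
    ∃ z e, (z = s ∧ e = x ∨ z = s' ∧ e = x') ∧ ((∃ j, S.cutNet.IsCenter c j (S.at' z e)) ∨
      ∃ j, ∃ t ∈ S.chainNodes, ∃ y y' : Pos, y.1 ≠ y'.1 ∧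
        S.E (S.at' z (e + colorVec j)) = S.at' t y ∧
        S.E (S.at' z (e + colorVec j + colorVec c)) = S.at' t y') := by
  obtain ⟨v, a, hv, hA, hP, hc⟩ := R.bubble s _ hs
  obtain ⟨v', a', hv', hA', hP', -⟩ := R.bubble s' _ hs'
  have hvv' : v ≠ v' := by
    rintro rfl
    exact hne (R.eq_of_mem (v := v) (by rw [hA]; rfl) (by rw [hA']; rfl))
  have tr : ∀ {x x'}, S.E (S.at' s x) = S.at' s' x' → G.E (G.at' v (x + a)) = G.at' v' (x' + a') := by
    intro x x' h
    have h1 := R.E_eq (S.at' s x)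
    rw [h] at h1
    have h2 : G.E (P s x) = P s' x' := h1
    rwa [hP, hP'] at h2
  have h₁ := tr e₁
  have h₂ := tr e₂
  rw [add_right_comm, add_right_comm x'] at h₂
  have hiso : ¬ G.IsIsolated {v, v'} := by
    intro hiso
    obtain ⟨j, hj, -⟩ := Color.exists_third c c
    exact hc [c] {v, v'} _ ⟨.single (.typeI hv hv' hvv' hj h₁ h₂), Or.inr hiso⟩ (Or.inl rfl)
  obtain ⟨u, e₀, hu, w, d, j, hwv, hwv', hkw, hj, e₃, e₄⟩ :=
    exists_third_tetra hv hv' h₁ h₂ hiso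
  obtain ⟨t, ht, -⟩ := R.exists_unique w
  -- the shared tetrahedron is `z`, the other one is `o`
  have key : ∀ z o e f b, S.kind z = .bubble .tetra → S.kind o = .bubble .tetra → z ≠ o →
      S.E (S.at' z e) = S.at' o f → S.E (S.at' z (e + colorVec c)) = S.at' o (f + colorVec c) →
      (∀ x, P z x = G.at' u (x + b)) → e₀ = e + b → z ≠ t → o ≠ t →
      (∃ j, S.cutNet.IsCenter c j (S.at' z e)) ∨
      ∃ j, ∃ t ∈ S.chainNodes, ∃ y y' : Pos, y.1 ≠ y'.1 ∧
        S.E (S.at' z (e + colorVec j)) = S.at' t y ∧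
        S.E (S.at' z (e + colorVec j + colorVec c)) = S.at' t y' := by
    intro z o e f b hz ho hzo f₁ f₂ hPz he₀ hzt hot
    subst he₀
    obtain ⟨y, hy, hPy⟩ := R.E_eq_at' (s := z) (x := e + colorVec j)
      ((hPz _).trans (by rw [add_right_comm])) e₃ ht
    obtain ⟨y', hy', hPy'⟩ := R.E_eq_at' (s := z) (x := e + colorVec j + colorVec c)
      ((hPz _).trans (by rw [add_right_comm, add_right_comm e])) e₄ ht
    by_cases hchain : t ∈ S.chainNodes
    · -- the two edges end on the same tetrahedron of the chain, so on different sides of it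
      refine Or.inr ⟨j, t, hchain, y, y', fun hyy => ?_, hy, hy'⟩
      obtain ⟨l, hl⟩ := R.exists_maximal hchain
      obtain ⟨σ, r⟩ := y
      obtain ⟨σ', r'⟩ := y'
      obtain rfl : σ = σ' := hyy
      have hrr : r ≠ r' := by
        rintro rfl
        have := (at'_inj.1 (hPy.symm.trans hPy')).2
        exact colorVec_ne_zero c (by simpa using this)
      rcases zmod_two_cases r with rfl | rfl <;> rcases zmod_two_cases r' with rfl | rfl
      · exact hrr rfl
      · exact hl.1.1.kind_ne_tetra hPy hPy' hkw
      · exact hl.1.1.kind_ne_tetra hPy' hPy hkw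
      · exact hrr rfl
    · obtain ⟨b', hb'⟩ := notMem_chainNodes.1 hchain
      obtain rfl := R.eq_tetra hb'
      obtain ⟨w', t', hw', hAt, hPt, -⟩ := R.bubble t _ hb'
      rw [hPt] at hPy hPy'
      obtain rfl : y' = y + colorVec c := by
        have h1 := (at'_inj.1 hPy).2
        have h2 := (at'_inj.1 hPy').2
        rw [← h1, add_right_comm] at h2
        simpa using h2
      exact Or.inl ⟨j, isCenter_of_dipoles (by rw [hz]; rfl) (by rw [ho]; rfl) (by rw [hb']; rfl)
        hzo hzt hot hj f₁ f₂ hy hy'⟩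
  have hst : s ≠ t := by
    rintro rfl
    rw [hA] at ht
    exact hwv ht
  have hst' : s' ≠ t := by
    rintro rfl
    rw [hA'] at ht
    exact hwv' ht
  rcases hu with ⟨rfl, rfl⟩ | ⟨rfl, rfl⟩
  · exact ⟨s, x, Or.inl ⟨rfl, rfl⟩, key s s' x x' a hs hs' hne e₁ e₂ hP rfl hst hst'⟩
  · refine ⟨s', x', Or.inr ⟨rfl, rfl⟩, key s' s x' x a' hs' hs hne.symm ?_ ?_ hP' rfl hst' hst⟩
    · rw [← e₁, S.E_invol]
    · rw [← e₂, S.E_invol]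

theorem exists_of_kind_eq_tetra (R : Replacement G S A P) {h : S.H}
    (hk : S.cutNet.kind h = some .tetra) : ∃ s x, h = S.at' s x ∧ S.kind s = .bubble .tetra := by
  obtain (⟨s, x⟩ | l) := h
  · refine ⟨s, x, rfl, ?_⟩
    change (S.kind s).toBubble? = _ at hk
    by_cases hs : s ∈ S.chainNodes
    · rw [mem_chainNodes_iff_toBubble?.1 hs] at hk
      simp at hk
    · obtain ⟨b, hb⟩ := notMem_chainNodes.1 hs
      rw [hb, R.eq_tetra hb]
  · simp [toNet] at hk

/-- The situation around a face of length two between bubbles of the scheme. -/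
theorem isTadpole_or_center_or_chain (R : Replacement G S A P) {h : S.H} {c : Color}
    (hk : S.cutNet.kind h = some .tetra) (hk' : S.cutNet.kind (S.cutNet.E h) = some .tetra)
    (hE : S.cutNet.E (S.cutNet.X c h) = S.cutNet.X c (S.cutNet.E h)) :
    S.cutNet.IsTadpole h ∨ ∃ z e, z ∉ S.chainNodes ∧
      (S.at' z e = h ∨ S.at' z e = S.cutNet.E h) ∧ ((∃ j, S.cutNet.IsCenter c j (S.at' z e)) ∨
        ∃ j, ∃ t ∈ S.chainNodes, ∃ y y' : Pos, y.1 ≠ y'.1 ∧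
          S.E (S.at' z (e + colorVec j)) = S.at' t y ∧
          S.E (S.at' z (e + colorVec j + colorVec c)) = S.at' t y') := by
  obtain ⟨s, x, rfl, hs⟩ := R.exists_of_kind_eq_tetra hk
  obtain ⟨s', x', hsx', hs'⟩ := R.exists_of_kind_eq_tetra hk'
  have e₁ : S.E (S.at' s x) = S.at' s' x' := hsx'
  have htet : ∀ {s : S.V}, S.kind s = .bubble .tetra → (S.kind s).toBubble? = some .tetra :=
    fun h => by rw [h]; rfl
  by_cases hne : s = s'
  · subst hne
    exact Or.inl (isTadpole_of_E (htet hs) e₁)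
  have e₂ : S.E (S.at' s (x + colorVec c)) = S.at' s' (x' + colorVec c) := by
    rw [hsx'] at hE
    have h3 : S.cutNet.X c (S.at' s x) = _ := toNet_X_of_tetra (htet hs) x c
    have h4 : S.cutNet.X c (S.at' s' x') = _ := toNet_X_of_tetra (htet hs') x' c
    rw [h3, h4] at hE
    exact hE
  obtain ⟨z, e, hz, hcase⟩ := R.exists_center_or_chain hs hs' hne e₁ e₂
  refine Or.inr ⟨z, e, ?_, ?_, hcase⟩
  · rcases hz with ⟨rfl, rfl⟩ | ⟨rfl, rfl⟩
    · exact notMem_chainNodes.2 ⟨_, hs⟩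
    · exact notMem_chainNodes.2 ⟨_, hs'⟩
  · rcases hz with ⟨rfl, rfl⟩ | ⟨rfl, rfl⟩
    · exact Or.inl rfl
    · exact Or.inr hsx'.symm

end Replacement

/-! ### Connected components of the scheme with its chain-vertices cut -/

section Components

variable {S : SchemeGraph} {q : Quot S.cutNet.conn}

/-- Each side of a cut chain-vertex stays connected. -/
theorem mk_cutNet_rail {s : S.V} (hs : s ∈ S.chainNodes) (σ r r' : ZMod 2) :
    Quot.mk S.cutNet.conn (S.at' s (σ, r)) = Quot.mk _ (S.at' s (σ, r')) := by
  have key : Quot.mk S.cutNet.conn (S.at' s (σ, 0)) = Quot.mk _ (S.at' s (σ, 1)) := by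
    refine Quot.sound (Or.inr ⟨0, ?_⟩)
    rw [cutNet_X_eq, cutStep_of_mem hs]
    simp
  rcases zmod_two_cases r with rfl | rfl <;> rcases zmod_two_cases r' with rfl | rfl
  · rfl
  · exact key
  · exact key.symm
  · rfl

theorem mk_cutNet_bubble {s : S.V} (hs : s ∉ S.chainNodes) (x y : Pos) :
    Quot.mk S.cutNet.conn (S.at' s x) = Quot.mk _ (S.at' s y) := by
  obtain ⟨b, hb⟩ := notMem_chainNodes.1 hs
  exact toNet_conn_node (b := b) (by rw [hb]; rfl) x y

/-- A component of the cut scheme that contains both sides of each chain-vertex it meets is the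
whole scheme. -/
theorem mk_cutNet_eq (hq : ∀ s ∈ S.chainNodes, ∀ x y, Quot.mk _ (S.at' s x) = q →
    Quot.mk _ (S.at' s y) = q) (h : S.H) : Quot.mk _ h = q := by
  obtain ⟨h₀, hh₀⟩ := Quot.exists_rep q
  refine forall_of_connected S (Φ := fun h => Quot.mk S.cutNet.conn h = q)
    (fun h hh => (S.cutNet.conn_E h).trans hh) (fun s x y hx => ?_)
    (fun l l' hl => (toNet_conn_leg _ _ _ _ _).trans hl) hh₀ h
  by_cases hs : s ∈ S.chainNodes
  · exact hq s hs x y hx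
  · exact (mk_cutNet_bubble hs y x).trans hx

/-- In a component without legs and with at most two sides of chain-vertices, these sides belong to
different chain-vertices. -/
theorem fst_eq_of_card_pairs (hleg : ∀ l, Quot.mk _ (Sum.inr l) ≠ q)
    (hP : (S.cutNet.comp q).pairs.card ≤ 4) {s : S.V} (hs : s ∈ S.chainNodes) {y y' : Pos}
    (hy : Quot.mk _ (S.at' s y) = q) (hy' : Quot.mk _ (S.at' s y') = q) : y.1 = y'.1 := by
  classical
  by_contra hne
  have hall : ∀ x, Quot.mk S.cutNet.conn (S.at' s x) = q := by
    rintro ⟨σ, r⟩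
    have : σ = y.1 ∨ σ = y'.1 := by
      revert hne
      generalize y.1 = a; generalize y'.1 = b
      clear * -; revert σ a b; decide
    rcases this with rfl | rfl
    · exact (mk_cutNet_rail hs _ _ _).trans hy
    · exact (mk_cutNet_rail hs _ _ _).trans hy'
  let f : Pos → S.cutNet.Comp q := fun x => ⟨S.at' s x, hall x⟩
  have hf : Function.Injective f := fun a b h => (at'_inj.1 (congrArg Subtype.val h)).2
  have hsub : Finset.univ.image f ⊆ (S.cutNet.comp q).pairs := by
    intro z hz
    obtain ⟨x, -, rfl⟩ := Finset.mem_image.1 hz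
    exact Net.mem_pairs.2 (mem_chainNodes_iff_toBubble?.1 hs)
  have heq := Finset.eq_of_subset_of_card_le hsub (by
    rw [Finset.card_image_of_injective _ hf]; exact hP)
  refine hleg 0 (mk_cutNet_eq (fun t ht a b ha => ?_) _)
  have hmem : (⟨S.at' t a, ha⟩ : S.cutNet.Comp q) ∈ (S.cutNet.comp q).pairs :=
    Net.mem_pairs.2 (mem_chainNodes_iff_toBubble?.1 ht)
  rw [← heq] at hmem
  obtain ⟨x, -, hx⟩ := Finset.mem_image.1 hmem
  obtain rfl : s = t := (at'_inj.1 (congrArg Subtype.val hx)).1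
  exact hall b

variable {G : TwoPointGraph} {A : S.V → Set G.V} {P : S.V → Pos → G.H}

/-- A component of degree zero without legs contains a tetrahedron only if it meets at least three
sides of chain-vertices. -/
theorem Replacement.kind_comp_eq_none (R : Replacement G S A P)
    (hleg : ∀ l, Quot.mk _ (Sum.inr l) ≠ q) (hd : (S.cutNet.comp q).deg = 0)
    (hP : (S.cutNet.comp q).pairs.card ≤ 4) (h : S.cutNet.Comp q) :
    (S.cutNet.comp q).kind h = none := by
  classical
  refine (R.kind_cutNet h.1).resolve_left fun ht => ?_
  obtain ⟨c, h, h4, hall⟩ := Net.exists_card_orb_eq_four (S.cutNet.comp_comps q) hd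
    (fun h => R.kind_cutNet h.1) (t := h) ht hP
  have hself : h ∈ (S.cutNet.comp q).orb c h := self_mem_cls _ _
  rcases R.isTadpole_or_center_or_chain (hall h hself)
    (hall _ ((S.cutNet.comp q).E_mem_orb hself))
    (congrArg Subtype.val ((S.cutNet.comp q).E_X_eq_of_card h4)) with hT | ⟨z, e, hz, hze, hcase⟩
  · exact Net.not_isTadpole hd h (Net.comp_isTadpole hT)
  have hzq : Quot.mk _ (S.at' z e) = q := by
    rcases hze with hze | hze <;> rw [hze]
    · exact h.2
    · exact (S.cutNet.conn_E _).trans h.2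
  rcases hcase with ⟨j, hj⟩ | ⟨j, t, ht, y, y', hyy, f₁, f₂⟩
  · exact Net.not_isCenter hd c j ⟨S.at' z e, hzq⟩ (Net.comp_isCenter hj)
  · refine hyy (fst_eq_of_card_pairs hleg hP ht ?_ ?_)
    · rw [← f₁]
      exact (S.cutNet.conn_E _).trans ((mk_cutNet_bubble hz _ _).trans hzq)
    · rw [← f₂]
      exact (S.cutNet.conn_E _).trans ((mk_cutNet_bubble hz _ _).trans hzq)

/-- A component of degree zero without legs meets at least three sides of chain-vertices. -/
theorem Replacement.five_le_card_pairs (R : Replacement G S A P)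
    (hG : ¬ ∃ G', MelonRemoval G G') (hleg : ∀ l, Quot.mk _ (Sum.inr l) ≠ q)
    (hd : (S.cutNet.comp q).deg = 0) : 5 ≤ (S.cutNet.comp q).pairs.card := by
  classical
  by_contra hP
  have hP : (S.cutNet.comp q).pairs.card ≤ 4 := by omega
  have hnode : ∀ h, Quot.mk S.cutNet.conn h = q → ∃ s ∈ S.chainNodes, ∃ x, h = S.at' s x := by
    rintro (⟨s, x⟩ | l) hh
    · exact ⟨s, mem_chainNodes_iff_toBubble?.2 (R.kind_comp_eq_none hleg hd hP ⟨_, hh⟩), x, rfl⟩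
    · exact absurd hh (hleg l)
  have hEq : ∀ h, Quot.mk S.cutNet.conn h = q → Quot.mk S.cutNet.conn (S.E h) = q :=
    fun h hh => (S.cutNet.conn_E h).trans hh
  obtain ⟨h₀, hh₀⟩ := Quot.exists_rep q
  obtain ⟨s, hs, ⟨σ, r⟩, rfl⟩ := hnode h₀ hh₀
  obtain ⟨s', hs', ⟨σ', r'⟩, hE⟩ := hnode _ (hEq _ hh₀)
  have hh₁ : Quot.mk _ (S.at' s (σ, r + 1)) = q := (mk_cutNet_rail hs _ _ _).trans hh₀
  have hh₀' : Quot.mk _ (S.at' s' (σ', r')) = q := by rw [← hE]; exact hEq _ hh₀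
  have hh₁' : Quot.mk _ (S.at' s' (σ', r' + 1)) = q := (mk_cutNet_rail hs' _ _ _).trans hh₀'
  have hlift : ∀ {s s' x x'}, S.E (S.at' s x) = S.at' s' x' → G.E (P s x) = P s' x' := by
    intro s s' x x' h
    have h1 := R.E_eq (S.at' s x)
    rw [h] at h1
    exact h1
  have hr1 : ∀ r : ZMod 2, r ≠ r + 1 := by decide
  obtain ⟨l, hl⟩ := R.exists_maximal hs
  obtain ⟨l', hl'⟩ := R.exists_maximal hs'
  -- the component consists of one or two sides of chain-vertices: a single side would be closed
  -- by an edge, and two sides would merge two maximal chains into a longer one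
  by_cases hss : s = s'
  · subst hss
    obtain rfl : σ = σ' := fst_eq_of_card_pairs hleg hP hs hh₀ hh₀'
    obtain rfl : r' = r + 1 := by
      have : r' ≠ r := by
        rintro rfl
        exact S.E_ne _ hE
      clear * - this
      revert r r'; decide
    exact hl.1.1.E_ne_of_not_melonRemoval hG σ r (hlift hE)
  · -- the other rail joins the same two sides
    have hE1 : S.E (S.at' s (σ, r + 1)) = S.at' s' (σ', r' + 1) := by
      let B : Finset (S.cutNet.Comp q) :=
        {⟨_, hh₀⟩, ⟨_, hh₁⟩, ⟨_, hh₀'⟩, ⟨_, hh₁'⟩}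
      have hB : B ⊆ (S.cutNet.comp q).pairs := by
        intro z _
        exact Net.mem_pairs.2 (R.kind_comp_eq_none hleg hd hP z)
      have hcard : B.card = 4 := by
        simp [B, Finset.card_insert_of_notMem, at'_inj, hss, hr1]
      have heq := Finset.eq_of_subset_of_card_le hB (by rw [hcard]; exact hP)
      have hmem : (⟨_, hEq _ hh₁⟩ : S.cutNet.Comp q) ∈ B := by
        rw [heq]
        exact Net.mem_pairs.2 (R.kind_comp_eq_none hleg hd hP _)
      simp only [B, Finset.mem_insert, Finset.mem_singleton, Subtype.mk.injEq] at hmem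
      rcases hmem with h | h | h | h
      · have : S.E (S.at' s (σ, r)) = S.at' s (σ, r + 1) := by rw [← h, S.E_invol]
        rw [hE] at this
        exact absurd (at'_inj.1 this).1.symm hss
      · exact absurd h (S.E_ne _)
      · rw [← hE] at h
        have h' := congrArg S.E h
        rw [S.E_invol, S.E_invol, at'_inj] at h'
        exact absurd (Prod.ext_iff.1 h'.2).2.symm (hr1 r)
      · exact h
    obtain ⟨l₁, hl₁, hp⟩ := hl.1.1.translate (σ + 1, r)
    obtain ⟨l₂, hl₂, hp'⟩ := hl'.1.1.translate (σ', r')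
    have hdis : Disjoint (A s) (A s') := Set.disjoint_left.2 fun v hv hv' => hss (R.eq_of_mem hv hv')
    have happ := hp.append hp' hdis (by
      intro τ
      have h2 : (1 : ZMod 2) + (σ + 1) = σ := by clear * -; revert σ; decide
      simp only [Prod.mk_add_mk, h2, zero_add]
      rcases zmod_two_cases τ with rfl | rfl
      · simpa using hlift hE
      · rw [add_comm 1 r, add_comm 1 r']
        exact hlift hE1)
    refine hl.2 (l₁ ++ l₂) (A s ∪ A s') _ ⟨happ, Or.inl ?_⟩ ?_
    · have h1 := List.length_pos_of_ne_nil hl₁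
      have h2 := List.length_pos_of_ne_nil hl₂
      rw [List.length_append]
      omega
    · refine ⟨Set.subset_union_left, fun h => ?_⟩
      obtain ⟨v, hv, -⟩ := R.exists_eq_at' s' 0
      exact Set.disjoint_left.1 hdis (h (Or.inr hv)) hv

end Components

end Graph

namespace Graph

section Count

variable {G : TwoPointGraph} {S : SchemeGraph} {A : S.V → Set G.V} {P : S.V → Pos → G.H}

/-! ### The number of chain-vertices -/

/-- The total weight of the bubbles of a component is a half-integer. -/
theorem Replacement.exists_sum_weight_comp (R : Replacement G S A P) (q : Quot S.cutNet.conn) :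
    ∃ m : ℕ, ∑ h, halfEdgeWeight ((S.cutNet.comp q).kind h) = m / 2 := by
  classical
  have h1 : ∑ h, halfEdgeWeight ((S.cutNet.comp q).kind h) =
      ∑ h, if Quot.mk _ h = q then halfEdgeWeight (S.cutNet.kind h) else 0 := by
    rw [← Finset.sum_filter]
    exact Finset.sum_bij (fun (v : S.cutNet.Comp q) _ => v.1) (fun v _ => by simpa using v.2)
      (fun _ _ _ _ h => Subtype.ext h)
      (fun w hw => ⟨⟨w, by simpa using hw⟩, Finset.mem_univ _, rfl⟩) (fun _ _ => rfl)
  have h2 : ∀ s, ∃ n : ℕ, ∑ x, (if Quot.mk _ (S.at' s x) = q then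
      halfEdgeWeight (S.cutNet.kind (S.at' s x)) else 0) = (n : ℚ) / 2 := by
    intro s
    by_cases hs : s ∈ S.chainNodes
    · refine ⟨0, ?_⟩
      have : ∀ x, S.cutNet.kind (S.at' s x) = none := fun x => mem_chainNodes_iff_toBubble?.1 hs
      simp [this, halfEdgeWeight]
    · obtain ⟨b, hb⟩ := notMem_chainNodes.1 hs
      have hk : ∀ x, S.cutNet.kind (S.at' s x) = some .tetra := fun x => by
        change (S.kind s).toBubble? = _
        rw [hb, R.eq_tetra hb]; rfl
      have hc : ∀ x, Quot.mk S.cutNet.conn (S.at' s x) = Quot.mk _ (S.at' s 0) :=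
        fun x => mk_cutNet_bubble hs x 0
      simp only [hk, hc, Finset.sum_const, Finset.card_univ, nsmul_eq_mul]
      have h4 : Fintype.card Pos = 4 := rfl
      rw [h4]
      split_ifs
      · exact ⟨3, by norm_num [halfEdgeWeight]⟩
      · exact ⟨0, by norm_num⟩
  choose n hn using h2
  refine ⟨∑ s, n s, ?_⟩
  rw [h1, Fintype.sum_sum_type, Fintype.sum_prod_type]
  have h3 : ∑ l : Fin 2, (if Quot.mk S.cutNet.conn (Sum.inr l) = q then
      halfEdgeWeight (S.cutNet.kind (Sum.inr l)) else 0) = 0 :=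
    Finset.sum_eq_zero fun l _ => by
      have : halfEdgeWeight (S.cutNet.kind (Sum.inr l)) = 0 := rfl
      rw [this, ite_self]
  rw [h3, add_zero]
  push_cast
  rw [Finset.sum_div]
  exact Finset.sum_congr rfl fun s _ => hn s

open scoped Classical in
variable (S) in
/-- The half-edges of the chain-vertices. -/
noncomputable def chainHalfEdges : Finset S.H :=
  (S.chainNodes ×ˢ (Finset.univ : Finset Pos)).image fun q => S.at' q.1 q.2

theorem mem_chainHalfEdges {h : S.H} :
    h ∈ S.chainHalfEdges ↔ ∃ s ∈ S.chainNodes, ∃ x, S.at' s x = h := by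
  simp [chainHalfEdges]

theorem card_chainHalfEdges : S.chainHalfEdges.card = S.chainNodes.card * 4 := by
  classical
  rw [chainHalfEdges, Finset.card_image_of_injective, Finset.card_product]
  · rfl
  · intro a b h
    exact Prod.ext (at'_inj.1 h).1 (at'_inj.1 h).2

open scoped Classical in
/-- By connectedness, each component meets a side of a chain-vertex. -/
theorem two_le_card_chainHalfEdges (hm : S.chainNodes.Nonempty) (q : Quot S.cutNet.conn) :
    2 ≤ (S.chainHalfEdges.filter fun h => Quot.mk _ h = q).card := by
  obtain ⟨s, hs, ⟨σ, r⟩, hx⟩ : ∃ s ∈ S.chainNodes, ∃ x, Quot.mk _ (S.at' s x) = q := by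
    by_contra hcon
    push Not at hcon
    obtain ⟨s, hs⟩ := hm
    exact hcon s hs 0 (mk_cutNet_eq (fun t ht x _ h => absurd h (hcon t ht x)) _)
  have hne : S.at' s (σ, 0) ≠ S.at' s (σ, 1) := fun e => by
    have := (at'_inj.1 e).2
    simp at this
  refine (Finset.card_pair hne).ge.trans (Finset.card_le_card fun y hy => ?_)
  simp only [Finset.mem_insert, Finset.mem_singleton] at hy
  rw [Finset.mem_filter, mem_chainHalfEdges]
  rcases hy with rfl | rfl
  · exact ⟨⟨s, hs, _, rfl⟩, (mk_cutNet_rail hs _ _ _).trans hx⟩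
  · exact ⟨⟨s, hs, _, rfl⟩, (mk_cutNet_rail hs _ _ _).trans hx⟩

open scoped Classical in
/-- The component of the legs meets one side at least, the other components of degree zero meet
three, and the remaining ones have degree at least one half. -/
theorem Replacement.le_card_chainHalfEdges (R : Replacement G S A P)
    (hG : ¬ ∃ G', MelonRemoval G G') (hm : S.chainNodes.Nonempty) (q : Quot S.cutNet.conn) :
    (5 : ℚ) - 3 * (if Quot.mk _ (Sum.inr 0) = q then 1 else 0) - 6 * (S.cutNet.comp q).deg ≤
      (S.chainHalfEdges.filter fun h => Quot.mk _ h = q).card := by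
  have h2 : (2 : ℚ) ≤ (S.chainHalfEdges.filter fun h => Quot.mk _ h = q).card := by
    exact_mod_cast two_le_card_chainHalfEdges hm q
  have hd := (S.cutNet.comp q).deg_nonneg
  split_ifs with hq
  · linarith
  · have hleg : ∀ l, Quot.mk _ (Sum.inr l) ≠ q := fun l h =>
      hq ((toNet_conn_leg _ _ _ _ _).trans h)
    rcases hd.eq_or_lt with h0 | hpos
    · have h5 := R.five_le_card_pairs hG hleg h0.symm
      have : (S.cutNet.comp q).pairs.card ≤
          (S.chainHalfEdges.filter fun h => Quot.mk _ h = q).card := by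
        refine Finset.card_le_card_of_injOn (fun h => h.1) ?_ fun _ _ _ _ h => Subtype.ext h
        rintro ⟨h, hh⟩ hp
        have hp' : S.cutNet.kind h = none := (Net.mem_pairs (N := S.cutNet.comp q)).1 hp
        rw [Finset.mem_coe, Finset.mem_filter, mem_chainHalfEdges]
        refine ⟨?_, hh⟩
        obtain (⟨s, x⟩ | l) := h
        · exact ⟨s, mem_chainNodes_iff_toBubble?.2 hp', x, rfl⟩
        · exact absurd hh (hleg l)
      have : (5 : ℚ) ≤ (S.chainHalfEdges.filter fun h => Quot.mk _ h = q).card := by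
        exact_mod_cast h5.trans this
      linarith
    · obtain ⟨k, hk⟩ := (S.cutNet.comp q).deg_mem_half (R.exists_sum_weight_comp q)
      have : (1 : ℚ) ≤ k := by
        have h1 : (0 : ℚ) < k := by rw [hk] at hpos; linarith
        have h1 : 0 < k := by exact_mod_cast h1
        exact_mod_cast h1
      linarith

/-- The number of chain-vertices of a scheme is bounded in terms of its degree. -/
theorem Replacement.card_chainNodes_le (R : Replacement G S A P)
    (hG : ¬ ∃ G', MelonRemoval G G') :
    S.chainNodes.card = 0 ∨ (S.chainNodes.card : ℚ) ≤ 6 * G.degree - 2 := by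
  classical
  rcases S.chainNodes.eq_empty_or_nonempty with h0 | hm
  · exact Or.inl (by rw [h0]; rfl)
  right
  have : Fintype (Quot S.cutNet.conn) := Fintype.ofFinite _
  have h1 := Finset.sum_le_sum fun (q : Quot S.cutNet.conn) (_ : q ∈ Finset.univ) =>
    R.le_card_chainHalfEdges hG hm q
  rw [Finset.sum_sub_distrib, Finset.sum_sub_distrib, ← Finset.mul_sum, ← Finset.mul_sum,
    Finset.sum_ite_eq, if_pos (Finset.mem_univ _), ← Net.deg_eq_sum_comp] at h1
  have h2 : ∑ q : Quot S.cutNet.conn,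
      ((S.chainHalfEdges.filter fun h => Quot.mk _ h = q).card : ℚ) = S.chainNodes.card * 4 := by
    have h := Finset.card_eq_sum_card_fiberwise (s := S.chainHalfEdges) (t := Finset.univ)
      (f := fun h : S.H => Quot.mk S.cutNet.conn h) fun _ _ => Finset.mem_univ _
    rw [card_chainHalfEdges] at h
    exact_mod_cast h.symm
  have h3 : (S.cutNet.comps : ℚ) = Fintype.card (Quot S.cutNet.conn) := by
    rw [Net.comps, Nat.card_eq_fintype_card]
  simp only [Finset.sum_const, Finset.card_univ, nsmul_eq_mul] at h1
  rw [h2, ← h3] at h1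
  have h4 := R.deg_cutNet_le
  have h5 : (S.cutNet.comps : ℚ) ≤ S.chainNodes.card + 1 := by
    exact_mod_cast (Graph.deg_cutNet_le (S := S)).2
  -- `5 k - 3 - 6 deg ≤ 4 m`, where `deg ≤ ω - 1 - m + k` and `k ≤ m + 1` for `m` chain-vertices
  -- and `k` components
  linarith

/-! ### The size of a scheme -/

open scoped Classical in
/-- The size lemma for the cut scheme: a face of length two between tetrahedra is close to a
chain-vertex, unless it is on a tadpole or on overlapping dipoles. -/
theorem Replacement.card_half_edges_le (R : Replacement G S A P) :
    (Fintype.card S.H : ℚ) ≤ Net.sizeBound (16 * S.chainNodes.card + 8) S.cutNet.deg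
      S.cutNet.comps := by
  set N := S.cutNet with hN
  have hpairs : N.pairs.card ≤ S.chainNodes.card * 4 + 2 := by
    have hsub : N.pairs ⊆ S.chainHalfEdges ∪ (Finset.univ : Finset (Fin 2)).image Sum.inr := by
      intro h hh
      have hh' := Net.mem_pairs.1 hh
      obtain (⟨s, x⟩ | l) := h
      · exact Finset.mem_union_left _ (mem_chainHalfEdges.2
          ⟨s, mem_chainNodes_iff_toBubble?.2 hh', x, rfl⟩)
      · exact Finset.mem_union_right _ (Finset.mem_image_of_mem _ (Finset.mem_univ _))
    refine (Finset.card_le_card hsub).trans ((Finset.card_union_le _ _).trans ?_)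
    rw [card_chainHalfEdges]
    exact Nat.add_le_add_left Finset.card_image_le _
  -- the half-edges of the pairs, and the half-edges of the tetrahedra attached to them
  let Z : Finset S.H := N.pairs ∪
    (Finset.univ : Finset Color).biUnion fun j => N.pairs.image fun h => N.X j (N.E h)
  have hZ : Z.card ≤ 4 * N.pairs.card := by
    have h1 : ((Finset.univ : Finset Color).biUnion fun j =>
        N.pairs.image fun h => N.X j (N.E h)).card ≤ 3 * N.pairs.card :=
      Finset.card_biUnion_le_card_mul _ _ _ fun _ _ => Finset.card_image_le
    refine (Finset.card_union_le _ _).trans ?_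
    omega
  refine (N.card_le Z ?_ ?_).trans (Net.sizeBound_mono ?_ le_rfl le_rfl)
  · intro h hk
    exact Finset.mem_union_left _ (Net.mem_pairs.2 ((R.kind_cutNet h).resolve_left hk))
  · intro c h h4
    by_cases hall : ∃ y ∈ N.orb c h, N.kind y = none
    · obtain ⟨y, hy, hy'⟩ := hall
      exact ⟨y, hy, Or.inl (Finset.mem_union_left _ (Net.mem_pairs.2 hy'))⟩
    push Not at hall
    have htet : ∀ y ∈ N.orb c h, N.kind y = some .tetra := fun y hy =>
      (R.kind_cutNet y).resolve_right (hall y hy)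
    have hself : h ∈ N.orb c h := self_mem_cls _ _
    rcases R.isTadpole_or_center_or_chain (htet h hself) (htet _ (N.E_mem_orb hself))
      (N.E_X_eq_of_card h4) with hT | ⟨z, e, hz, hze, hcase⟩
    · exact ⟨h, hself, Or.inr (Or.inl hT)⟩
    have hmem : S.at' z e ∈ N.orb c h := by
      rcases hze with hze | hze <;> rw [hze]
      · exact hself
      · exact N.E_mem_orb hself
    refine ⟨_, hmem, ?_⟩
    rcases hcase with ⟨j, hj⟩ | ⟨j, t, ht, y, y', -, f₁, -⟩
    · exact Or.inr (Or.inr ⟨j, hj⟩)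
    · refine Or.inl (Finset.mem_union_right _ (Finset.mem_biUnion.2 ⟨j, Finset.mem_univ _,
        Finset.mem_image.2 ⟨S.at' t y, Net.mem_pairs.2 (mem_chainNodes_iff_toBubble?.1 ht), ?_⟩⟩))
      have hX : N.X j (S.at' z e) = S.at' z (e + colorVec j) :=
        toNet_X_of_tetra (show (S.kind z).toBubble? = some .tetra from htet _ hmem) e j
      have hE : N.E (S.at' t y) = S.at' z (e + colorVec j) := by
        rw [← f₁]; exact S.E_invol _
      rw [hE, ← hX, N.X_invol]
  · have : (Z.card : ℚ) ≤ (4 * (S.chainNodes.card * 4 + 2) : ℕ) := by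
      exact_mod_cast hZ.trans (Nat.mul_le_mul_left 4 hpairs)
    push_cast at this
    linarith

end Count

theorem degree_nonneg (G : TwoPointGraph) : 0 ≤ G.degree := by
  rw [degree_eq_deg _ twoPoint_legs]
  exact Net.deg_nonneg _

end Graph

open QuarticTensor.Graph

theorem IsSchemeOfDegree.chainNodes_le {ω : ℚ} {S : SchemeGraph} (h : IsSchemeOfDegree ω S) :
    S.chainNodes.card = 0 ∨ (S.chainNodes.card : ℚ) ≤ 6 * ω - 2 := by
  obtain ⟨G, rfl, G₀, hG₀, hS⟩ := h
  obtain ⟨A, P, R⟩ := exists_replacement hS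
  have h1 := degree_le_of_isMelonFreeCore hG₀
  refine (R.card_chainNodes_le hG₀.2).imp_right fun h => ?_
  linarith

theorem IsSchemeOfDegree.card_le {ω : ℚ} {S : SchemeGraph} (h : IsSchemeOfDegree ω S) :
    Fintype.card S.V ≤ ⌈Net.sizeBound (96 * ω + 8) ω (6 * ω + 1)⌉₊ := by
  have hm := h.chainNodes_le
  obtain ⟨G, rfl, G₀, hG₀, hS⟩ := h
  obtain ⟨A, P, R⟩ := exists_replacement hS
  have h0 := G.degree_nonneg
  have h1 := degree_le_of_isMelonFreeCore hG₀
  have hm' : (S.chainNodes.card : ℚ) ≤ 6 * G.degree := by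
    rcases hm with hm | hm
    · rw [hm]; push_cast; linarith
    · linarith
  have h2 := R.deg_cutNet_le
  have h3 : (S.cutNet.comps : ℚ) ≤ S.chainNodes.card + 1 := by
    exact_mod_cast (Graph.deg_cutNet_le (S := S)).2
  have h4 := R.card_half_edges_le.trans (Net.sizeBound_mono
    (z' := 96 * G.degree + 8) (d' := G.degree) (k' := 6 * G.degree + 1) (by linarith)
    (by linarith) (by linarith))
  have h5 : Fintype.card S.H = Fintype.card S.V * 4 + 2 := by
    rw [Fintype.card_sum, Fintype.card_prod]; rfl
  have h6 : Fintype.card S.H ≤ ⌈Net.sizeBound (96 * G.degree + 8) G.degree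
      (6 * G.degree + 1)⌉₊ := by
    exact_mod_cast h4.trans (Nat.le_ceil _)
  omega

/-! ### Finiteness of the set of schemes -/

instance : Finite SchemeNode := by
  let f : (Option Color ⊕ Option Color) → SchemeNode := Sum.elim
    (fun o => o.elim (.bubble .tetra) fun i => .bubble (.pillow i)) fun o => o.elim .broken .chain
  refine Finite.of_surjective f ?_
  rintro ((_ | i) | i | _)
  · exact ⟨Sum.inl none, rfl⟩
  · exact ⟨Sum.inl (some i), rfl⟩
  · exact ⟨Sum.inr (some i), rfl⟩
  · exact ⟨Sum.inr none, rfl⟩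

/-- The properties required from the edges of color `0` of a graph. -/
def IsEdgeMap {V : Type} {n : ℕ} (E : (V × Pos) ⊕ Fin n → (V × Pos) ⊕ Fin n) : Prop :=
  (∀ h, E (E h) = h) ∧ (∀ h, E h ≠ h) ∧ Nonempty ((V × Pos) ⊕ Fin n) ∧
    ∀ h h' : (V × Pos) ⊕ Fin n, Relation.EqvGen
      (fun x y => E x = y ∨ Sum.elim (fun p => some p.1) (fun _ => none) x =
          (Sum.elim (fun p => some p.1) (fun _ => none) y : Option V)) h h'

/-- There are finitely many graphs with a bounded number of nodes, up to isomorphism. -/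
theorem finite_isoClasses (K : Type) [Finite K] (n N : ℕ) :
    {s : Quotient (isoSetoid K n) | ∃ G : Graph K n, Fintype.card G.V ≤ N ∧
      Quotient.mk _ G = s}.Finite := by
  -- graphs whose nodes are numbered
  let D : Type := Σ k : Fin (N + 1), (Fin k → K) ×
    {E : (Fin k × Pos) ⊕ Fin n → (Fin k × Pos) ⊕ Fin n // IsEdgeMap E}
  let g : D → Quotient (isoSetoid K n) := fun d => Quotient.mk _
    { V := Fin d.1, finite := inferInstance, kind := d.2.1, E := d.2.2.1,
      E_invol := d.2.2.2.1, E_ne := d.2.2.2.2.1, nonempty := d.2.2.2.2.2.1,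
      connected := d.2.2.2.2.2.2 }
  have : Finite D := inferInstance
  refine (Set.finite_range g).subset ?_
  rintro _ ⟨G, hG, rfl⟩
  let φ : G.V ≃ Fin (Fintype.card G.V) := Fintype.equivFin _
  let ψ : G.H ≃ (Fin (Fintype.card G.V) × Pos) ⊕ Fin n :=
    Equiv.sumCongr (Equiv.prodCongr φ (Equiv.refl _)) (Equiv.refl _)
  let E : (Fin (Fintype.card G.V) × Pos) ⊕ Fin n → (Fin (Fintype.card G.V) × Pos) ⊕ Fin n :=
    fun h => ψ (G.E (ψ.symm h))
  have hE : IsEdgeMap E := by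
    refine ⟨fun h => by simp [E, G.E_invol], fun h e => ?_, G.nonempty.map ψ, fun h h' => ?_⟩
    · have : G.E (ψ.symm h) = ψ.symm h :=
        ψ.injective (by rw [ψ.apply_symm_apply]; exact e)
      exact G.E_ne _ this
    · rw [← ψ.apply_symm_apply h, ← ψ.apply_symm_apply h']
      have hc := G.connected (ψ.symm h) (ψ.symm h')
      generalize ψ.symm h = a at hc
      generalize ψ.symm h' = b at hc
      induction hc with
      | rel x y hxy =>
        refine .rel _ _ ?_
        rcases hxy with rfl | hxy
        · exact Or.inl (by simp [E])
        · refine Or.inr ?_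
          obtain (⟨v, x⟩ | l) := x <;> obtain (⟨w, y⟩ | l') := y <;> simp at hxy <;> simp [ψ, hxy]
      | refl x => exact .refl _
      | symm x y _ ih => exact ih.symm
      | trans x y z _ _ ih1 ih2 => exact ih1.trans _ _ _ ih2
  refine ⟨⟨⟨Fintype.card G.V, by omega⟩, G.kind ∘ φ.symm, E, hE⟩, Quotient.sound ?_⟩
  refine Iso.symm ⟨φ, fun _ => 0, fun v => by simp, fun h => ?_⟩
  have key : ∀ h : G.H, (Sum.map (fun p : G.V × Pos => (φ p.1, p.2 + 0)) id h :
      (Fin (Fintype.card G.V) × Pos) ⊕ Fin n) = ψ h := by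
    rintro (⟨v, x⟩ | l) <;> simp [ψ]
  refine (congrArg E (key h)).trans (Eq.trans ?_ (key (G.E h)).symm)
  simp [E]

theorem finite_schemesOfDegree (ω : ℚ) : (schemesOfDegree ω).Finite :=
  (finite_isoClasses SchemeNode 2 ⌈Net.sizeBound (96 * ω + 8) ω (6 * ω + 1)⌉₊).subset
    fun _ ⟨S, hS, hs⟩ => ⟨S, hS.card_le, hs⟩

end QuarticTensor

theorem mainTheorem4 :
    (∀ ω : ℚ, (∃ m : ℕ, ω = (m : ℚ) / 2) →
      (QuarticTensor.schemesOfDegree ω).Finite ∧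
      (0 < ω → ∀ S : QuarticTensor.SchemeGraph, QuarticTensor.IsSchemeOfDegree ω S →
        (QuarticTensor.numChainVertices S : ℚ) ≤ 7 * ω - 1)) ∧
    (∀ (ω : ℚ) (k : ℕ), ∃ N : ℕ, ∀ G : QuarticTensor.VacuumGraph,
      G.degree = ω → G.numIsolatedDipoles = k → Nat.card G.V ≤ N) := by
  refine ⟨fun ω hω => ⟨QuarticTensor.finite_schemesOfDegree ω, fun hpos S hS => ?_⟩,
    QuarticTensor.Graph.exists_card_le_of_isolated⟩
  rw [← QuarticTensor.Graph.card_chainNodes]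
  -- either there is no chain-vertex and `ω ≥ 1 / 2`, or there are at most `6 ω - 2` of them
  rcases hS.chainNodes_le with h | h
  · obtain ⟨m, rfl⟩ := hω
    have h1 : (0 : ℚ) < m := by linarith
    have h1 : 0 < m := by exact_mod_cast h1
    have h2 : (1 : ℚ) ≤ m := by exact_mod_cast h1
    rw [h]
    push_cast
    linarith
  · linarith
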